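/- Let $M$ be a smooth manifold (Hausdorff, $\sigma$-compact, finite-dimensional, without boundary), with complexified tangent bundle $TM$ and complexified cotangent bundle $\mathcal E^1$. An involutive structure $\mathcal E$ on $M$ is a smooth complex sub-bundle $T^{0,1}_{\mathcal E}\subset TM$ whose smooth sections are closed under the Lie bracket; $\mathcal E^{1,0}\subset\mathcal E^1$ is its annihilator, $\mathcal E^{0,1}=\mathcal E^1/\mathcal E^{1,0}$, $\mathcal E^{0,q}=\wedge^q\mathcal E^{0,1}$, and $\bar\partial f$ is the class of $df$ in $\mathcal E^{0,1}$. An $\mathcal E$-compatible structure on a smooth complex vector bundle $W$ of finite rank is a $\mathbb C$-linear operator $\bar\partial:\Gamma(W)\to\Gamma(\mathcal E^{0,1}\otimes W)$ with $\bar\partial(fs)=\bar\partial f\otimes s+f\,\bar\partial s$ whose extension $\bar\partial:\Gamma(\mathcal E^{0,q}\otimes W)\to\Gamma(\mathcal E^{0,q+1}\otimes W)$, $q\ge 0$, satisfies $\bar\partial^2=0$; $H^q_{\mathcal E,c}(M,W)$ is the cohomology of the complex $(\Gamma_c(M,\mathcal E^{0,\bullet}\otimes W),\bar\partial)$ of compactly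 supported smooth sections. Let $\mathcal A^{1,0}\subset\mathcal E^{1,0}$ be two involutive structures on $M$, let $V\to M$ be an $\mathcal A$-compatible smooth complex vector bundle with operator $\bar\partial_{\mathcal A}$, and set $B^1=\mathcal E^{1,0}/\mathcal A^{1,0}\subset\mathcal A^{0,1}$ and $B^p=\wedge^pB^1\subset\mathcal A^{0,p}$. Let $F^p\Gamma_c(M,\mathcal A^{0,n}\otimes V)$ be the space of compactly supported smooth sections of the sub-bundle $(\mathcal A^{0,n-p}\wedge B^p)\otimes V$ (zero if $p>n$), and let the leading part of such a section be its image under the bundle map $(\mathcal A^{0,n-p}\wedge B^p)\otimes V\to\mathcal E^{0,n-p}\otimes B^p\otimes V$, $(\alpha\wedge\beta)\otimes v\mapsto\bar\alpha\otimes\beta\otimes v$ (also used for sections without compact support). Then: 1. For every $p\ge 0$ there is exactly one $\mathcal E$-compatible structure on $B^p\otimes V$ such that for every $w\in\Gamma(M,B^p\otimes V)\subset\Gamma(M,\mathcal A^{0,p}\otimes V)$ the section $\bar\partial_{\mathcal E}w$ is the leading part of $\bar\partial_{\mathcal A}w$. (For $p=0$ this says that $V$ is $\mathcal E$-compatible.)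 2. The $F^p$ form a decreasing filtration of $(\Gamma_c(M,\mathcal A^{0,\bullet}\otimes V),\bar\partial_{\mathcal A})$ by subcomplexes, with $F^0$ the whole complex and $F^{n+1}=0$ in degree $n$. 3. The spectral sequence of this filtered complex, i.e. the first-quadrant cohomological spectral sequence with $E_r^{p,q}=Z_r^p/(Z_{r-1}^{p+1}+\bar\partial_{\mathcal A}Z_{r-1}^{p-r+1})$ in total degree $p+q$ for $r\ge1$, where $Z_r^p=\{\eta\in F^p:\bar\partial_{\mathcal A}\eta\in F^{p+r}\}$, with differentials $d_r:E_r^{p,q}\to E_r^{p+r,q-r+1}$ induced by $\bar\partial_{\mathcal A}$, has $$E_1^{p,q}\cong H^q_{\mathcal E,c}(M,B^p\otimes V)\Longrightarrow H^{p+q}_{\mathcal A,c}(M,V).$$ Here the isomorphism maps the class of $\eta$ to the cohomology class of the leading part of $\eta$. Convergence means: the images $F^pH^n$ of $H^n(F^p)$ in $H^n:=H^n_{\mathcal A,c}(M,V)$ satisfy $H^n=F^0H^n\supseteq F^1H^n\supseteq\dots\supseteq F^{n+1}H^n=0$, and for all $p,q$ and all $r>\max(p,q+1)$ every element of $Z_r^p$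 in degree $p+q$ is a cocycle and $\eta\mapsto[\eta]$ induces an isomorphism $E_r^{p,q}\cong F^pH^{p+q}/F^{p+1}H^{p+q}$. -/

import Mathlib

open scoped Manifold ContDiff Topology TensorProduct
open CategoryTheory

noncomputable section

namespace Involutive

/-! ### Linear algebra in one fibre

`U` is a complexified cotangent space and `P ≤ Q` are the annihilators defining two
involutive structures. -/

section Fibre

variable {U : Type*} [AddCommGroup U] [Module ℂ U] (P Q : Submodule ℂ U)

/-- The quotient `Q / P` (for `P ≤ Q`). -/
abbrev RelQuot : Type _ := Q ⧸ P.submoduleOf Q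

/-- The natural injection `Q / P → U / P`. -/
def relIncl : RelQuot P Q →ₗ[ℂ] U ⧸ P :=
  Submodule.mapQ (P.submoduleOf Q) P Q.subtype le_rfl

variable (V : Type*) [AddCommGroup V] [Module ℂ V]

/-- The map `Λ(U/P) ⊗ (Λ^p(Q/P) ⊗ V) → Λ(U/P) ⊗ V`, `η ⊗ (β ⊗ v) ↦ (η ∧ β) ⊗ v`. -/
def wedgeMap (p : ℕ) :
    ExteriorAlgebra ℂ (U ⧸ P) ⊗[ℂ] (⋀[ℂ]^p (RelQuot P Q) ⊗[ℂ] V) →ₗ[ℂ]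
      ExteriorAlgebra ℂ (U ⧸ P) ⊗[ℂ] V :=
  (LinearMap.rTensor V (TensorProduct.lift
    ((LinearMap.mul ℂ (ExteriorAlgebra ℂ (U ⧸ P))).compl₂
      ((ExteriorAlgebra.map (relIncl P Q)).toLinearMap ∘ₗ (⋀[ℂ]^p (RelQuot P Q)).subtype)))) ∘ₗ
  (TensorProduct.assoc ℂ _ _ _).symm.toLinearMap

variable {P Q}

/-- The map `Λ(U/P) ⊗ W → Λ(U/Q) ⊗ W` induced by the projection `U/P → U/Q`. -/
def reduceMap (h : P ≤ Q) (W : Type*) [AddCommGroup W] [Module ℂ W] :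
    ExteriorAlgebra ℂ (U ⧸ P) ⊗[ℂ] W →ₗ[ℂ] ExteriorAlgebra ℂ (U ⧸ Q) ⊗[ℂ] W :=
  LinearMap.rTensor W (ExteriorAlgebra.map (Submodule.factor h)).toLinearMap

/-- Exterior multiplication on the left by `a ∈ N` on `Λ N ⊗ W`. -/
def wedgeLeft {N : Type*} [AddCommGroup N] [Module ℂ N] (W : Type*) [AddCommGroup W] [Module ℂ W]
    (a : N) : ExteriorAlgebra ℂ N ⊗[ℂ] W →ₗ[ℂ] ExteriorAlgebra ℂ N ⊗[ℂ] W :=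
  LinearMap.rTensor W (LinearMap.mulLeft ℂ (ExteriorAlgebra.ι ℂ a))

end Fibre

/-! ### Sections -/

section Sections

variable {M : Type*} [TopologicalSpace M] {W : M → Type*} [∀ x, AddCommGroup (W x)]
  [∀ x, Module ℂ (W x)]

/-- The sections that agree, near every point, with a finite linear combination of
members of `G`. -/
def locSpan (G : Set (∀ x, W x)) : Submodule ℂ (∀ x, W x) where
  carrier := {s | ∀ x₀, ∃ t ∈ Submodule.span ℂ G, ∀ᶠ x in 𝓝 x₀, s x = t x}
  zero_mem' := fun _ => ⟨0, Submodule.zero_mem _, Filter.Eventually.of_forall fun _ => rfl⟩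
  add_mem' := by
    intro a b ha hb x₀
    obtain ⟨t, ht, hat⟩ := ha x₀
    obtain ⟨u, hu, hbu⟩ := hb x₀
    refine ⟨t + u, Submodule.add_mem _ ht hu, ?_⟩
    filter_upwards [hat, hbu] with x h1 h2
    simp [h1, h2]
  smul_mem' := by
    intro c a ha x₀
    obtain ⟨t, ht, hat⟩ := ha x₀
    refine ⟨c • t, Submodule.smul_mem _ c ht, ?_⟩
    filter_upwards [hat] with x h1
    simp [h1]

/-- The sections (of a family of vector spaces) with compact support. -/
def compactlySupported : Submodule ℂ (∀ x, W x) where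
  carrier := {s | ∃ K : Set M, IsCompact K ∧ ∀ x, x ∉ K → s x = 0}
  zero_mem' := ⟨∅, isCompact_empty, fun _ _ => rfl⟩
  add_mem' := by
    rintro a b ⟨K, hK, ha⟩ ⟨L, hL, hb⟩
    refine ⟨K ∪ L, hK.union hL, fun x hx => ?_⟩
    simp only [Set.mem_union, not_or] at hx
    simp [ha x hx.1, hb x hx.2]
  smul_mem' := by
    rintro c a ⟨K, hK, ha⟩
    exact ⟨K, hK, fun x hx => by simp [ha x hx]⟩

end Sections

/-! ### Complexified tangent and cotangent bundles, involutive structures -/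

section Manifold

variable (E : Type*) [NormedAddCommGroup E] [NormedSpace ℝ E]
  {M : Type*} [TopologicalSpace M] [ChartedSpace E M]

/-- The complexified tangent space. -/
abbrev CTangent (x : M) : Type _ := ℂ ⊗[ℝ] TangentSpace 𝓘(ℝ, E) x

/-- The complexified cotangent space. -/
abbrev CCotangent (x : M) : Type _ := Module.Dual ℂ (CTangent E x)

variable {E}

/-- The complex tangent vector `a + i b`. -/
def mkC {x : M} (a b : TangentSpace 𝓘(ℝ, E) x) : CTangent E x :=
  (1 : ℂ) ⊗ₜ[ℝ] a + Complex.I ⊗ₜ[ℝ] b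

/-- The complexified differential `df` of a complex-valued function. -/
def cdiff (f : M → ℂ) (x : M) : CCotangent E x :=
  LinearMap.liftBaseChange ℂ
    (show TangentSpace 𝓘(ℝ, E) x →L[ℝ] ℂ from mfderiv 𝓘(ℝ, E) 𝓘(ℝ, ℂ) f x).toLinearMap

variable [IsManifold 𝓘(ℝ, E) ∞ M]

/-- Smooth real vector fields. -/
def SmoothField (X : ∀ x : M, TangentSpace 𝓘(ℝ, E) x) : Prop :=
  ContMDiff 𝓘(ℝ, E) (𝓘(ℝ, E).prod 𝓘(ℝ, E)) ∞
    (fun x => (⟨x, X x⟩ : TangentBundle 𝓘(ℝ, E) M))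

/-- Smooth sections of the complexified tangent bundle. -/
def SmoothCField (X : ∀ x : M, CTangent E x) : Prop :=
  ∃ a b : ∀ x : M, TangentSpace 𝓘(ℝ, E) x,
    SmoothField a ∧ SmoothField b ∧ ∀ x, X x = mkC (a x) (b x)

/-- Smooth complex one-forms. -/
def SmoothForm (θ : ∀ x : M, CCotangent E x) : Prop :=
  ∀ a : ∀ x : M, TangentSpace 𝓘(ℝ, E) x, SmoothField a →
    ContMDiff 𝓘(ℝ, E) 𝓘(ℝ, ℂ) ∞ (fun x => θ x ((1 : ℂ) ⊗ₜ[ℝ] a x))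

variable (E M) in
/-- An involutive structure: a smooth complex sub-bundle `T^{0,1}` of the complexified tangent
bundle whose smooth sections are closed under the (complex bilinear) Lie bracket
`[a + i b, c + i d] = ([a, c] - [b, d]) + i ([a, d] + [b, c])`. -/
structure InvolutiveStructure where
  /-- the fibres of `T^{0,1}` -/
  T01 : ∀ x : M, Submodule ℂ (CTangent E x)
  subbundle : ∀ x₀ : M, ∃ (r : ℕ) (X : Fin r → ∀ x : M, CTangent E x),
    (∀ i, SmoothCField (X i)) ∧
    ∀ᶠ x in 𝓝 x₀, LinearIndependent ℂ (fun i => X i x) ∧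
      Submodule.span ℂ (Set.range fun i => X i x) = T01 x
  involutive : ∀ a b c d : ∀ x : M, TangentSpace 𝓘(ℝ, E) x,
    SmoothField a → SmoothField b → SmoothField c → SmoothField d →
    (∀ x, mkC (a x) (b x) ∈ T01 x) → (∀ x, mkC (c x) (d x) ∈ T01 x) →
    ∀ x, mkC
      (VectorField.mlieBracket 𝓘(ℝ, E) a c x - VectorField.mlieBracket 𝓘(ℝ, E) b d x)
      (VectorField.mlieBracket 𝓘(ℝ, E) a d x + VectorField.mlieBracket 𝓘(ℝ, E) b c x) ∈ T01 x

namespace InvolutiveStructure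

variable (S A : InvolutiveStructure E M)

/-- `E^{1,0}`, the annihilator of `T^{0,1}`. -/
def form10 (x : M) : Submodule ℂ (CCotangent E x) := (S.T01 x).dualAnnihilator

/-- `E^{0,1} = E^1 / E^{1,0}`. -/
abbrev Form01 (x : M) : Type _ := CCotangent E x ⧸ S.form10 x

/-- `∂̄ f`, the class of `df` in `E^{0,1}`. -/
def dbarFun (f : M → ℂ) (x : M) : S.Form01 x := (S.form10 x).mkQ (cdiff f x)

/-- The fibre of `Λ^• E^{0,1} ⊗ W`; its part of degree `q` is `E^{0,q} ⊗ W`. -/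
def FormFibre (W : M → Type*) [∀ x, AddCommGroup (W x)] [∀ x, Module ℂ (W x)] (x : M) :
    Type _ :=
  ExteriorAlgebra ℂ (S.Form01 x) ⊗[ℂ] W x

instance (W : M → Type*) [∀ x, AddCommGroup (W x)] [∀ x, Module ℂ (W x)] (x : M) :
    AddCommGroup (S.FormFibre W x) :=
  inferInstanceAs (AddCommGroup (ExteriorAlgebra ℂ (S.Form01 x) ⊗[ℂ] W x))

instance (W : M → Type*) [∀ x, AddCommGroup (W x)] [∀ x, Module ℂ (W x)] (x : M) :
    Module ℂ (S.FormFibre W x) :=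
  inferInstanceAs (Module ℂ (ExteriorAlgebra ℂ (S.Form01 x) ⊗[ℂ] W x))

section FibreMaps

variable {S}
variable (W : M → Type*) [∀ x, AddCommGroup (W x)] [∀ x, Module ℂ (W x)] (x : M)

variable {W x} in
/-- The element `α ⊗ w`. -/
def FormFibre.tmul (α : ExteriorAlgebra ℂ (S.Form01 x)) (w : W x) : S.FormFibre W x := α ⊗ₜ[ℂ] w

/-- Exterior multiplication by an element of `E^{0,1}` on the left. -/
def wedge01 (a : S.Form01 x) : S.FormFibre W x →ₗ[ℂ] S.FormFibre W x := wedgeLeft (W x) a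

/-- The map `Λ A^{0,1} ⊗ W → Λ E^{0,1} ⊗ W` induced by the projection `A^{0,1} → E^{0,1}`. -/
def reduce (h : A.form10 x ≤ S.form10 x) : A.FormFibre W x →ₗ[ℂ] S.FormFibre W x :=
  reduceMap h (W x)

end FibreMaps

section Bundle

/- `W` is the family of fibres of a complex vector bundle and `Γ` is its space of smooth
sections. -/
variable {W : M → Type*} [∀ x, AddCommGroup (W x)] [∀ x, Module ℂ (W x)]
  (Γ : Submodule ℂ (∀ x, W x))

/-- The sections `[θ₁] ∧ ⋯ ∧ [θ_q] ⊗ w` of `E^{0,q} ⊗ W`, with smooth one-forms `θᵢ` and a smooth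
section `w`. -/
def decomposable (q : ℕ) : Set (∀ x, S.FormFibre W x) :=
  {s | ∃ (θ : Fin q → ∀ x : M, CCotangent E x) (w : ∀ x, W x),
    (∀ i, SmoothForm (θ i)) ∧ w ∈ Γ ∧
    s = fun x => FormFibre.tmul
      (ExteriorAlgebra.ιMulti ℂ q (fun i => (S.form10 x).mkQ (θ i x))) (w x)}

/-- The smooth sections of `Λ^• E^{0,1} ⊗ W`. -/
def forms : Submodule ℂ (∀ x, S.FormFibre W x) := locSpan (⋃ q, S.decomposable Γ q)

/-- The smooth sections of `E^{0,q} ⊗ W`, inside those of `Λ^• E^{0,1} ⊗ W`. -/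
def formsDeg (q : ℕ) : Submodule ℂ (S.forms Γ) :=
  (locSpan (S.decomposable Γ q)).submoduleOf (S.forms Γ)

/-- The compactly supported smooth sections of `E^{0,q} ⊗ W`. -/
def formsDegC (q : ℕ) : Submodule ℂ (S.forms Γ) :=
  S.formsDeg Γ q ⊓ compactlySupported.submoduleOf (S.forms Γ)

/-- A structure of bundle compatible with the involutive structure `S`: the operator `∂̄` on the
sections of `W` and its extension to the sections of `E^{0,q} ⊗ W` for all `q`, assembled to one
operator on the sections of `Λ^• E^{0,1} ⊗ W`. The Leibniz rule and `∂̄² = 0` give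
`∂̄ (∂̄f ∧ s) = - ∂̄f ∧ ∂̄s`; since the sections of `E^{0,1}` are locally combinations of
differentials, the operator is the extension of its part in degree zero. -/
@[ext]
structure CompatibleStructure where
  /-- the operator `∂̄` -/
  dbar : S.forms Γ →ₗ[ℂ] S.forms Γ
  dbar_deg : ∀ q, ∀ s ∈ S.formsDeg Γ q, dbar s ∈ S.formsDeg Γ (q + 1)
  leibniz : ∀ f : M → ℂ, ContMDiff 𝓘(ℝ, E) 𝓘(ℝ, ℂ) ∞ f → ∀ s t : S.forms Γ,
    (∀ x, t.1 x = f x • s.1 x) →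
    ∀ x, (dbar t).1 x = wedge01 W x (S.dbarFun f x) (s.1 x) + f x • (dbar s).1 x
  dbar_dbar : ∀ s, dbar (dbar s) = 0

end Bundle

end InvolutiveStructure

end Manifold

/-! ### Cohomology and filtered complexes -/

section Complex

universe u

variable {C : Type u} [AddCommGroup C] [Module ℂ C] (d : C →ₗ[ℂ] C)

/-- For a graded subspace `K` of `C`, the coboundaries `d K^{n-1}` in degree `n`. -/
def coboundaries (K : ℕ → Submodule ℂ C) : ℕ → Submodule ℂ C
  | 0 => ⊥
  | n + 1 => (K n).map d

/-- The cocycles in `K^n`. -/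
def cocycles (K : ℕ → Submodule ℂ C) (n : ℕ) : Submodule ℂ C := K n ⊓ LinearMap.ker d

/-- The cohomology in degree `n` of the complex `K⁰ → K¹ → K² → ⋯`. -/
def Cohomology (K : ℕ → Submodule ℂ C) (n : ℕ) : Type _ :=
  cocycles d K n ⧸ (coboundaries d K n).submoduleOf (cocycles d K n)

instance (K : ℕ → Submodule ℂ C) (n : ℕ) : AddCommGroup (Cohomology d K n) :=
  inferInstanceAs (AddCommGroup
    (cocycles d K n ⧸ (coboundaries d K n).submoduleOf (cocycles d K n)))

instance (K : ℕ → Submodule ℂ C) (n : ℕ) : Module ℂ (Cohomology d K n) :=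
  inferInstanceAs (Module ℂ
    (cocycles d K n ⧸ (coboundaries d K n).submoduleOf (cocycles d K n)))

/-- The cohomology class of a cocycle. -/
def Cohomology.mk (K : ℕ → Submodule ℂ C) (n : ℕ) : cocycles d K n →ₗ[ℂ] Cohomology d K n :=
  ((coboundaries d K n).submoduleOf (cocycles d K n)).mkQ

/- From now on `K p n` is the `p`-th step of a decreasing filtration in degree `n`, with
`K 0 n` everything. -/
variable (K : ℕ → ℕ → Submodule ℂ C)

/-- The filtration on the cohomology of `K 0` by the images of the cohomologies of `K p`. -/
def filCohomology (p n : ℕ) : Submodule ℂ (Cohomology d (K 0) n) :=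
  ((K p n).submoduleOf (cocycles d (K 0) n)).map (Cohomology.mk d (K 0) n)

/-- The graded pieces of the filtration on cohomology. -/
abbrev GrCohomology (p n : ℕ) : Type _ :=
  filCohomology d K p n ⧸ (filCohomology d K (p + 1) n).submoduleOf (filCohomology d K p n)

/-- `Z_r^p` in degree `n`: the elements of the `p`-th step whose differential lies in the
`(p + r)`-th step. -/
def approxCycles (r p n : ℕ) : Submodule ℂ C := K p n ⊓ (K (p + r) (n + 1)).comap d

/-- The denominator `Z_{r-1}^{p+1} + d Z_{r-1}^{p-r+1}` of the page `E_r^p` in degree `n`, for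
`r ≥ 1`. (The second term consists of the `d c` in the `p`-th step with `c` of degree `n - 1` in
the step `p - r + 1`; for `p + 1 ≤ r` that step is everything, as is `K 0`.) -/
def approxBoundaries (r p n : ℕ) : Submodule ℂ C :=
  approxCycles d K (r - 1) (p + 1) n ⊔ (K p n ⊓ coboundaries d (K (p + 1 - r)) n)

/-- The spectral sequence of the filtered complex `K`: a first quadrant cohomological spectral
sequence starting with page one, together with identifications
`E_r^{p,q} = Z_r^p / (Z_{r-1}^{p+1} + d Z_{r-1}^{p-r+1})` in degree `p + q` (given here as
surjections from `Z_r^p` with this kernel), such that the differentials are induced by `d` and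
the isomorphisms between the cohomology of a page and the next page are induced by the identity
on representatives. -/
structure SpectralSequenceOf where
  /-- the spectral sequence -/
  seq : CohomologicalSpectralSequenceNat (ModuleCat.{u} ℂ) 1
  /-- the element of `E_r^{p,q}` represented by an element of `Z_r^p` -/
  repr : ∀ (r : ℕ) (hr : (1 : ℤ) ≤ r) (p q : ℕ),
    approxCycles d K r p (p + q) →ₗ[ℂ] (seq.page r hr).X (p, q)
  repr_surjective : ∀ r hr p q, Function.Surjective (repr r hr p q)
  ker_repr : ∀ r hr p q, LinearMap.ker (repr r hr p q) =
    (approxBoundaries d K r p (p + q)).submoduleOf (approxCycles d K r p (p + q))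
  d_repr : ∀ (r : ℕ) (hr : (1 : ℤ) ≤ r) (p q p' q' : ℕ), p + r = p' → q + 1 = q' + r →
    ∀ (η : approxCycles d K r p (p + q)) (η' : approxCycles d K r p' (p' + q')),
      (η' : C) = d η →
      ((seq.page r hr).d (p, q) (p', q')).hom (repr r hr p q η) = repr r hr p' q' η'
  iso_repr : ∀ (r r' : ℕ) (hr : (1 : ℤ) ≤ r) (hr' : (1 : ℤ) ≤ r') (hrr' : (r : ℤ) + 1 = r')
    (p q : ℕ) (η : approxCycles d K r p (p + q)) (η' : approxCycles d K r' p (p + q)),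
      (η : C) = η' →
      ∀ z : (seq.page r hr).cycles (p, q),
        ((seq.page r hr).iCycles (p, q)).hom z = repr r hr p q η →
        (seq.iso r r' (p, q) hrr' hr).hom.hom (((seq.page r hr).homologyπ (p, q)).hom z) =
          repr r' hr' p q η'

/-- Convergence of the spectral sequence of a filtered complex to the cohomology of the complex:
the filtration of the cohomology `H^n` of `K 0` by the images of the cohomologies of the `K p`
satisfies `H^n = F^0 ⊇ F^1 ⊇ ⋯ ⊇ F^{n+1} = 0`, and `E_r^{p,q}`, for all `r` so large that no
nonzero differential starts or ends at the place `(p, q)` on the pages from `r` on, is identified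
with `F^p H^{p+q} / F^{p+1} H^{p+q}`, an element represented by `η` being mapped to the class
of `η`, which is then a cocycle. -/
def SpectralSequenceOf.Converges {d : C →ₗ[ℂ] C} {K : ℕ → ℕ → Submodule ℂ C}
    (Sp : SpectralSequenceOf d K) : Prop :=
  (∀ n, filCohomology d K 0 n = ⊤) ∧
  (∀ p n, filCohomology d K (p + 1) n ≤ filCohomology d K p n) ∧
  (∀ n, filCohomology d K (n + 1) n = ⊥) ∧
  ∀ (r : ℕ) (hr : (1 : ℤ) ≤ r) (p q : ℕ), p < r → q + 1 < r →
    ∃ e : (Sp.seq.page r hr).X (p, q) ≃ₗ[ℂ] GrCohomology d K p (p + q),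
      ∀ η : approxCycles d K r p (p + q),
        ∃ (z : cocycles d (K 0) (p + q))
          (hz : Cohomology.mk d (K 0) (p + q) z ∈ filCohomology d K p (p + q)),
          (z : C) = η ∧
          e (Sp.repr r hr p q η) = Submodule.Quotient.mk ⟨Cohomology.mk d (K 0) (p + q) z, hz⟩

end Complex

/-- The compactly supported involutive cohomology `H^q_{S,c}(M, W)` of a bundle with a
compatible structure. -/
abbrev InvolutiveStructure.CompatibleStructure.CohomologyC
    {E : Type*} [NormedAddCommGroup E] [NormedSpace ℝ E]
    {M : Type*} [TopologicalSpace M] [ChartedSpace E M] [IsManifold 𝓘(ℝ, E) ∞ M]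
    {S : InvolutiveStructure E M}
    {W : M → Type*} [∀ x, AddCommGroup (W x)] [∀ x, Module ℂ (W x)]
    {Γ : Submodule ℂ (∀ x, W x)} (N : S.CompatibleStructure Γ) (q : ℕ) : Type _ :=
  Cohomology (C := S.forms Γ) N.dbar (S.formsDegC Γ) q

/-! ### Two involutive structures -/

section TwoStructures

variable {E : Type*} [NormedAddCommGroup E] [NormedSpace ℝ E]
  {M : Type*} [TopologicalSpace M] [ChartedSpace E M] [IsManifold 𝓘(ℝ, E) ∞ M]

variable (E) in
/-- The smooth sections of a smooth complex vector bundle `V` with fibre `F` over the real manifold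
`M`: the trivializations are complex linear, and the changes of trivialization are smooth. -/
def smoothSections (F : Type*) [NormedAddCommGroup F] [NormedSpace ℂ F]
    (V : M → Type*) [TopologicalSpace (Bundle.TotalSpace F V)]
    [∀ x, TopologicalSpace (V x)] [∀ x, AddCommGroup (V x)] [∀ x, Module ℂ (V x)]
    [FiberBundle F V] [VectorBundle ℂ F V] [VectorBundle ℝ F V]
    [ContMDiffVectorBundle ∞ F V 𝓘(ℝ, E)] : Submodule ℂ (∀ x, V x) where
  carrier := {s | ContMDiff 𝓘(ℝ, E) (𝓘(ℝ, E).prod 𝓘(ℝ, F)) ∞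
    (fun x => Bundle.TotalSpace.mk' F x (s x))}
  zero_mem' := Bundle.contMDiff_zeroSection ℝ V
  add_mem' := fun ha hb => ContMDiff.add_section ha hb
  smul_mem' := by
    intro c s hs x₀
    have hs0 := (Bundle.contMDiffAt_section (s := s) x₀).1 (hs x₀)
    refine (Bundle.contMDiffAt_section (s := c • s) x₀).2 ?_
    have h2 : ContMDiffAt 𝓘(ℝ, E) 𝓘(ℝ, F) ∞
        (fun x => c • (trivializationAt F V x₀ ⟨x, s x⟩).2) x₀ :=
      ((c • ContinuousLinearMap.id ℝ F).contMDiff.contMDiffAt).comp x₀ hs0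
    refine h2.congr_of_eventuallyEq ?_
    filter_upwards [(trivializationAt F V x₀).open_baseSet.mem_nhds
      (FiberBundle.mem_baseSet_trivializationAt F V x₀)] with x hx
    exact ((trivializationAt F V x₀).linear ℂ hx).map_smul c (s x)

variable (A S : InvolutiveStructure E M)
  {V : M → Type*} [∀ x, AddCommGroup (V x)] [∀ x, Module ℂ (V x)]
  (Γ : Submodule ℂ (∀ x, V x))

variable (V) in
/-- The fibre of `B^p ⊗ V`, where `B^p = Λ^p (E^{1,0} / A^{1,0})`. -/
def BFibre (p : ℕ) (x : M) : Type _ :=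
  ⋀[ℂ]^p (RelQuot (A.form10 x) (S.form10 x)) ⊗[ℂ] V x

instance (p : ℕ) (x : M) : AddCommGroup (BFibre A S V p x) :=
  inferInstanceAs (AddCommGroup (⋀[ℂ]^p (RelQuot (A.form10 x) (S.form10 x)) ⊗[ℂ] V x))

instance (p : ℕ) (x : M) : Module ℂ (BFibre A S V p x) :=
  inferInstanceAs (Module ℂ (⋀[ℂ]^p (RelQuot (A.form10 x) (S.form10 x)) ⊗[ℂ] V x))

variable (V) in
/-- The map `Λ A^{0,1} ⊗ (B^p ⊗ V) → Λ A^{0,1} ⊗ V`, `α ⊗ (β ⊗ v) ↦ (α ∧ β) ⊗ v`, where `B^p` is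
mapped to `A^{0,p} = Λ^p A^{0,1}` by the inclusion `E^{1,0} / A^{1,0} → A^{0,1}`. -/
def wedgeB (p : ℕ) (x : M) : A.FormFibre (BFibre A S V p) x →ₗ[ℂ] A.FormFibre V x :=
  wedgeMap (A.form10 x) (S.form10 x) (V x) p

/-- The smooth sections of `B^p ⊗ V`: locally, sums of `[θ₁] ∧ ⋯ ∧ [θ_p] ⊗ v` with smooth
sections `θᵢ` of `E^{1,0}` and smooth sections `v` of `V`. -/
def BSections (p : ℕ) : Submodule ℂ (∀ x, BFibre A S V p x) :=
  locSpan {b | ∃ (θ : Fin p → ∀ x : M, S.form10 x) (v : ∀ x, V x),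
    (∀ i, SmoothForm (fun x => (θ i x : CCotangent E x))) ∧ v ∈ Γ ∧
    b = fun x => (exteriorPower.ιMulti ℂ p
      (fun i => ((A.form10 x).submoduleOf (S.form10 x)).mkQ (θ i x)) ⊗ₜ[ℂ] v x :
        ⋀[ℂ]^p (RelQuot (A.form10 x) (S.form10 x)) ⊗[ℂ] V x)}

/-- The `p`-th step of the filtration of the compactly supported complex of `A`: the compactly
supported smooth sections of `A^{0,n} ⊗ V` with values in the sub-bundle spanned by the
`η ∧ β ⊗ v` with `β ∈ B^p ⊂ A^{0,p}` and `η ∈ A^{0,n-p}`. -/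
def filtrationC (p n : ℕ) : Submodule ℂ (A.forms Γ) where
  carrier := {s | s ∈ A.formsDegC Γ n ∧
    ∀ x, s.1 x ∈ LinearMap.range (wedgeB A S V p x)}
  zero_mem' := ⟨Submodule.zero_mem _, fun _ => Submodule.zero_mem _⟩
  add_mem' := fun ha hb =>
    ⟨Submodule.add_mem _ ha.1 hb.1, fun x => Submodule.add_mem _ (ha.2 x) (hb.2 x)⟩
  smul_mem' := fun c _ ha =>
    ⟨Submodule.smul_mem _ c ha.1, fun x => Submodule.smul_mem _ c (ha.2 x)⟩

variable {A S Γ}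

/-- `σ` is the leading part of `η` in the filtration step `p`: at every point, `η` is a sum of
`α ∧ β ⊗ v` with `α ∈ Λ A^{0,1}`, `β ∈ B^p`, and `σ` is the sum of the corresponding
`ᾱ ⊗ (β ⊗ v)`, where `ᾱ` is the image of `α` in `Λ E^{0,1}`. -/
def IsSymbol (h : ∀ x, A.form10 x ≤ S.form10 x) (p : ℕ) (η : ∀ x, A.FormFibre V x)
    (σ : ∀ x, S.FormFibre (BFibre A S V p) x) : Prop :=
  ∀ x, ∃ t, wedgeB A S V p x t = η x ∧
    InvolutiveStructure.reduce A (BFibre A S V p) x (h x) t = σ x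

/-- The structure `N` on `B^p ⊗ V` is induced by the structure `D` on `V`: a section `w` of
`B^p ⊗ V` is also a section of `A^{0,p} ⊗ V`, and `∂̄ w` for `N`, a section of
`E^{0,1} ⊗ B^p ⊗ V`, is the leading part of `∂̄ w` for `D`. -/
def IsInduced (h : ∀ x, A.form10 x ≤ S.form10 x) (D : A.CompatibleStructure Γ) (p : ℕ)
    (N : S.CompatibleStructure (BSections A S Γ p)) : Prop :=
  ∀ w ∈ BSections A S Γ p, ∃ (η : A.forms Γ) (s : S.forms (BSections A S Γ p)),
    (∀ x, η.1 x = wedgeB A S V p x (InvolutiveStructure.FormFibre.tmul 1 (w x))) ∧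
    (∀ x, s.1 x = InvolutiveStructure.FormFibre.tmul 1 (w x)) ∧
    IsSymbol h p (D.dbar η).1 (N.dbar s).1

end TwoStructures

end Involutive

end

open Involutive

/-! In one fibre, `0 → B^1 → A^{0,1} → E^{0,1} → 0` is exact. Filtering `Λ A^{0,1} ⊗ V` by the
number of factors from `B^1` therefore gives graded pieces `Λ E^{0,1} ⊗ Λ^p B^1 ⊗ V`, and taking the
leading part is the projection to the `p`-th piece. Everything follows once `∂̄` is known to respect
this filtration on smooth sections.

That is where involutivity of `E` is used. If `θ = ∑ g_j df_j` is a section of `E^{1,0}`, Cartan's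
formula shows that `∑ dg_j ∧ df_j` vanishes on `T^{0,1}` (`InvolutiveStructure.sum_wedge_eq_zero`),
so its class in `Λ A^{0,1}` lies in the ideal generated by `B^1`. Since `∂̄([θ] ∧ s) = ∑ ∂̄g_j ∧
∂̄f_j ∧ s - [θ] ∧ ∂̄s` (`dbar_wedge`), wedging with such a `θ` raises the filtration step of both
`s` and `∂̄s`. This settles the sections that are visibly products. A general section differs from
one of these by a section of the next step, and the steps vanish for `p > dim E`, so descending
induction finishes (`dbar_mem_filSections`).

Taking leading parts of smooth sections is then a surjection (`leadSections_surjective`, by a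
partition of unity) whose kernel is the next step, so `∂̄` descends to an operator on the forms with
values in `B^p ⊗ V` (`exists_inducedStructure`). It is unique because a compatible structure is
determined by its values in degree zero (`ext_of_degree_zero`). The leading part is defined through
an arbitrary splitting in each fibre. On the filtration step the splitting does not matter, so a
smooth local projection may replace it, and this gives smoothness (`leadingPart_mem_locSpan`).

The rest is algebra of filtered complexes: the spectral sequence is built from `Z_r^p` by hand, its
first page is the cohomology of the graded pieces (`IsFilteredComplex.exists_firstPage`), and it
converges because the filtration is finite in each degree. Compact supports are handled by cutoff
functions. -/

noncomputable section

namespace Involutive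

/-! ### The spectral sequence of a filtered complex -/

section FilteredComplex

universe u

variable {C : Type u} [AddCommGroup C] [Module ℂ C]

/-- `K p n` is the `p`-th step, in degree `n`, of a decreasing filtration of a complex with
differential `d`, and `K p n = 0` for `p > n`. -/
structure IsFilteredComplex (d : C →ₗ[ℂ] C) (K : ℕ → ℕ → Submodule ℂ C) : Prop where
  d_d : ∀ c, d (d c) = 0
  d_mem : ∀ p n, ∀ c ∈ K p n, d c ∈ K p (n + 1)
  succ_le : ∀ p n, K (p + 1) n ≤ K p n
  eq_bot : ∀ n, K (n + 1) n = ⊥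

variable {d : C →ₗ[ℂ] C} {K : ℕ → ℕ → Submodule ℂ C}

namespace IsFilteredComplex

variable (hK : IsFilteredComplex d K)
include hK

lemma anti {p p' : ℕ} (h : p ≤ p') (n : ℕ) : K p' n ≤ K p n := by
  induction p', h using Nat.le_induction with
  | base => exact le_rfl
  | succ m _ ih => exact (hK.succ_le m n).trans ih

lemma eq_zero_of_lt {p n : ℕ} (h : n < p) {c : C} (hc : c ∈ K p n) : c = 0 := by
  have := hK.anti (Nat.succ_le_of_lt h) n hc
  simpa [hK.eq_bot n] using this

lemma approxCycles_anti {r r' p n : ℕ} (h : r ≤ r') :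
    approxCycles d K r' p n ≤ approxCycles d K r p n :=
  fun _ hc => ⟨hc.1, hK.anti (by omega) _ hc.2⟩

lemma d_mem_approxCycles {r p n : ℕ} {c : C} (hc : c ∈ approxCycles d K r p n) :
    d c ∈ approxCycles d K r (p + r) (n + 1) :=
  ⟨hc.2, by simp [hK.d_d]⟩

/-- The second summand of the denominator consists of coboundaries, which `d` kills. The first,
`Z_{r-1}^{p+1}`, is sent into the second summand at `p + r`, because `(p + r) + 1 - r = p + 1`. -/
lemma d_mem_approxBoundaries {r p n : ℕ} (hr : 1 ≤ r) {c : C}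
    (hc : c ∈ approxBoundaries d K r p n) :
    d c ∈ approxBoundaries d K r (p + r) (n + 1) := by
  obtain ⟨a, ha, b, hb, rfl⟩ := Submodule.mem_sup.1 hc
  have hb0 : d b = 0 := by
    cases n with
    | zero => have : b = 0 := by simpa [coboundaries] using hb.2
              simp [this]
    | succ m =>
      obtain ⟨e, _, rfl⟩ := hb.2
      exact hK.d_d e
  rw [map_add, hb0, add_zero]
  refine Submodule.mem_sup_right ⟨?_, ?_⟩
  · have := ha.2
    rwa [show p + 1 + (r - 1) = p + r by omega] at this
  · refine ⟨a, ?_, rfl⟩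
    rw [show p + r + 1 - r = p + 1 by omega]
    exact ha.1

/-- A representative of a cycle of the `r`-th page can be chosen in `Z_{r+1}`. -/
lemma exists_approxCycles_succ {r p n : ℕ} (hr : 1 ≤ r) {c : C}
    (hc : c ∈ approxCycles d K r p n)
    (hdc : d c ∈ approxBoundaries d K r (p + r) (n + 1)) :
    ∃ c' ∈ approxCycles d K (r + 1) p n, c - c' ∈ approxBoundaries d K r p n := by
  obtain ⟨a, ha, b, hb, hab⟩ := Submodule.mem_sup.1 hdc
  obtain ⟨e, he, rfl⟩ := hb.2
  have he' : e ∈ K (p + 1) n := by rwa [show p + r + 1 - r = p + 1 by omega] at he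
  -- Here `d c = a + d e`. Subtracting `e` leaves `d (c - e) = a`, which lies in step `p + r + 1`,
  -- and `e` itself belongs to `Z_{r-1}^{p+1}`.
  refine ⟨c - e, ⟨Submodule.sub_mem _ hc.1 (hK.succ_le p n he'), ?_⟩, ?_⟩
  · change d (c - e) ∈ K _ _
    rw [map_sub, ← hab, add_sub_cancel_right]
    simpa [add_assoc] using ha.1
  · rw [sub_sub_cancel]
    refine Submodule.mem_sup_left ⟨he', ?_⟩
    change d e ∈ K _ _
    rw [show p + 1 + (r - 1) = p + r by omega]
    exact hb.1

/-- Since `Z_r^{p+1} ⊆ Z_{r-1}^{p+1}`, the only thing new in the denominator of page `r + 1` is that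
coboundaries may come from step `p - r` instead of `p - r + 1`. -/
lemma approxBoundaries_le_succ {r p n : ℕ} :
    approxBoundaries d K (r + 1) p n ⊓ approxCycles d K (r + 1) p n ≤
      approxBoundaries d K r p n ⊔ (K p n ⊓ coboundaries d (K (p - r)) n) := by
  rintro c ⟨hc, -⟩
  obtain ⟨a, ha, b, hb, rfl⟩ := Submodule.mem_sup.1 hc
  refine Submodule.add_mem _ (Submodule.mem_sup_left (Submodule.mem_sup_left ⟨ha.1, ?_⟩))
    (Submodule.mem_sup_right ⟨hb.1, ?_⟩)
  · exact hK.anti (by omega) _ ha.2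
  · have := hb.2
    rwa [show p + 1 - (r + 1) = p - r by omega] at this

/-- An element of `Z_{r+1}` is in the denominator of the page `r + 1` if it is a boundary on the
page `r`. -/
lemma mem_approxBoundaries_succ {r p n : ℕ} {c e : C}
    (hc : c ∈ approxCycles d K (r + 1) p n)
    (he : e ∈ K p n ⊓ coboundaries d (K (p - r)) n)
    (hce : c - e ∈ approxBoundaries d K r p n) :
    c ∈ approxBoundaries d K (r + 1) p n := by
  obtain ⟨a, ha, b, hb, hab⟩ := Submodule.mem_sup.1 hce
  have hd0 : ∀ j, ∀ x ∈ coboundaries d (K j) n, d x = 0 := by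
    intro j x hx
    cases n with
    | zero => have : x = 0 := by simpa [coboundaries] using hx
              simp [this]
    | succ m =>
      obtain ⟨e, _, rfl⟩ := hx
      exact hK.d_d e
  have hmono : coboundaries d (K (p + 1 - r)) n ≤ coboundaries d (K (p - r)) n := by
    cases n with
    | zero => exact le_rfl
    | succ m => exact Submodule.map_mono (hK.anti (by omega) m)
  have hceq : c = a + (b + e) := by
    rw [← add_assoc, hab, sub_add_cancel]
  rw [hceq]
  refine Submodule.add_mem _ (Submodule.mem_sup_left ⟨ha.1, ?_⟩) (Submodule.mem_sup_right ?_)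
  -- `b` and `e` are coboundaries, so `a` has the same differential as `c`. This puts `d a` into
  -- step `p + r + 1` and improves `a` from `Z_{r-1}^{p+1}` to `Z_r^{p+1}`.
  · have hda : d a = d c := by
      rw [hceq, map_add, map_add, hd0 _ b hb.2, hd0 _ e he.2]; simp
    change d a ∈ K _ _
    rw [hda, Nat.add_sub_cancel, show p + 1 + r = p + (r + 1) by omega]
    exact hc.2
  · rw [show p + 1 - (r + 1) = p - r by omega]
    exact Submodule.add_mem _ ⟨hb.1, hmono hb.2⟩ he

end IsFilteredComplex

/-! ### Pages and their differentials -/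

variable (d K) in
/-- The object `E_r^p` in degree `n`. -/
abbrev PageModule (r p n : ℕ) : Type u :=
  approxCycles d K r p n ⧸ (approxBoundaries d K r p n).submoduleOf (approxCycles d K r p n)

/-- The differential of the page `r`. -/
def pageDiff (hK : IsFilteredComplex d K) (r p n p' n' : ℕ) (hr : 1 ≤ r)
    (h : p' = p + r ∧ n' = n + 1) : PageModule d K r p n →ₗ[ℂ] PageModule d K r p' n' :=
  Submodule.mapQ _ _
    (d.restrict (p := approxCycles d K r p n) (q := approxCycles d K r p' n') fun c hc => by
      rw [h.1, h.2]; exact hK.d_mem_approxCycles hc) <| by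
    intro c hc
    change d (c : C) ∈ approxBoundaries d K r p' n'
    rw [h.1, h.2]
    exact hK.d_mem_approxBoundaries hr hc

lemma pageDiff_mk (hK : IsFilteredComplex d K) (r p n p' n' : ℕ) (hr : 1 ≤ r)
    (h : p' = p + r ∧ n' = n + 1) (c : approxCycles d K r p n) (c' : approxCycles d K r p' n')
    (hc : (c' : C) = d c) :
    pageDiff hK r p n p' n' hr h (Submodule.Quotient.mk c) = Submodule.Quotient.mk c' := by
  rw [pageDiff, Submodule.mapQ_apply]
  congr 1
  exact Subtype.ext hc.symm

lemma degrees_of_rel {r : ℤ} (hr : 1 ≤ r) {i j : ℕ × ℕ}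
    (h : (ComplexShape.spectralSequenceNat ⟨r, 1 - r⟩).Rel i j) :
    j.1 = i.1 + r.toNat ∧ j.1 + j.2 = i.1 + i.2 + 1 := by
  have := (ComplexShape.spectralSequenceNat_rel_iff _ _ _).1 h
  simp only at this
  omega

open Classical in
/-- The pages of the spectral sequence of a filtered complex. -/
def pageComplex (hK : IsFilteredComplex d K) (r : ℤ) (hr : 1 ≤ r) :
    HomologicalComplex (ModuleCat.{u} ℂ) (ComplexShape.spectralSequenceNat ⟨r, 1 - r⟩) where
  X i := ModuleCat.of ℂ (PageModule d K r.toNat i.1 (i.1 + i.2))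
  d i j := if h : (ComplexShape.spectralSequenceNat ⟨r, 1 - r⟩).Rel i j then
    ModuleCat.ofHom (pageDiff hK r.toNat i.1 (i.1 + i.2) j.1 (j.1 + j.2) (by omega)
      (degrees_of_rel hr h)) else 0
  shape i j h := dif_neg h
  d_comp_d' i j k hij hjk := by
    rw [dif_pos hij, dif_pos hjk, ← ModuleCat.ofHom_comp]
    ext c
    have h1 := degrees_of_rel hr hij
    have h2 := degrees_of_rel hr hjk
    have hm : d (c : C) ∈ approxCycles d K r.toNat j.1 (j.1 + j.2) := by
      rw [h1.1, ← h1.1, h1.2, h1.1]; exact hK.d_mem_approxCycles c.2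
    change pageDiff hK _ _ _ _ _ (by omega) h2 (pageDiff hK _ _ _ _ _ (by omega) h1
      (Submodule.Quotient.mk c)) = 0
    rw [pageDiff_mk hK _ _ _ _ _ _ _ c ⟨_, hm⟩ rfl,
      pageDiff_mk hK _ _ _ _ _ _ _ ⟨_, hm⟩ 0 (by simp [hK.d_d])]
    rfl

/-- The element of the page `r` represented by an element of `Z_r`. -/
def pageMk (hK : IsFilteredComplex d K) (r : ℤ) (hr : 1 ≤ r) (i : ℕ × ℕ) :
    approxCycles d K r.toNat i.1 (i.1 + i.2) →ₗ[ℂ] (pageComplex hK r hr).X i :=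
  ((approxBoundaries d K r.toNat i.1 (i.1 + i.2)).submoduleOf
    (approxCycles d K r.toNat i.1 (i.1 + i.2))).mkQ

lemma pageMk_surjective (hK : IsFilteredComplex d K) (r : ℤ) (hr : 1 ≤ r) (i : ℕ × ℕ) :
    Function.Surjective (pageMk hK r hr i) :=
  Submodule.mkQ_surjective _

lemma pageMk_eq_zero (hK : IsFilteredComplex d K) (r : ℤ) (hr : 1 ≤ r) (i : ℕ × ℕ)
    (c : approxCycles d K r.toNat i.1 (i.1 + i.2)) :
    pageMk hK r hr i c = 0 ↔ (c : C) ∈ approxBoundaries d K r.toNat i.1 (i.1 + i.2) :=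
  Submodule.Quotient.mk_eq_zero _

lemma pageMk_eq (hK : IsFilteredComplex d K) (r : ℤ) (hr : 1 ≤ r) (i : ℕ × ℕ)
    (c c' : approxCycles d K r.toNat i.1 (i.1 + i.2)) :
    pageMk hK r hr i c = pageMk hK r hr i c' ↔
      (c - c' : C) ∈ approxBoundaries d K r.toNat i.1 (i.1 + i.2) :=
  Submodule.Quotient.eq _

lemma pageComplex_d_mk (hK : IsFilteredComplex d K) (r : ℤ) (hr : 1 ≤ r) (i j : ℕ × ℕ)
    (h : (ComplexShape.spectralSequenceNat ⟨r, 1 - r⟩).Rel i j)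
    (c : approxCycles d K r.toNat i.1 (i.1 + i.2)) (c' : approxCycles d K r.toNat j.1 (j.1 + j.2))
    (hc : (c' : C) = d c) :
    ((pageComplex hK r hr).d i j).hom (pageMk hK r hr i c) = pageMk hK r hr j c' := by
  have : (pageComplex hK r hr).d i j = ModuleCat.ofHom (pageDiff hK r.toNat i.1 (i.1 + i.2) j.1
      (j.1 + j.2) (by omega) (degrees_of_rel hr h)) := dif_pos h
  rw [this]
  exact pageDiff_mk hK _ _ _ _ _ (by omega) (degrees_of_rel hr h) c c' hc

/-- The drop of the second index by `r - 1` is written additively, so that truncated subtraction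
cannot produce a false target outside the first quadrant. -/
lemma degrees_add_iff {r : ℤ} (i j : ℕ × ℕ) (hr : 1 ≤ r) :
    (ComplexShape.spectralSequenceNat ⟨r, 1 - r⟩).Rel i j ↔
      j.1 = i.1 + r.toNat ∧ j.2 + r.toNat = i.2 + 1 := by
  rw [ComplexShape.spectralSequenceNat_rel_iff]
  simp only
  omega

/-- The cycles on the page `r` are the classes of the elements of `Z_{r+1}`. -/
lemma exists_rep_of_cycle (hK : IsFilteredComplex d K) (r : ℤ) (hr : 1 ≤ r) (i j : ℕ × ℕ)
    (hj : (ComplexShape.spectralSequenceNat ⟨r, 1 - r⟩).next i = j)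
    (x : (pageComplex hK r hr).X i) (hx : ((pageComplex hK r hr).d i j).hom x = 0) :
    ∃ c : approxCycles d K r.toNat i.1 (i.1 + i.2),
      (c : C) ∈ approxCycles d K (r.toNat + 1) i.1 (i.1 + i.2) ∧
      x = pageMk hK r hr i c := by
  obtain ⟨c, rfl⟩ := pageMk_surjective hK r hr _ x
  by_cases h : r.toNat ≤ i.2 + 1
  · have hrel : (ComplexShape.spectralSequenceNat ⟨r, 1 - r⟩).Rel i
        (i.1 + r.toNat, i.2 + 1 - r.toNat) := by
      exact (degrees_add_iff _ _ hr).2 ⟨rfl, Nat.sub_add_cancel h⟩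
    have hj' := (ComplexShape.next_eq' _ hrel).symm.trans hj
    subst hj'
    have e : i.1 + r.toNat + (i.2 + 1 - r.toNat) = i.1 + i.2 + 1 := by omega
    have hm : d (c : C) ∈ approxCycles d K r.toNat (i.1 + r.toNat)
        (i.1 + r.toNat + (i.2 + 1 - r.toNat)) := by
      rw [e]; exact hK.d_mem_approxCycles c.2
    rw [pageComplex_d_mk hK r hr _ _ hrel c ⟨_, hm⟩ rfl, pageMk_eq_zero] at hx
    simp only [e] at hx
    obtain ⟨c', hc', hcc'⟩ := hK.exists_approxCycles_succ (by omega) c.2 hx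
    refine ⟨⟨c', hc'.1, hK.anti (by omega) _ hc'.2⟩, hc', ?_⟩
    exact (pageMk_eq hK r hr _ _ _).2 hcc'
  -- The target lies outside the quadrant. Then `d c` lies in a step `p + r` greater than its degree
  -- `p + q + 1`, hence is zero, and `c` is already in `Z_{r+1}`.
  · refine ⟨c, ⟨c.2.1, ?_⟩, rfl⟩
    have : d (c : C) = 0 := hK.eq_zero_of_lt (by omega) c.2.2
    change d (c : C) ∈ K _ _
    rw [this]
    exact Submodule.zero_mem _

/-- For `c` in `Z_{r+1}^p` the cocycle `d c` lies one step deeper than needed, hence in the summand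
`Z_{r-1}^{p+r+1}` of the denominator at the target. -/
lemma pageComplex_d_of_mem (hK : IsFilteredComplex d K) (r : ℤ) (hr : 1 ≤ r) (i j : ℕ × ℕ)
    (c : approxCycles d K r.toNat i.1 (i.1 + i.2))
    (hc : (c : C) ∈ approxCycles d K (r.toNat + 1) i.1 (i.1 + i.2)) :
    ((pageComplex hK r hr).d i j).hom (pageMk hK r hr i c) = 0 := by
  by_cases hrel : (ComplexShape.spectralSequenceNat ⟨r, 1 - r⟩).Rel i j
  · have h := degrees_of_rel hr hrel
    have hm : d (c : C) ∈ approxCycles d K r.toNat j.1 (j.1 + j.2) := by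
      rw [h.1, ← h.1, h.2, h.1]; exact hK.d_mem_approxCycles c.2
    rw [pageComplex_d_mk hK r hr _ _ hrel c ⟨_, hm⟩ rfl, pageMk_eq_zero]
    refine Submodule.mem_sup_left ⟨?_, ?_⟩
    · change d (c : C) ∈ K _ _
      rw [h.2, h.1]; exact hc.2
    · change d (d (c : C)) ∈ K _ _
      rw [hK.d_d]; exact Submodule.zero_mem _
  · rw [(pageComplex hK r hr).shape _ _ hrel]
    rfl

/-- The boundaries on the page `r` among the classes of elements of `Z_{r+1}`. -/
lemma boundary_iff (hK : IsFilteredComplex d K) (r : ℤ) (hr : 1 ≤ r) (i j : ℕ × ℕ)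
    (hj : (ComplexShape.spectralSequenceNat ⟨r, 1 - r⟩).prev i = j)
    (c : approxCycles d K r.toNat i.1 (i.1 + i.2))
    (hc : (c : C) ∈ approxCycles d K (r.toNat + 1) i.1 (i.1 + i.2)) :
    (∃ y, ((pageComplex hK r hr).d j i).hom y = pageMk hK r hr i c) ↔
      (c : C) ∈ approxBoundaries d K (r.toNat + 1) i.1 (i.1 + i.2) := by
  have hr' : 1 ≤ r.toNat := by omega
  by_cases h : r.toNat ≤ i.1
  · have hrel : (ComplexShape.spectralSequenceNat ⟨r, 1 - r⟩).Rel
        (i.1 - r.toNat, i.2 + r.toNat - 1) i := by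
      rw [degrees_add_iff _ _ hr]; simp only; omega
    have hj' := (ComplexShape.prev_eq' _ hrel).symm.trans hj
    subst hj'
    have e : i.1 - r.toNat + (i.2 + r.toNat - 1) + 1 = i.1 + i.2 := by omega
    have hcomp : ∀ b : approxCycles d K r.toNat (i.1 - r.toNat)
        (i.1 - r.toNat + (i.2 + r.toNat - 1)),
        ∃ hb : d (b : C) ∈ approxCycles d K r.toNat i.1 (i.1 + i.2),
        ((pageComplex hK r hr).d (i.1 - r.toNat, i.2 + r.toNat - 1) i).hom
          (pageMk hK r hr _ b) = pageMk hK r hr i ⟨d (b : C), hb⟩ := by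
      intro b
      have hb := hK.d_mem_approxCycles b.2
      rw [e, Nat.sub_add_cancel h] at hb
      exact ⟨hb, pageComplex_d_mk hK r hr _ _ hrel b ⟨_, hb⟩ rfl⟩
    constructor
    · rintro ⟨y, hy⟩
      obtain ⟨b, rfl⟩ := pageMk_surjective hK r hr _ y
      obtain ⟨hb, hb'⟩ := hcomp b
      rw [hb'] at hy
      refine hK.mem_approxBoundaries_succ hc (e := d (b : C)) ⟨hb.1, ?_⟩
        ((pageMk_eq hK r hr _ _ _).1 hy.symm)
      rw [← e]
      exact ⟨_, b.2.1, rfl⟩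
    · intro hcb
      -- Write `c = a + d f` with `a` zero on page `r` and `f` in step `p - r`. As `d f` lies in
      -- step `p`, `f` belongs to `Z_r^{p-r}`, and its class is the required preimage.
      obtain ⟨a, ha, b, hb, hab⟩ := Submodule.mem_sup.1 (hK.approxBoundaries_le_succ ⟨hcb, hc⟩)
      obtain ⟨hb1, hb2⟩ := hb
      rw [← e] at hb2
      obtain ⟨f, hf, rfl⟩ := hb2
      have hfm : f ∈ approxCycles d K r.toNat (i.1 - r.toNat)
          (i.1 - r.toNat + (i.2 + r.toNat - 1)) := by
        refine ⟨hf, ?_⟩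
        change d f ∈ K _ _
        rw [e, Nat.sub_add_cancel h]; exact hb1
      obtain ⟨hf1, hf2⟩ := hcomp ⟨f, hfm⟩
      refine ⟨pageMk hK r hr _ ⟨f, hfm⟩, hf2.trans ((pageMk_eq hK r hr _ _ _).2 ?_)⟩
      change d f - (c : C) ∈ approxBoundaries d K _ _ _
      rw [← hab, sub_add_cancel_right]
      exact Submodule.neg_mem _ ha
  -- For `r > p` no differential arrives. Both `p + 1 - r` and `p - r` truncate to `0`, so the
  -- denominators of pages `r` and `r + 1` allow the same coboundaries.
  · have hnrel : ¬ (ComplexShape.spectralSequenceNat ⟨r, 1 - r⟩).Rel j i := by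
      rw [degrees_add_iff _ _ hr]; omega
    rw [(pageComplex hK r hr).shape _ _ hnrel]
    have e1 : i.1 + 1 - r.toNat = i.1 - r.toNat := by omega
    constructor
    · rintro ⟨y, hy⟩
      refine hK.mem_approxBoundaries_succ hc (e := 0) (Submodule.zero_mem _) ?_
      rw [sub_zero, ← pageMk_eq_zero hK r hr i]
      exact hy.symm
    · intro hcb
      refine ⟨0, ?_⟩
      rw [map_zero]
      symm
      rw [pageMk_eq_zero]
      have hle := hK.approxBoundaries_le_succ ⟨hcb, hc⟩
      rw [← e1] at hle
      exact sup_le (le_refl (approxBoundaries d K r.toNat i.1 (i.1 + i.2))) le_sup_right hle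

/-! ### The homology of a page is the next page -/

/-- The class in the homology of the page `r` of an element of `Z_{r+1}`. -/
def repHomology (hK : IsFilteredComplex d K) (r r' : ℤ) (hr : 1 ≤ r) (hrr' : r + 1 = r')
    (i : ℕ × ℕ) :
    ModuleCat.of ℂ (approxCycles d K r'.toNat i.1 (i.1 + i.2)) ⟶
      (pageComplex hK r hr).cycles i :=
  (pageComplex hK r hr).liftCycles
    (ModuleCat.ofHom (pageMk hK r hr i ∘ₗ Submodule.inclusion
      (hK.approxCycles_anti (p := i.1) (n := i.1 + i.2) (show r.toNat ≤ r'.toNat by omega)))) _ rfl <| by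
    have hr1 : r'.toNat = r.toNat + 1 := by omega
    ext c
    refine pageComplex_d_of_mem hK r hr _ _ _ ?_
    rw [← hr1]
    exact c.2

lemma iCycles_repHomology (hK : IsFilteredComplex d K) (r r' : ℤ) (hr : 1 ≤ r)
    (hrr' : r + 1 = r') (i : ℕ × ℕ) (c' : approxCycles d K r'.toNat i.1 (i.1 + i.2))
    (c : approxCycles d K r.toNat i.1 (i.1 + i.2)) (h : (c : C) = c') :
    ((pageComplex hK r hr).iCycles i).hom ((repHomology hK r r' hr hrr' i).hom c') =
      pageMk hK r hr i c := by
  have := (pageComplex hK r hr).liftCycles_i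
    (ModuleCat.ofHom (pageMk hK r hr i ∘ₗ Submodule.inclusion
      (hK.approxCycles_anti (p := i.1) (n := i.1 + i.2) (show r.toNat ≤ r'.toNat by omega)))) _ rfl (by
    have hr1 : r'.toNat = r.toNat + 1 := by omega
    ext c
    refine pageComplex_d_of_mem hK r hr _ _ _ ?_
    rw [← hr1]
    exact c.2)
  have h2 := congrArg (fun f => ModuleCat.Hom.hom f c') this
  refine Eq.trans h2 ?_
  exact congrArg (pageMk hK r hr i) (Subtype.ext h.symm)

lemma iCycles_injective (hK : IsFilteredComplex d K) (r : ℤ) (hr : 1 ≤ r) (i : ℕ × ℕ) :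
    Function.Injective ((pageComplex hK r hr).iCycles i).hom :=
  (ModuleCat.mono_iff_injective _).1 inferInstance

lemma homologyπ_repHomology_surjective (hK : IsFilteredComplex d K) (r r' : ℤ) (hr : 1 ≤ r)
    (hrr' : r + 1 = r') (i : ℕ × ℕ) :
    Function.Surjective (((pageComplex hK r hr).homologyπ i).hom ∘ₗ
      (repHomology hK r r' hr hrr' i).hom) := by
  have hr1 : r'.toNat = r.toNat + 1 := by omega
  intro y
  obtain ⟨z, rfl⟩ := (ModuleCat.epi_iff_surjective ((pageComplex hK r hr).homologyπ i)).1
    inferInstance y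
  obtain ⟨c, hc, hzc⟩ := exists_rep_of_cycle hK r hr i _ rfl
    (((pageComplex hK r hr).iCycles i).hom z) (by
      have := (pageComplex hK r hr).iCycles_d i
        ((ComplexShape.spectralSequenceNat ⟨r, 1 - r⟩).next i)
      exact congrArg (fun f => ModuleCat.Hom.hom f z) this)
  rw [← hr1] at hc
  refine ⟨⟨c, hc⟩, ?_⟩
  rw [LinearMap.comp_apply]
  congr 1
  apply iCycles_injective hK r hr i
  rw [iCycles_repHomology hK r r' hr hrr' i ⟨c, hc⟩ c rfl, hzc]

lemma ker_homologyπ_repHomology (hK : IsFilteredComplex d K) (r r' : ℤ) (hr : 1 ≤ r)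
    (hrr' : r + 1 = r') (i : ℕ × ℕ) :
    LinearMap.ker (((pageComplex hK r hr).homologyπ i).hom ∘ₗ
      (repHomology hK r r' hr hrr' i).hom) =
    (approxBoundaries d K r'.toNat i.1 (i.1 + i.2)).submoduleOf
      (approxCycles d K r'.toNat i.1 (i.1 + i.2)) := by
  have hr1 : r'.toNat = r.toNat + 1 := by omega
  -- The projection to homology is the cokernel of `toCycles`, so its kernel is the image of the
  -- incoming differential. `boundary_iff` identifies that image.
  have hex := (ShortComplex.moduleCat_exact_iff _).1 (ShortComplex.exact_of_g_is_cokernel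
    (ShortComplex.mk _ _ ((pageComplex hK r hr).toCycles_comp_homologyπ _ i))
    ((pageComplex hK r hr).homologyIsCokernel _ i rfl))
  have htoC : ∀ y, ((pageComplex hK r hr).iCycles i).hom
      (((pageComplex hK r hr).toCycles
        ((ComplexShape.spectralSequenceNat ⟨r, 1 - r⟩).prev i) i).hom y) =
      ((pageComplex hK r hr).d _ i).hom y := fun y =>
    congrArg (fun f => ModuleCat.Hom.hom f y) ((pageComplex hK r hr).toCycles_i _ i)
  have hπ : ∀ y, ((pageComplex hK r hr).homologyπ i).hom
      (((pageComplex hK r hr).toCycles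
        ((ComplexShape.spectralSequenceNat ⟨r, 1 - r⟩).prev i) i).hom y) = 0 := fun y =>
    congrArg (fun f => ModuleCat.Hom.hom f y) ((pageComplex hK r hr).toCycles_comp_homologyπ _ i)
  ext c'
  have hcm : (c' : C) ∈ approxCycles d K r.toNat i.1 (i.1 + i.2) :=
    ⟨c'.2.1, hK.anti (by omega) _ c'.2.2⟩
  have hcm' : (c' : C) ∈ approxCycles d K (r.toNat + 1) i.1 (i.1 + i.2) := by
    rw [← hr1]; exact c'.2
  have hb := boundary_iff hK r hr i _ rfl ⟨c', hcm⟩ hcm'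
  rw [← hr1] at hb
  refine Iff.trans ?_ hb
  rw [LinearMap.mem_ker, LinearMap.comp_apply]
  constructor
  · intro h0
    obtain ⟨y, hy⟩ := hex _ h0
    refine ⟨y, ?_⟩
    rw [← htoC, ← iCycles_repHomology hK r r' hr hrr' i c' ⟨c', hcm⟩ rfl]
    exact congrArg _ hy
  · rintro ⟨y, hy⟩
    rw [← hπ y]
    congr 1
    apply iCycles_injective hK r hr i
    rw [htoC, hy, iCycles_repHomology hK r r' hr hrr' i c' ⟨c', hcm⟩ rfl]

/-- The homology of the page `r` is the page `r + 1`. -/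
def pageHomologyEquiv (hK : IsFilteredComplex d K) (r r' : ℤ) (hr : 1 ≤ r)
    (hrr' : r + 1 = r') (i : ℕ × ℕ) :
    PageModule d K r'.toNat i.1 (i.1 + i.2) ≃ₗ[ℂ] (pageComplex hK r hr).homology i :=
  (Submodule.quotEquivOfEq _ _ (ker_homologyπ_repHomology hK r r' hr hrr' i).symm).trans
    (LinearMap.quotKerEquivOfSurjective _
      (homologyπ_repHomology_surjective hK r r' hr hrr' i))

lemma pageHomologyEquiv_mk (hK : IsFilteredComplex d K) (r r' : ℤ) (hr : 1 ≤ r)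
    (hrr' : r + 1 = r') (i : ℕ × ℕ) (c : approxCycles d K r'.toNat i.1 (i.1 + i.2)) :
    pageHomologyEquiv hK r r' hr hrr' i (Submodule.Quotient.mk c) =
      ((pageComplex hK r hr).homologyπ i).hom ((repHomology hK r r' hr hrr' i).hom c) :=
  rfl

/-- The spectral sequence of a filtered complex. -/
def spectralSequenceOf (hK : IsFilteredComplex d K) : SpectralSequenceOf d K where
  seq :=
    { page := fun r hr => pageComplex hK r hr
      iso := fun r r' i hrr' hr =>
        (pageHomologyEquiv hK r r' hr hrr' i).symm.toModuleIso }
  repr r hr p q := pageMk hK r hr (p, q)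
  repr_surjective r hr p q := pageMk_surjective hK r hr (p, q)
  ker_repr r hr p q := Submodule.ker_mkQ _
  d_repr := by
    intro r hr p q p' q' hp hq η η' h
    refine pageComplex_d_mk hK r hr (p, q) (p', q') ?_ η η' h
    rw [ComplexShape.spectralSequenceNat_rel_iff]
    simp only
    omega
  iso_repr := by
    intro r r' hr hr' hrr' p q η η' h z hz
    refine (LinearEquiv.symm_apply_eq (pageHomologyEquiv hK r r' hr hrr' (p, q))).2 ?_
    refine Eq.trans ?_ (pageHomologyEquiv_mk hK r r' hr hrr' (p, q) η').symm
    congr 1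
    apply iCycles_injective hK r hr
    exact hz.trans (iCycles_repHomology hK r r' hr hrr' (p, q) η' η h).symm

/-! ### Convergence -/

lemma Cohomology.mk_surjective (L : ℕ → Submodule ℂ C) (n : ℕ) :
    Function.Surjective (Cohomology.mk d L n) :=
  Submodule.mkQ_surjective _

lemma Cohomology.mk_eq_zero (L : ℕ → Submodule ℂ C) (n : ℕ) (z : cocycles d L n) :
    Cohomology.mk d L n z = 0 ↔ (z : C) ∈ coboundaries d L n :=
  Submodule.Quotient.mk_eq_zero _

lemma mem_filCohomology {p n : ℕ} {y : Cohomology d (K 0) n} :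
    y ∈ filCohomology d K p n ↔
      ∃ z : cocycles d (K 0) n, (z : C) ∈ K p n ∧ Cohomology.mk d (K 0) n z = y :=
  Iff.rfl

/-- If `q + 1 < r`, step `p + r` vanishes in degree `p + q + 1`, so `Z_r^p` and `Z_{r-1}^{p+1}`
consist of the cocycles in steps `p` and `p + 1`. If `p < r`, then `p + 1 - r = 0` and the
denominator contains every coboundary lying in step `p`. The quotient is then the graded piece of
the cohomology. -/
lemma spectralSequenceOf_converges (hK : IsFilteredComplex d K) :
    (spectralSequenceOf hK).Converges := by
  refine ⟨?_, ?_, ?_, ?_⟩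
  · intro n
    rw [eq_top_iff]
    rintro y -
    obtain ⟨z, rfl⟩ := Cohomology.mk_surjective _ _ y
    exact ⟨z, z.2.1, rfl⟩
  · rintro p n y ⟨z, hz, rfl⟩
    exact ⟨z, hK.succ_le p n hz, rfl⟩
  · intro n
    rw [eq_bot_iff]
    rintro y ⟨z, hz, rfl⟩
    rw [Submodule.mem_bot, Cohomology.mk_eq_zero,
      hK.eq_zero_of_lt (Nat.lt_succ_self n) (show (z : C) ∈ K (n + 1) n from hz)]
    exact Submodule.zero_mem _
  · intro r hr p q hpr hqr
    have hd0 : ∀ η : approxCycles d K r p (p + q), d (η : C) = 0 := fun η =>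
      hK.eq_zero_of_lt (by omega) η.2.2
    have hz : ∀ η ∈ approxCycles d K r p (p + q), η ∈ cocycles d (K 0) (p + q) := fun η hη =>
      ⟨hK.anti (Nat.zero_le p) _ hη.1, hd0 ⟨η, hη⟩⟩
    let toFil : approxCycles d K r p (p + q) →ₗ[ℂ] filCohomology d K p (p + q) :=
      (Cohomology.mk d (K 0) (p + q) ∘ₗ Submodule.inclusion hz).codRestrict _
        fun η => ⟨⟨η, hz η η.2⟩, η.2.1, rfl⟩
    let φ : approxCycles d K r p (p + q) →ₗ[ℂ] GrCohomology d K p (p + q) :=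
      Submodule.mkQ _ ∘ₗ toFil
    have hφs : Function.Surjective φ := by
      intro y
      obtain ⟨⟨_, z, hzK, rfl⟩, rfl⟩ := Submodule.mkQ_surjective _ y
      refine ⟨⟨z, hzK, ?_⟩, rfl⟩
      change d (z : C) ∈ K _ _
      rw [show d (z : C) = 0 from z.2.2]
      exact Submodule.zero_mem _
    have hker : LinearMap.ker φ = (approxBoundaries d K r p (p + q)).submoduleOf
        (approxCycles d K r p (p + q)) := by
      ext η
      have h1 : η ∈ LinearMap.ker φ ↔ Cohomology.mk d (K 0) (p + q) ⟨η, hz η η.2⟩ ∈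
          filCohomology d K (p + 1) (p + q) := by
        rw [LinearMap.mem_ker]
        exact Submodule.Quotient.mk_eq_zero _
      rw [h1, mem_filCohomology]
      change _ ↔ (η : C) ∈ approxBoundaries d K r p (p + q)
      have e0 : p + 1 - r = 0 := by omega
      constructor
      · rintro ⟨z, hzK, hzη⟩
        have hsub : (η : C) - z ∈ coboundaries d (K 0) (p + q) := by
          rw [eq_comm, ← sub_eq_zero, ← map_sub, Cohomology.mk_eq_zero] at hzη
          exact hzη
        -- A class in the next step has a cocycle `z` of step `p + 1` as representative. The
        -- difference `η - z` is a coboundary in step `p`.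
        rw [← add_sub_cancel (z : C) (η : C)]
        refine Submodule.add_mem _ (Submodule.mem_sup_left ⟨hzK, ?_⟩)
          (Submodule.mem_sup_right ⟨?_, ?_⟩)
        · change d (z : C) ∈ K _ _
          rw [show d (z : C) = 0 from z.2.2]
          exact Submodule.zero_mem _
        · exact Submodule.sub_mem _ η.2.1 (hK.succ_le _ _ hzK)
        · rw [e0]; exact hsub
      · intro hη
        obtain ⟨a, ha, b, hb, hab⟩ := Submodule.mem_sup.1 hη
        have hb' := hb.2
        rw [e0] at hb'
        have ha0 : d a = 0 := hK.eq_zero_of_lt (by omega) ha.2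
        refine ⟨⟨a, hK.anti (Nat.zero_le _) _ ha.1, ha0⟩, ha.1, ?_⟩
        rw [eq_comm, ← sub_eq_zero, ← map_sub, Cohomology.mk_eq_zero]
        change (η : C) - a ∈ _
        rw [← hab, add_sub_cancel_left]
        exact hb'
    refine ⟨(Submodule.quotEquivOfEq _ _ hker.symm).trans
      (LinearMap.quotKerEquivOfSurjective φ hφs), fun η => ?_⟩
    exact ⟨⟨η, hz η η.2⟩, ⟨⟨η, hz η η.2⟩, η.2.1, rfl⟩, rfl, rfl⟩

end FilteredComplex

end Involutive

end

noncomputable section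

namespace Involutive

/-! ### Exterior algebras of an extension -/

section ExteriorExtension

open ExteriorAlgebra

variable {N B N' : Type*} [AddCommGroup N] [Module ℂ N] [AddCommGroup B] [Module ℂ B]
  [AddCommGroup N'] [Module ℂ N'] (V : Type*) [AddCommGroup V] [Module ℂ V]

/-- Graded commutativity: true on generators by anticommutation, and preserved by products. It makes
the left ideal generated by vectors two-sided. -/
lemma ι_mul_eq_involute_mul (n : N) (α : ExteriorAlgebra ℂ N) :
    ι ℂ n * α = CliffordAlgebra.involute α * ι ℂ n := by
  induction α using ExteriorAlgebra.induction generalizing n with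
  | algebraMap r =>
    rw [AlgHom.commutes]; exact (Algebra.commutes r _).symm
  | ι m =>
    rw [CliffordAlgebra.involute_ι, neg_mul]
    exact eq_neg_of_add_eq_zero_left (ι_add_mul_swap n m)
  | mul a b ha hb => rw [map_mul, ← mul_assoc, ha, mul_assoc, hb, mul_assoc]
  | add a b ha hb => rw [map_add, mul_add, add_mul, ha, hb]

/-- `Λ N ⊗ (Λ^p B ⊗ V) → Λ N ⊗ V`, `α ⊗ (β ⊗ v) ↦ (α ∧ β) ⊗ v`, for a linear map `B → N`. -/
def wedgeOf (j : B →ₗ[ℂ] N) (p : ℕ) :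
    ExteriorAlgebra ℂ N ⊗[ℂ] (⋀[ℂ]^p B ⊗[ℂ] V) →ₗ[ℂ] ExteriorAlgebra ℂ N ⊗[ℂ] V :=
  (LinearMap.rTensor V (TensorProduct.lift
    ((LinearMap.mul ℂ (ExteriorAlgebra ℂ N)).compl₂
      ((ExteriorAlgebra.map j).toLinearMap ∘ₗ (⋀[ℂ]^p B).subtype)))) ∘ₗ
  (TensorProduct.assoc ℂ _ _ _).symm.toLinearMap

variable {V}

@[simp]
lemma wedgeOf_tmul (j : B →ₗ[ℂ] N) (p : ℕ) (α : ExteriorAlgebra ℂ N) (β : ⋀[ℂ]^p B) (v : V) :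
    wedgeOf V j p (α ⊗ₜ (β ⊗ₜ v)) = (α * ExteriorAlgebra.map j (β : ExteriorAlgebra ℂ B)) ⊗ₜ v :=
  rfl

lemma tmul_mem_range_wedgeOf (j : B →ₗ[ℂ] N) (p : ℕ) (α : ExteriorAlgebra ℂ N)
    (β : ⋀[ℂ]^p B) (v : V) :
    (α * ExteriorAlgebra.map j (β : ExteriorAlgebra ℂ B)) ⊗ₜ v ∈
      LinearMap.range (wedgeOf V j p) :=
  ⟨α ⊗ₜ (β ⊗ₜ v), rfl⟩

/-- To check that a linear map sends `range (wedgeOf V j p)` to a subspace, one may look at the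
elements `(α ∧ b₁ ∧ ⋯ ∧ b_p) ⊗ v`. -/
lemma range_wedgeOf_le {j : B →ₗ[ℂ] N} {p : ℕ} {X : Type*} [AddCommGroup X] [Module ℂ X]
    (L : ExteriorAlgebra ℂ N ⊗[ℂ] V →ₗ[ℂ] X) (S : Submodule ℂ X)
    (h : ∀ α (b : Fin p → B) (v : V), L ((α * ιMulti ℂ p (fun i => j (b i))) ⊗ₜ v) ∈ S)
    {x : ExteriorAlgebra ℂ N ⊗[ℂ] V} (hx : x ∈ LinearMap.range (wedgeOf V j p)) : L x ∈ S := by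
  obtain ⟨t, rfl⟩ := hx
  induction t using TensorProduct.induction_on with
  | zero => simp
  | add a b ha hb => rw [map_add, map_add]; exact S.add_mem ha hb
  | tmul α w =>
    induction w using TensorProduct.induction_on with
    | zero => simp
    | add a b ha hb => rw [TensorProduct.tmul_add, map_add, map_add]; exact S.add_mem ha hb
    | tmul β v =>
      have hβ : β ∈ Submodule.span ℂ (Set.range (exteriorPower.ιMulti ℂ p (M := B))) := by
        rw [exteriorPower.ιMulti_span]; trivial
      induction hβ using Submodule.span_induction with
      | mem x hx =>
        obtain ⟨b, rfl⟩ := hx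
        have := h α b v
        simpa [ExteriorAlgebra.map_apply_ιMulti, Function.comp_def] using this
      | zero => simp
      | add a b _ _ ha hb =>
        rw [TensorProduct.add_tmul, TensorProduct.tmul_add, map_add, map_add]
        exact S.add_mem ha hb
      | smul c a _ ha =>
        rw [← TensorProduct.smul_tmul', TensorProduct.tmul_smul, map_smul, map_smul]
        exact S.smul_mem c ha

lemma mul_ιMulti_tmul_mem (j : B →ₗ[ℂ] N) (p : ℕ) (α : ExteriorAlgebra ℂ N) (b : Fin p → B)
    (v : V) : (α * ιMulti ℂ p (fun i => j (b i))) ⊗ₜ v ∈ LinearMap.range (wedgeOf V j p) := by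
  have := tmul_mem_range_wedgeOf j p α (exteriorPower.ιMulti ℂ p b) v
  simpa [ExteriorAlgebra.map_apply_ιMulti, Function.comp_def] using this

/-- One of the `p + 1` factors from `B` is absorbed into `α`. -/
lemma range_wedgeOf_succ_le (j : B →ₗ[ℂ] N) (p : ℕ) :
    LinearMap.range (wedgeOf V j (p + 1)) ≤ LinearMap.range (wedgeOf V j p) := by
  intro x hx
  refine range_wedgeOf_le LinearMap.id _ (fun α b v => ?_) hx
  rw [ιMulti_succ_apply, ← mul_assoc]
  exact mul_ιMulti_tmul_mem j p _ _ v

lemma range_wedgeOf_zero (j : B →ₗ[ℂ] N) : LinearMap.range (wedgeOf V j 0) = ⊤ := by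
  rw [eq_top_iff]
  rintro x -
  induction x using TensorProduct.induction_on with
  | zero => simp
  | add a b ha hb => exact Submodule.add_mem _ ha hb
  | tmul α v =>
    have := mul_ιMulti_tmul_mem j 0 α (fun i => i.elim0) v
    simpa using this

lemma mulLeft_mem_range_wedgeOf (j : B →ₗ[ℂ] N) (p : ℕ) (ζ : ExteriorAlgebra ℂ N)
    {x : ExteriorAlgebra ℂ N ⊗[ℂ] V} (hx : x ∈ LinearMap.range (wedgeOf V j p)) :
    LinearMap.rTensor V (LinearMap.mulLeft ℂ ζ) x ∈ LinearMap.range (wedgeOf V j p) := by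
  refine range_wedgeOf_le _ _ (fun α b v => ?_) hx
  rw [LinearMap.rTensor_tmul, LinearMap.mulLeft_apply, ← mul_assoc]
  exact mul_ιMulti_tmul_mem j p _ _ v

/-- The left ideal generated by `B` in `Λ N`. -/
def extIdeal (j : B →ₗ[ℂ] N) : Submodule ℂ (ExteriorAlgebra ℂ N) :=
  Submodule.span ℂ {x | ∃ α b, x = α * ι ℂ (j b)}

lemma ι_mem_extIdeal (j : B →ₗ[ℂ] N) (b : B) : ι ℂ (j b) ∈ extIdeal j :=
  Submodule.subset_span ⟨1, b, (one_mul _).symm⟩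

lemma mul_mem_extIdeal_left (j : B →ₗ[ℂ] N) (α : ExteriorAlgebra ℂ N) {x : ExteriorAlgebra ℂ N}
    (hx : x ∈ extIdeal j) : α * x ∈ extIdeal j := by
  induction hx using Submodule.span_induction with
  | mem x hx =>
    obtain ⟨α', b, rfl⟩ := hx
    exact Submodule.subset_span ⟨α * α', b, by rw [mul_assoc]⟩
  | zero => simp
  | add a b _ _ ha hb => rw [mul_add]; exact Submodule.add_mem _ ha hb
  | smul c a _ ha => rw [mul_smul_comm]; exact Submodule.smul_mem _ _ ha

lemma mul_mem_extIdeal_right (j : B →ₗ[ℂ] N) (α : ExteriorAlgebra ℂ N) {x : ExteriorAlgebra ℂ N}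
    (hx : x ∈ extIdeal j) : x * α ∈ extIdeal j := by
  induction hx using Submodule.span_induction with
  | mem x hx =>
    obtain ⟨α', b, rfl⟩ := hx
    refine Submodule.subset_span ⟨α' * CliffordAlgebra.involute α, b, ?_⟩
    rw [mul_assoc, ι_mul_eq_involute_mul, mul_assoc]
  | zero => simp
  | add a b _ _ ha hb => rw [add_mul]; exact Submodule.add_mem _ ha hb
  | smul c a _ ha => rw [smul_mul_assoc]; exact Submodule.smul_mem _ _ ha

/-- Multiplication by the ideal generated by `B` raises the filtration. -/
lemma mulLeft_mem_range_wedgeOf_succ (j : B →ₗ[ℂ] N) (p : ℕ) {ζ : ExteriorAlgebra ℂ N}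
    (hζ : ζ ∈ extIdeal j) {x : ExteriorAlgebra ℂ N ⊗[ℂ] V}
    (hx : x ∈ LinearMap.range (wedgeOf V j p)) :
    LinearMap.rTensor V (LinearMap.mulLeft ℂ ζ) x ∈ LinearMap.range (wedgeOf V j (p + 1)) := by
  refine range_wedgeOf_le _ _ (fun α b v => ?_) hx
  rw [LinearMap.rTensor_tmul, LinearMap.mulLeft_apply, ← mul_assoc]
  -- The ideal is two-sided, so `ζ ∧ α` is a sum of terms `α' ∧ b'`, and each `b'` joins `b₁, …,
  -- b_p` as one more factor from `B`.
  have hm := mul_mem_extIdeal_right j α hζ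
  generalize ζ * α = γ at hm
  induction hm using Submodule.span_induction with
  | mem x hx =>
    obtain ⟨α', b', rfl⟩ := hx
    have := mul_ιMulti_tmul_mem j (p + 1) α' (Fin.cons b' b) v
    rw [ιMulti_succ_apply, ← mul_assoc] at this
    simpa [Matrix.vecTail, Function.comp_def] using this
  | zero => simp
  | add a b _ _ ha hb => rw [add_mul, TensorProduct.add_tmul]; exact Submodule.add_mem _ ha hb
  | smul c a _ ha =>
    rw [smul_mul_assoc, ← TensorProduct.smul_tmul']; exact Submodule.smul_mem _ _ ha

/-! ### Linear splittings and the kernel of the reduction `Λ N → Λ N'` -/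

section Section

variable {j : B →ₗ[ℂ] N} {π : N →ₗ[ℂ] N'} {s : N' →ₗ[ℂ] N}

/-- The algebra endomorphism induced by `s ∘ π` agrees with the identity on generators modulo a
two-sided ideal, hence everywhere modulo that ideal. -/
lemma sub_map_mem_extIdeal (hs : ∀ n, ∃ b, n - s (π n) = j b) (α : ExteriorAlgebra ℂ N) :
    α - ExteriorAlgebra.map s (ExteriorAlgebra.map π α) ∈ extIdeal j := by
  induction α using ExteriorAlgebra.induction with
  | algebraMap r => simp [AlgHom.commutes]
  | ι n =>
    obtain ⟨b, hb⟩ := hs n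
    rw [ExteriorAlgebra.map_apply_ι, ExteriorAlgebra.map_apply_ι, ← map_sub, hb]
    exact ι_mem_extIdeal j b
  | add a b ha hb =>
    rw [map_add, map_add, add_sub_add_comm]
    exact Submodule.add_mem _ ha hb
  | mul a b ha hb =>
    have e : ∀ a b a' b' : ExteriorAlgebra ℂ N, a * b - a' * b' = a * (b - b') + (a - a') * b' := by
      intro a b a' b'
      rw [mul_sub, sub_mul]; abel
    rw [map_mul, map_mul, e]
    exact Submodule.add_mem _ (mul_mem_extIdeal_left j _ hb) (mul_mem_extIdeal_right j _ ha)

lemma exists_linear_section (hπ : Function.Surjective π)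
    (hker : LinearMap.ker π ≤ LinearMap.range j) :
    ∃ s : N' →ₗ[ℂ] N, ∀ n, ∃ b, n - s (π n) = j b := by
  obtain ⟨s, hs⟩ := LinearMap.exists_rightInverse_of_surjective π (LinearMap.range_eq_top.2 hπ)
  refine ⟨s, fun n => ?_⟩
  have : n - s (π n) ∈ LinearMap.ker π := by
    rw [LinearMap.mem_ker, map_sub, sub_eq_zero]
    exact (LinearMap.congr_fun hs (π n)).symm
  obtain ⟨b, hb⟩ := hker this
  exact ⟨b, hb.symm⟩

lemma mem_extIdeal_of_map_eq_zero (hπ : Function.Surjective π)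
    (hker : LinearMap.ker π ≤ LinearMap.range j) {ζ : ExteriorAlgebra ℂ N}
    (hζ : ExteriorAlgebra.map π ζ = 0) : ζ ∈ extIdeal j := by
  obtain ⟨s, hs⟩ := exists_linear_section hπ hker
  have := sub_map_mem_extIdeal hs ζ
  rwa [hζ, map_zero, sub_zero] at this

/-- Injectivity of the leading part on the graded piece. Replacing `α` by its image under `s ∘ π`
changes `α ∧ β` by (ideal of `B`) `∧ β`, which lies in step `p + 1`; and that image is zero when the
reduction is. -/
lemma wedgeOf_mem_succ_of_reduce_eq_zero (hπ : Function.Surjective π)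
    (hker : LinearMap.ker π ≤ LinearMap.range j) (p : ℕ)
    {t : ExteriorAlgebra ℂ N ⊗[ℂ] (⋀[ℂ]^p B ⊗[ℂ] V)}
    (ht : LinearMap.rTensor _ (ExteriorAlgebra.map π).toLinearMap t = 0) :
    wedgeOf V j p t ∈ LinearMap.range (wedgeOf V j (p + 1)) := by
  obtain ⟨s, hs⟩ := exists_linear_section hπ hker
  have key : ∀ t : ExteriorAlgebra ℂ N ⊗[ℂ] (⋀[ℂ]^p B ⊗[ℂ] V),
      wedgeOf V j p t - wedgeOf V j p (LinearMap.rTensor _ (ExteriorAlgebra.map s).toLinearMap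
        (LinearMap.rTensor _ (ExteriorAlgebra.map π).toLinearMap t)) ∈
      LinearMap.range (wedgeOf V j (p + 1)) := by
    intro t
    induction t using TensorProduct.induction_on with
    | zero => simp
    | add a b ha hb =>
      simp only [map_add, add_sub_add_comm]
      exact Submodule.add_mem _ ha hb
    | tmul α w =>
      rw [LinearMap.rTensor_tmul, LinearMap.rTensor_tmul, ← map_sub, ← TensorProduct.sub_tmul]
      have hm := sub_map_mem_extIdeal hs α
      simp only [AlgHom.toLinearMap_apply]
      generalize α - _ = δ at hm
      have hm' := mulLeft_mem_range_wedgeOf_succ (V := V) j p hm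
        (x := wedgeOf V j p (1 ⊗ₜ w)) ⟨_, rfl⟩
      convert hm' using 1
      clear hm'
      induction w using TensorProduct.induction_on with
      | zero => simp
      | add a b ha hb => simp only [TensorProduct.tmul_add, map_add, ha, hb]
      | tmul β v => simp
  have := key t
  rwa [ht, map_zero, map_zero, sub_zero] at this

end Section

/-! The leading part of an element of the filtration is computed by the algebra map
`Λ N → End (Λ N' ⊗ Λ B)` that sends `a` to `π a ∧ · + (-1)^• (r a ∧ ·)`. -/

section Symbol

variable (π : N →ₗ[ℂ] N') (r : N →ₗ[ℂ] B)

/-- The operator `ξ ⊗ β ↦ (π a ∧ ξ) ⊗ β + (-1)^{deg ξ} ξ ⊗ (r a ∧ β)`. -/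
def splitWedge : N →ₗ[ℂ] Module.End ℂ (ExteriorAlgebra ℂ N' ⊗[ℂ] ExteriorAlgebra ℂ B) where
  toFun a := TensorProduct.map (LinearMap.mulLeft ℂ (ι ℂ (π a))) LinearMap.id +
    TensorProduct.map CliffordAlgebra.involute.toLinearMap (LinearMap.mulLeft ℂ (ι ℂ (r a)))
  map_add' a b := by
    ext ξ β
    simp [add_mul, TensorProduct.add_tmul, TensorProduct.tmul_add]
    abel
  map_smul' c a := by
    ext ξ β
    simp [TensorProduct.smul_tmul']

lemma splitWedge_tmul (a : N) (ξ : ExteriorAlgebra ℂ N') (β : ExteriorAlgebra ℂ B) :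
    splitWedge π r a (ξ ⊗ₜ β) =
      (ι ℂ (π a) * ξ) ⊗ₜ β + CliffordAlgebra.involute ξ ⊗ₜ (ι ℂ (r a) * β) :=
  rfl

/-- The squares of `π a` and `r a` vanish, and the two mixed terms cancel because `involute` changes
sign past `π a`. This cancellation is what the sign in `splitWedge` is for. -/
lemma splitWedge_sq (a : N) : splitWedge π r a * splitWedge π r a = 0 := by
  refine TensorProduct.ext' fun ξ β => ?_
  rw [Module.End.mul_apply, splitWedge_tmul, map_add, splitWedge_tmul, splitWedge_tmul,
    ← mul_assoc, ι_sq_zero, zero_mul, TensorProduct.zero_tmul, zero_add, ← mul_assoc (ι ℂ (r a)),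
    ι_sq_zero, zero_mul, TensorProduct.tmul_zero, add_zero, map_mul, CliffordAlgebra.involute_ι,
    neg_mul, TensorProduct.neg_tmul, neg_add_cancel]
  rfl

/-- The algebra map `Λ N → End (Λ N' ⊗ Λ B)`. -/
def splitAlgHom : ExteriorAlgebra ℂ N →ₐ[ℂ]
    Module.End ℂ (ExteriorAlgebra ℂ N' ⊗[ℂ] ExteriorAlgebra ℂ B) :=
  ExteriorAlgebra.lift ℂ ⟨splitWedge π r, splitWedge_sq π r⟩

@[simp]
lemma splitAlgHom_ι (a : N) : splitAlgHom π r (ι ℂ a) = splitWedge π r a :=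
  ExteriorAlgebra.lift_ι_apply ℂ _ _ _

/-- The map `Λ N → Λ N' ⊗ Λ B`, an isomorphism if `π` and `r` split `N` as `N' ⊕ B`. -/
def splitMap : ExteriorAlgebra ℂ N →ₗ[ℂ] ExteriorAlgebra ℂ N' ⊗[ℂ] ExteriorAlgebra ℂ B :=
  LinearMap.applyₗ (1 ⊗ₜ 1) ∘ₗ (splitAlgHom π r).toLinearMap

lemma splitMap_one : splitMap π r 1 = 1 ⊗ₜ 1 := by
  change splitAlgHom π r 1 (1 ⊗ₜ 1) = _
  rw [map_one]
  rfl

lemma splitMap_mul (α γ : ExteriorAlgebra ℂ N) :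
    splitMap π r (α * γ) = splitAlgHom π r α (splitMap π r γ) := by
  change splitAlgHom π r (α * γ) (1 ⊗ₜ 1) = _
  rw [map_mul]
  rfl

lemma splitMap_ι_mul (a : N) (γ : ExteriorAlgebra ℂ N) :
    splitMap π r (ι ℂ a * γ) = splitWedge π r a (splitMap π r γ) := by
  rw [splitMap_mul, splitAlgHom_ι]

variable (B N') in
/-- The part of `Λ N' ⊗ Λ B` of degree at least `p` in the second factor. -/
def tailDeg (p : ℕ) : Submodule ℂ (ExteriorAlgebra ℂ N' ⊗[ℂ] ExteriorAlgebra ℂ B) :=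
  Submodule.span ℂ {x | ∃ k, p ≤ k ∧ ∃ ξ, ∃ β ∈ ⋀[ℂ]^k B, x = ξ ⊗ₜ β}

lemma map_mem_tailDeg {p p' : ℕ}
    (L : Module.End ℂ (ExteriorAlgebra ℂ N' ⊗[ℂ] ExteriorAlgebra ℂ B))
    (h : ∀ k, p ≤ k → ∀ ξ, ∀ β ∈ ⋀[ℂ]^k B, L (ξ ⊗ₜ β) ∈ tailDeg B N' p')
    {y : ExteriorAlgebra ℂ N' ⊗[ℂ] ExteriorAlgebra ℂ B} (hy : y ∈ tailDeg B N' p) :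
    L y ∈ tailDeg B N' p' := by
  induction hy using Submodule.span_induction with
  | mem x hx =>
    obtain ⟨k, hk, ξ, β, hβ, rfl⟩ := hx
    exact h k hk ξ β hβ
  | zero => simp
  | add a b _ _ ha hb => rw [map_add]; exact Submodule.add_mem _ ha hb
  | smul c a _ ha => rw [map_smul]; exact Submodule.smul_mem _ _ ha

lemma tailDeg_succ_le (p : ℕ) : tailDeg B N' (p + 1) ≤ tailDeg B N' p := by
  refine Submodule.span_mono ?_
  rintro x ⟨k, hk, h⟩
  exact ⟨k, by omega, h⟩

lemma ι_mul_mem_exteriorPower (b : B) {k : ℕ} {β : ExteriorAlgebra ℂ B} (hβ : β ∈ ⋀[ℂ]^k B) :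
    ι ℂ b * β ∈ ⋀[ℂ]^(k + 1) B := by
  rw [exteriorPower, pow_succ']
  exact Submodule.mul_mem_mul ⟨b, rfl⟩ hβ

lemma rTensor_mulLeft_mem_tailDeg (ξ' : ExteriorAlgebra ℂ N') {p : ℕ}
    {y : ExteriorAlgebra ℂ N' ⊗[ℂ] ExteriorAlgebra ℂ B} (hy : y ∈ tailDeg B N' p) :
    LinearMap.rTensor _ (LinearMap.mulLeft ℂ ξ') y ∈ tailDeg B N' p :=
  map_mem_tailDeg (LinearMap.rTensor _ (LinearMap.mulLeft ℂ ξ'))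
    (fun k hk ξ β hβ => Submodule.subset_span ⟨k, hk, ξ' * ξ, β, hβ, rfl⟩) hy

/-- For a generator the `r`-term raises the degree in `Λ B` by one, so only multiplication by `π a`
survives to leading order. Leading-order statements multiply. -/
lemma splitAlgHom_sub_mem (α : ExteriorAlgebra ℂ N) {p : ℕ}
    {y : ExteriorAlgebra ℂ N' ⊗[ℂ] ExteriorAlgebra ℂ B} (hy : y ∈ tailDeg B N' p) :
    splitAlgHom π r α y -
      LinearMap.rTensor _ (LinearMap.mulLeft ℂ (ExteriorAlgebra.map π α)) y ∈
        tailDeg B N' (p + 1) := by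
  induction α using ExteriorAlgebra.induction generalizing y with
  | algebraMap c =>
    have : LinearMap.mulLeft ℂ (algebraMap ℂ (ExteriorAlgebra ℂ N') c) = c • LinearMap.id := by
      ext; simp [Algebra.smul_def]
    rw [AlgHom.commutes, AlgHom.commutes, this, LinearMap.rTensor_smul, LinearMap.rTensor_id,
      Module.algebraMap_end_apply]
    simp
  | ι n =>
    rw [splitAlgHom_ι, ExteriorAlgebra.map_apply_ι, ← LinearMap.sub_apply]
    refine map_mem_tailDeg _ (fun k hk ξ β hβ => ?_) hy
    rw [LinearMap.sub_apply, splitWedge_tmul, LinearMap.rTensor_tmul, LinearMap.mulLeft_apply,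
      add_sub_cancel_left]
    exact Submodule.subset_span ⟨k + 1, by omega, _, _, ι_mul_mem_exteriorPower _ hβ, rfl⟩
  | add a b ha hb =>
    have : LinearMap.mulLeft ℂ (ExteriorAlgebra.map π a + ExteriorAlgebra.map π b) =
        LinearMap.mulLeft ℂ (ExteriorAlgebra.map π a) +
          LinearMap.mulLeft ℂ (ExteriorAlgebra.map π b) := by
      ext; simp [add_mul]
    rw [map_add, map_add, this, LinearMap.rTensor_add, LinearMap.add_apply, LinearMap.add_apply,
      add_sub_add_comm]
    exact Submodule.add_mem _ (ha hy) (hb hy)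
  | mul a b ha hb =>
    rw [map_mul, map_mul, LinearMap.mulLeft_mul, LinearMap.rTensor_comp, LinearMap.comp_apply,
      Module.End.mul_apply]
    have hb1 : splitAlgHom π r b y ∈ tailDeg B N' p := by
      have := Submodule.add_mem _ (tailDeg_succ_le p (hb hy))
        (rTensor_mulLeft_mem_tailDeg (ExteriorAlgebra.map π b) hy)
      rwa [sub_add_cancel] at this
    have h1 := Submodule.add_mem _ (ha hb1)
      (rTensor_mulLeft_mem_tailDeg (ExteriorAlgebra.map π a) (hb hy))
    rwa [map_sub, sub_add_sub_cancel] at h1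

lemma splitAlgHom_mem_tailDeg (α : ExteriorAlgebra ℂ N) {p : ℕ}
    {y : ExteriorAlgebra ℂ N' ⊗[ℂ] ExteriorAlgebra ℂ B} (hy : y ∈ tailDeg B N' p) :
    splitAlgHom π r α y ∈ tailDeg B N' p := by
  have := Submodule.add_mem _ (tailDeg_succ_le p (splitAlgHom_sub_mem π r α hy))
    (rTensor_mulLeft_mem_tailDeg (ExteriorAlgebra.map π α) hy)
  rwa [sub_add_cancel] at this

variable {π r} in
lemma splitMap_map {j : B →ₗ[ℂ] N} (hπ : ∀ b, π (j b) = 0) (hr : ∀ b, r (j b) = b)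
    (β : ExteriorAlgebra ℂ B) : splitMap π r (ExteriorAlgebra.map j β) = 1 ⊗ₜ β := by
  -- Acting on every `1 ⊗ β'`, not only on `1 ⊗ 1`, is what lets the induction pass through
  -- products.
  have key : ∀ β' : ExteriorAlgebra ℂ B,
      splitAlgHom π r (ExteriorAlgebra.map j β) (1 ⊗ₜ β') = 1 ⊗ₜ (β * β') := by
    induction β using ExteriorAlgebra.induction with
    | algebraMap c =>
      intro β'
      rw [AlgHom.commutes, AlgHom.commutes, Module.algebraMap_end_apply, ← Algebra.smul_def,
        TensorProduct.tmul_smul]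
    | ι b =>
      intro β'
      rw [ExteriorAlgebra.map_apply_ι, splitAlgHom_ι, splitWedge_tmul, hπ, hr]
      simp
    | add a b ha hb =>
      intro β'
      rw [map_add, map_add, LinearMap.add_apply, ha, hb, add_mul, TensorProduct.tmul_add]
    | mul a b ha hb =>
      intro β'
      rw [map_mul, map_mul, Module.End.mul_apply, hb, ha, mul_assoc]
  have := key 1
  rwa [mul_one] at this

variable (B) in
/-- The projection of `Λ B` to its part of degree `k`. -/
def projDeg (k : ℕ) : ExteriorAlgebra ℂ B →ₗ[ℂ] ⋀[ℂ]^k B :=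
  DirectSum.component ℂ ℕ (fun i => ⋀[ℂ]^i B) k ∘ₗ
    (DirectSum.decomposeLinearEquiv (fun i : ℕ => ⋀[ℂ]^i B)).toLinearMap

lemma projDeg_coe {k : ℕ} (β : ⋀[ℂ]^k B) : projDeg B k (β : ExteriorAlgebra ℂ B) = β := by
  change DirectSum.decompose (fun i : ℕ => ⋀[ℂ]^i B) (β : ExteriorAlgebra ℂ B) k = β
  rw [DirectSum.decompose_coe, DirectSum.of_eq_same]

lemma projDeg_of_mem {k l : ℕ} (h : l ≠ k) {β : ExteriorAlgebra ℂ B} (hβ : β ∈ ⋀[ℂ]^l B) :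
    projDeg B k β = 0 := by
  change DirectSum.decompose (fun i : ℕ => ⋀[ℂ]^i B) β k = 0
  exact Subtype.ext (DirectSum.decompose_of_mem_ne (fun i : ℕ => ⋀[ℂ]^i B) hβ h)

lemma lTensor_projDeg_of_mem {p : ℕ} {y : ExteriorAlgebra ℂ N' ⊗[ℂ] ExteriorAlgebra ℂ B}
    (hy : y ∈ tailDeg B N' (p + 1)) : LinearMap.lTensor _ (projDeg B p) y = 0 := by
  induction hy using Submodule.span_induction with
  | mem x hx =>
    obtain ⟨k, hk, ξ, β, hβ, rfl⟩ := hx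
    rw [LinearMap.lTensor_tmul, projDeg_of_mem (by omega) hβ, TensorProduct.tmul_zero]
  | zero => simp
  | add a b _ _ ha hb => rw [map_add, ha, hb, add_zero]
  | smul c a _ ha => rw [map_smul, ha, smul_zero]

variable (V) in
/-- The map `Λ N ⊗ V → Λ N' ⊗ (Λ^p B ⊗ V)` that gives the leading part of elements of the
`p`-th step of the filtration. -/
def symbolMap (p : ℕ) :
    ExteriorAlgebra ℂ N ⊗[ℂ] V →ₗ[ℂ] ExteriorAlgebra ℂ N' ⊗[ℂ] (⋀[ℂ]^p B ⊗[ℂ] V) :=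
  (TensorProduct.assoc ℂ _ _ _).toLinearMap ∘ₗ
    LinearMap.rTensor V (LinearMap.lTensor _ (projDeg B p) ∘ₗ splitMap π r)

lemma symbolMap_tmul (p : ℕ) (α : ExteriorAlgebra ℂ N) (v : V) :
    symbolMap V π r p (α ⊗ₜ v) = TensorProduct.assoc ℂ _ _ _
      (LinearMap.lTensor _ (projDeg B p) (splitMap π r α) ⊗ₜ v) :=
  rfl

variable {π r} in
-- `α ∧ β` is sent to the operator of `α` applied to `1 ⊗ β`, that is to `π α ⊗ β` plus terms of
-- degree above `p` in `Λ B`, which `projDeg` removes. The right-hand side involves neither `r` nor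
-- a choice of representation: the leading part is well defined.
lemma symbolMap_wedgeOf {j : B →ₗ[ℂ] N} (hπ : ∀ b, π (j b) = 0) (hr : ∀ b, r (j b) = b) (p : ℕ)
    (t : ExteriorAlgebra ℂ N ⊗[ℂ] (⋀[ℂ]^p B ⊗[ℂ] V)) :
    symbolMap V π r p (wedgeOf V j p t) =
      LinearMap.rTensor _ (ExteriorAlgebra.map π).toLinearMap t := by
  induction t using TensorProduct.induction_on with
  | zero => simp
  | add a b ha hb => rw [map_add, map_add, map_add, ha, hb]
  | tmul α w =>
    induction w using TensorProduct.induction_on with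
    | zero => simp
    | add a b ha hb => rw [TensorProduct.tmul_add, map_add, map_add, map_add, ha, hb]
    | tmul β v =>
      have h1 : (1 : ExteriorAlgebra ℂ N') ⊗ₜ[ℂ] (β : ExteriorAlgebra ℂ B) ∈ tailDeg B N' p :=
        Submodule.subset_span ⟨p, le_rfl, 1, β, β.2, rfl⟩
      have h2 := lTensor_projDeg_of_mem (splitAlgHom_sub_mem π r α h1)
      rw [map_sub, sub_eq_zero] at h2
      rw [wedgeOf_tmul, symbolMap_tmul, splitMap_mul, splitMap_map hπ hr, h2,
        LinearMap.rTensor_tmul, LinearMap.lTensor_tmul, projDeg_coe]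
      simp

variable {π r} in
lemma symbolMap_of_mem_succ {j : B →ₗ[ℂ] N} (hπ : ∀ b, π (j b) = 0) (hr : ∀ b, r (j b) = b)
    (p : ℕ) {x : ExteriorAlgebra ℂ N ⊗[ℂ] V} (hx : x ∈ LinearMap.range (wedgeOf V j (p + 1))) :
    symbolMap V π r p x = 0 := by
  obtain ⟨t, rfl⟩ := hx
  induction t using TensorProduct.induction_on with
  | zero => simp
  | add a b ha hb => rw [map_add, map_add, ha, hb, add_zero]
  | tmul α w =>
    induction w using TensorProduct.induction_on with
    | zero => simp
    | add a b ha hb => rw [TensorProduct.tmul_add, map_add, map_add, ha, hb, add_zero]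
    | tmul β v =>
      have h1 : (1 : ExteriorAlgebra ℂ N') ⊗ₜ[ℂ] (β : ExteriorAlgebra ℂ B) ∈
          tailDeg B N' (p + 1) :=
        Submodule.subset_span ⟨p + 1, le_rfl, 1, β, β.2, rfl⟩
      rw [wedgeOf_tmul, symbolMap_tmul, splitMap_mul, splitMap_map hπ hr,
        lTensor_projDeg_of_mem (splitAlgHom_mem_tailDeg π r α h1)]
      simp

end Symbol

/-- An element of degree `n` in the step `n + 1` of the filtration vanishes. -/
lemma rTensor_projDeg_of_mem (j : B →ₗ[ℂ] N) (n : ℕ) {x : ExteriorAlgebra ℂ N ⊗[ℂ] V}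
    (hx : x ∈ LinearMap.range (wedgeOf V j (n + 1))) :
    LinearMap.rTensor V (projDeg N n) x = 0 := by
  refine (Submodule.mem_bot ℂ).1 (range_wedgeOf_le (X := ⋀[ℂ]^n N ⊗[ℂ] V)
    (LinearMap.rTensor V (projDeg N n)) ⊥ (fun α b v => ?_) hx)
  rw [Submodule.mem_bot, LinearMap.rTensor_tmul]
  have hα : α ∈ Submodule.span ℂ (Set.range fun x : Σ n, (Fin n → N) => ιMulti ℂ x.1 x.2) := by
    rw [ExteriorAlgebra.ιMulti_span]; trivial
  have : projDeg N n (α * ιMulti ℂ (n + 1) fun i => j (b i)) = 0 := by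
    induction hα using Submodule.span_induction with
    | mem x hx =>
      obtain ⟨⟨k, a⟩, rfl⟩ := hx
      refine projDeg_of_mem (l := k + (n + 1)) (by omega) ?_
      exact SetLike.mul_mem_graded (ιMulti_range ℂ k ⟨a, rfl⟩) (ιMulti_range ℂ (n + 1) ⟨_, rfl⟩)
    | zero => simp
    | add a b _ _ ha hb => rw [add_mul, map_add, ha, hb, add_zero]
    | smul c a _ ha => rw [smul_mul_assoc, map_smul, ha, smul_zero]
  rw [this, TensorProduct.zero_tmul]

/-- On elements of degree `n`, projection to `Λ^n N` followed by inclusion is the identity. Together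
with `rTensor_projDeg_of_mem` this gives `F^{n+1} = 0` in degree `n`. -/
lemma eq_zero_of_rTensor_projDeg (n : ℕ) {x : ExteriorAlgebra ℂ N ⊗[ℂ] V}
    (hx : x ∈ Submodule.span ℂ {y | ∃ (a : Fin n → N) (v : V), y = ιMulti ℂ n a ⊗ₜ v})
    (h : LinearMap.rTensor V (projDeg N n) x = 0) : x = 0 := by
  have : LinearMap.rTensor V (⋀[ℂ]^n N).subtype (LinearMap.rTensor V (projDeg N n) x) = x := by
    clear h
    induction hx using Submodule.span_induction with
    | mem x hx =>
      obtain ⟨a, v, rfl⟩ := hx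
      rw [LinearMap.rTensor_tmul, LinearMap.rTensor_tmul,
        ← exteriorPower.ιMulti_apply_coe, projDeg_coe]
      rfl
    | zero => simp
    | add a b _ _ ha hb => rw [map_add, map_add, ha, hb]
    | smul c a _ ha => rw [map_smul, map_smul, ha]
  rw [← this, h, map_zero]

/-- A bound valid for elements of mixed degree: `Λ^p B = 0` for `p > dim B`. It starts the
descending induction in `dbar_mem_filSections`. -/
lemma range_wedgeOf_eq_bot [FiniteDimensional ℂ B] (j : B →ₗ[ℂ] N) {p : ℕ}
    (hp : Module.finrank ℂ B < p) : LinearMap.range (wedgeOf V j p) = ⊥ := by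
  have hs : Subsingleton (⋀[ℂ]^p B) := by
    rw [← Module.finrank_zero_iff (R := ℂ), exteriorPower.finrank_eq, Nat.choose_eq_zero_of_lt hp]
  rw [eq_bot_iff]
  intro x hx
  refine range_wedgeOf_le LinearMap.id _ (fun α b v => ?_) hx
  have h0 : exteriorPower.ιMulti ℂ p b = 0 := Subsingleton.elim _ _
  have h1 : ιMulti ℂ p (fun i => j (b i)) = 0 := by
    have := congrArg (fun β : ⋀[ℂ]^p B => ExteriorAlgebra.map j (β : ExteriorAlgebra ℂ B)) h0
    simpa [ExteriorAlgebra.map_apply_ιMulti, Function.comp_def] using this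
  simp [h1]

end ExteriorExtension

end Involutive

end

noncomputable section

namespace Involutive

/-! ### Smooth functions, vector fields and one-forms -/

section SmoothTools

variable {E : Type*} [NormedAddCommGroup E] [NormedSpace ℝ E]
  {M : Type*} [TopologicalSpace M] [ChartedSpace E M]

/-- The derivative of a complex-valued function at a point. -/
def realDiff (f : M → ℂ) (x : M) : TangentSpace 𝓘(ℝ, E) x →L[ℝ] ℂ :=
  mfderiv 𝓘(ℝ, E) 𝓘(ℝ, ℂ) f x

lemma cdiff_tmul (f : M → ℂ) (x : M) (z : ℂ) (v : TangentSpace 𝓘(ℝ, E) x) :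
    cdiff f x (z ⊗ₜ[ℝ] v) = z * realDiff f x v :=
  LinearMap.liftBaseChange_tmul ..

lemma cmul_contMDiff {f g : M → ℂ} (hf : ContMDiff 𝓘(ℝ, E) 𝓘(ℝ, ℂ) ∞ f)
    (hg : ContMDiff 𝓘(ℝ, E) 𝓘(ℝ, ℂ) ∞ g) :
    ContMDiff 𝓘(ℝ, E) 𝓘(ℝ, ℂ) ∞ (fun x => f x * g x) :=
  (contDiff_mul (𝕜 := ℝ) (𝔸 := ℂ)).comp_contMDiff (hf.prodMk_space hg)

lemma cdiff_congr {f g : M → ℂ} {x : M} (h : f =ᶠ[𝓝 x] g) :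
    cdiff (E := E) f x = cdiff g x := by
  refine LinearMap.ext fun X => ?_
  induction X using TensorProduct.induction_on with
  | zero => simp
  | add a b ha hb => rw [map_add, map_add, ha, hb]
  | tmul z v =>
    have : realDiff (E := E) f x = realDiff g x := h.mfderiv_eq
    rw [cdiff_tmul, cdiff_tmul, this]

lemma dual_ext {x : M} {α β : CCotangent E x}
    (h : ∀ v : TangentSpace 𝓘(ℝ, E) x, α ((1 : ℂ) ⊗ₜ[ℝ] v) = β ((1 : ℂ) ⊗ₜ[ℝ] v)) : α = β := by
  refine LinearMap.ext fun X => ?_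
  induction X using TensorProduct.induction_on with
  | zero => simp
  | add a b ha hb => rw [map_add, map_add, ha, hb]
  | tmul z v =>
    have : z ⊗ₜ[ℝ] v = z • ((1 : ℂ) ⊗ₜ[ℝ] v) := by
      rw [TensorProduct.smul_tmul', smul_eq_mul, mul_one]
    rw [this, map_smul, map_smul, h]

lemma cdiff_add {f g : M → ℂ} {x : M} (hf : MDifferentiableAt 𝓘(ℝ, E) 𝓘(ℝ, ℂ) f x)
    (hg : MDifferentiableAt 𝓘(ℝ, E) 𝓘(ℝ, ℂ) g x) :
    cdiff (E := E) (fun y => f y + g y) x = cdiff f x + cdiff g x := by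
  refine dual_ext fun v => ?_
  rw [LinearMap.add_apply, cdiff_tmul, cdiff_tmul, cdiff_tmul, one_mul, one_mul, one_mul]
  have := mfderiv_add hf hg
  exact congrArg (fun L => (L v : ℂ)) this

lemma cdiff_mul {f g : M → ℂ} {x : M} (hf : MDifferentiableAt 𝓘(ℝ, E) 𝓘(ℝ, ℂ) f x)
    (hg : MDifferentiableAt 𝓘(ℝ, E) 𝓘(ℝ, ℂ) g x) :
    cdiff (E := E) (fun y => f y * g y) x = f x • cdiff g x + g x • cdiff f x := by
  refine dual_ext fun v => ?_
  rw [LinearMap.add_apply, LinearMap.smul_apply, LinearMap.smul_apply, cdiff_tmul, cdiff_tmul,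
    cdiff_tmul, one_mul, one_mul, one_mul]
  have h := (hf.hasMFDerivAt.mul hg.hasMFDerivAt).mfderiv
  exact congrArg (fun L => (L v : ℂ)) h

lemma cdiff_const (c : ℂ) (x : M) : cdiff (E := E) (fun _ : M => c) x = 0 := by
  refine dual_ext fun v => ?_
  have : realDiff (E := E) (fun _ : M => c) x = 0 := mfderiv_const
  rw [cdiff_tmul, this]
  simp

lemma cdiff_sum {ι : Type*} (s : Finset ι) {f : ι → M → ℂ} {x : M}
    (hf : ∀ i, MDifferentiableAt 𝓘(ℝ, E) 𝓘(ℝ, ℂ) (f i) x) :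
    cdiff (E := E) (fun y => ∑ i ∈ s, f i y) x = ∑ i ∈ s, cdiff (f i) x := by
  classical
  have key : MDifferentiableAt 𝓘(ℝ, E) 𝓘(ℝ, ℂ) (fun y => ∑ i ∈ s, f i y) x ∧
      cdiff (E := E) (fun y => ∑ i ∈ s, f i y) x = ∑ i ∈ s, cdiff (f i) x := by
    induction s using Finset.induction_on with
    | empty => simpa using ⟨mdifferentiableAt_const, cdiff_const 0 x⟩
    | insert a s ha ih =>
      simp only [Finset.sum_insert ha]
      refine ⟨(hf a).add ih.1, ?_⟩
      rw [cdiff_add (hf a) ih.1, ih.2]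
  exact key.2

variable [IsManifold 𝓘(ℝ, E) ∞ M]

/-- The function is the fibre component of the tangent map of `f` composed with the section `a`. -/
lemma contMDiff_mfderiv_apply {f : M → ℂ} (hf : ContMDiff 𝓘(ℝ, E) 𝓘(ℝ, ℂ) ∞ f)
    {a : ∀ x : M, TangentSpace 𝓘(ℝ, E) x} (ha : SmoothField a) :
    ContMDiff 𝓘(ℝ, E) 𝓘(ℝ, ℂ) ∞
      (fun x => realDiff f x (a x)) := by
  have h1 : ContMDiff 𝓘(ℝ, E).tangent 𝓘(ℝ, ℂ).tangent ∞ (tangentMap 𝓘(ℝ, E) 𝓘(ℝ, ℂ) f) :=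
    hf.contMDiff_tangentMap (by simp)
  exact (contMDiff_snd_tangentBundle_modelSpace ℂ 𝓘(ℝ, ℂ)).comp (h1.comp ha)

lemma smoothForm_cdiff {f : M → ℂ} (hf : ContMDiff 𝓘(ℝ, E) 𝓘(ℝ, ℂ) ∞ f) :
    SmoothForm (fun x => cdiff (E := E) f x) := by
  intro a ha
  simpa only [cdiff_tmul, one_mul] using contMDiff_mfderiv_apply hf ha

lemma SmoothForm.add {θ η : ∀ x : M, CCotangent E x} (hθ : SmoothForm θ) (hη : SmoothForm η) :
    SmoothForm (fun x => θ x + η x) :=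
  fun a ha => (hθ a ha).add (hη a ha)

lemma SmoothForm.smul {f : M → ℂ} (hf : ContMDiff 𝓘(ℝ, E) 𝓘(ℝ, ℂ) ∞ f)
    {θ : ∀ x : M, CCotangent E x} (hθ : SmoothForm θ) : SmoothForm (fun x => f x • θ x) :=
  fun a ha => cmul_contMDiff hf (hθ a ha)

lemma smoothForm_zero : SmoothForm (fun _ : M => (0 : CCotangent E _)) :=
  fun _ _ => contMDiff_const

lemma SmoothForm.sum {ι : Type*} (s : Finset ι) {θ : ι → ∀ x : M, CCotangent E x}
    (hθ : ∀ i, SmoothForm (θ i)) : SmoothForm (fun x => ∑ i ∈ s, θ i x) := by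
  classical
  induction s using Finset.induction_on with
  | empty => simpa using smoothForm_zero
  | insert a s ha ih =>
    simp only [Finset.sum_insert ha]
    exact (hθ a).add ih

lemma SmoothForm.apply {θ : ∀ x : M, CCotangent E x} (hθ : SmoothForm θ)
    {X : ∀ x : M, CTangent E x} (hX : SmoothCField X) :
    ContMDiff 𝓘(ℝ, E) 𝓘(ℝ, ℂ) ∞ (fun x => θ x (X x)) := by
  obtain ⟨a, b, ha, hb, hab⟩ := hX
  have h : (fun x => θ x (X x)) =
      fun x => θ x ((1 : ℂ) ⊗ₜ[ℝ] a x) + Complex.I * θ x ((1 : ℂ) ⊗ₜ[ℝ] b x) := by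
    funext x
    have : Complex.I ⊗ₜ[ℝ] b x = Complex.I • ((1 : ℂ) ⊗ₜ[ℝ] b x) := by
      rw [TensorProduct.smul_tmul', smul_eq_mul, mul_one]
    rw [hab, mkC, map_add, this, map_smul, smul_eq_mul]
  rw [h]
  exact (hθ a ha).add (cmul_contMDiff contMDiff_const (hθ b hb))

lemma SmoothField.smul {f : M → ℝ} (hf : ContMDiff 𝓘(ℝ, E) 𝓘(ℝ, ℝ) ∞ f)
    {a : ∀ x : M, TangentSpace 𝓘(ℝ, E) x} (ha : SmoothField a) :
    SmoothField (fun x => f x • a x) :=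
  hf.smul_section ha

lemma two_le_infty : (2 : ℕ∞ω) ≤ ∞ :=
  show ((2 : ℕ∞) : WithTop ℕ∞) ≤ ((⊤ : ℕ∞) : WithTop ℕ∞) from WithTop.coe_le_coe.2 le_top

/-- A vector field in the chart at `x`. -/
def chartField (x : M) (a : ∀ x : M, TangentSpace 𝓘(ℝ, E) x) : E → E :=
  VectorField.mpullbackWithin 𝓘(ℝ, E) 𝓘(ℝ, E) (extChartAt 𝓘(ℝ, E) x).symm a (Set.range 𝓘(ℝ, E))

/-- By the chain rule: the field in the chart is obtained with the inverse of the derivative of the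
chart inverse, and the two cancel. -/
lemma fderiv_comp_extChartAt_symm {f : M → ℂ} (hf : ContMDiff 𝓘(ℝ, E) 𝓘(ℝ, ℂ) ∞ f) (x : M)
    {y : E} (hy : y ∈ (extChartAt 𝓘(ℝ, E) x).target) (a : ∀ x : M, TangentSpace 𝓘(ℝ, E) x) :
    fderiv ℝ (f ∘ (extChartAt 𝓘(ℝ, E) x).symm) y (chartField x a y) =
      realDiff f ((extChartAt 𝓘(ℝ, E) x).symm y) (a ((extChartAt 𝓘(ℝ, E) x).symm y)) := by
  have : IsManifold 𝓘(ℝ, E) 1 M := IsManifold.of_le (n := ∞) (by simp)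
  have hinv := isInvertible_mfderivWithin_extChartAt_symm (I := 𝓘(ℝ, E)) hy
  have hd : MDifferentiableAt 𝓘(ℝ, E) 𝓘(ℝ, E) (extChartAt 𝓘(ℝ, E) x).symm y := by
    have h := mdifferentiableWithinAt_extChartAt_symm (I := 𝓘(ℝ, E)) hy
    rwa [modelWithCornersSelf_coe, Set.range_id, mdifferentiableWithinAt_univ] at h
  have hcomp := mfderiv_comp y ((hf _).mdifferentiableAt (by simp)) hd
  rw [mfderiv_eq_fderiv] at hcomp
  rw [hcomp]
  change mfderiv 𝓘(ℝ, E) 𝓘(ℝ, ℂ) f _ (mfderiv 𝓘(ℝ, E) 𝓘(ℝ, E) (extChartAt 𝓘(ℝ, E) x).symm y _) = _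
  rw [chartField, VectorField.mpullbackWithin_apply]
  have h1 : mfderivWithin 𝓘(ℝ, E) 𝓘(ℝ, E) (extChartAt 𝓘(ℝ, E) x).symm (Set.range 𝓘(ℝ, E)) y =
      mfderiv 𝓘(ℝ, E) 𝓘(ℝ, E) (extChartAt 𝓘(ℝ, E) x).symm y := by
    rw [modelWithCornersSelf_coe, Set.range_id, mfderivWithin_univ]
  rw [h1] at hinv ⊢
  rw [hinv.self_apply_inverse]
  rfl

/-- The Lie bracket acts on functions as the commutator. -/
lemma realDiff_mlieBracket [CompleteSpace E] {f : M → ℂ} (hf : ContMDiff 𝓘(ℝ, E) 𝓘(ℝ, ℂ) ∞ f)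
    {a c : ∀ x : M, TangentSpace 𝓘(ℝ, E) x} (ha : SmoothField a) (hc : SmoothField c) (x : M) :
    realDiff f x (VectorField.mlieBracket 𝓘(ℝ, E) a c x) =
      realDiff (fun y => realDiff f y (c y)) x (a x) -
        realDiff (fun y => realDiff f y (a y)) x (c x) := by
  have : IsManifold 𝓘(ℝ, E) 1 M := IsManifold.of_le (n := ∞) (by simp)
  have : IsManifold 𝓘(ℝ, E) 2 M := IsManifold.of_le (n := ∞) two_le_infty
  set φ := extChartAt 𝓘(ℝ, E) x with hφ
  have hy₀ : φ x ∈ φ.target := mem_extChartAt_target x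
  have hdiff : ∀ b : ∀ x : M, TangentSpace 𝓘(ℝ, E) x, SmoothField b →
      DifferentiableAt ℝ (chartField x b) (φ x) := by
    intro b hb
    have h : DifferentiableWithinAt ℝ (chartField x b) (φ.symm ⁻¹' Set.univ ∩ Set.range 𝓘(ℝ, E))
        (φ x) := MDifferentiableWithinAt.differentiableWithinAt_mpullbackWithin_vectorField
      (s := Set.univ) (((hb x).mdifferentiableAt (by simp)).mdifferentiableWithinAt)
    rwa [Set.preimage_univ, Set.univ_inter, modelWithCornersSelf_coe, Set.range_id,
      differentiableWithinAt_univ] at h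
  have hfs : ContDiffAt ℝ ∞ (f ∘ φ.symm) (φ x) := by
    have h1 : ContMDiffAt 𝓘(ℝ, E) 𝓘(ℝ, E) ∞ φ.symm (φ x) := by
      have h := contMDiffWithinAt_extChartAt_symm_range (I := 𝓘(ℝ, E)) (n := ∞) x hy₀
      rwa [modelWithCornersSelf_coe, Set.range_id, contMDiffWithinAt_univ] at h
    exact ((hf _).comp (φ x) h1).contDiffAt
  -- The commutator formula in the model space, for `f` and both fields read in the chart. The
  -- remaining steps carry its two sides back to `M`.
  have key := VectorField.fderiv_apply_lieBracket (𝕜 := ℝ) hfs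
    (by simpa using two_le_infty) (hdiff c hc) (hdiff a ha)
  have hcong : ∀ b : ∀ x : M, TangentSpace 𝓘(ℝ, E) x,
      (fun y => fderiv ℝ (f ∘ φ.symm) y (chartField x b y)) =ᶠ[𝓝 (φ x)] (fun z => realDiff f z (b z)) ∘ φ.symm := by
    intro b
    filter_upwards [extChartAt_target_mem_nhds (I := 𝓘(ℝ, E)) x] with y hy
    exact fderiv_comp_extChartAt_symm hf x hy b
  rw [(hcong c).fderiv_eq, (hcong a).fderiv_eq,
    fderiv_comp_extChartAt_symm (contMDiff_mfderiv_apply hf hc) x hy₀ a,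
    fderiv_comp_extChartAt_symm (contMDiff_mfderiv_apply hf ha) x hy₀ c, ← hφ,
    extChartAt_to_inv] at key
  rw [← key]
  have hinv := isInvertible_mfderiv_extChartAt (I := 𝓘(ℝ, E)) (mem_extChartAt_source x)
  have hfx : f =ᶠ[𝓝 x] (f ∘ φ.symm) ∘ φ := by
    filter_upwards [extChartAt_source_mem_nhds (I := 𝓘(ℝ, E)) x] with z hz
    simp only [Function.comp]
    rw [φ.left_inv hz]
  obtain ⟨w, hw⟩ : ∃ w : E,
      w = VectorField.lieBracket ℝ (chartField x a) (chartField x c) (φ x) := ⟨_, rfl⟩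
  have hbr : VectorField.mlieBracket 𝓘(ℝ, E) a c x =
      (mfderiv 𝓘(ℝ, E) 𝓘(ℝ, E) φ x).inverse w := by
    have h := VectorField.mlieBracketWithin_apply (I := 𝓘(ℝ, E)) (V := a) (W := c)
      (s := Set.univ) (x₀ := x)
    rw [Set.preimage_univ, Set.univ_inter] at h
    refine h.trans ?_
    have hr : Set.range 𝓘(ℝ, E) = Set.univ := by rw [modelWithCornersSelf_coe, Set.range_id]
    have hw' : w = VectorField.lieBracketWithin ℝ (chartField x a) (chartField x c)
        (Set.range 𝓘(ℝ, E)) (φ x) := by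
      rw [hr, VectorField.lieBracketWithin_univ, hw]
    rw [hw']
    rfl
  -- `f` factors through the chart near `x`, so the derivative of the chart meets its inverse in
  -- `hbr`.
  have h2 : mfderiv 𝓘(ℝ, E) 𝓘(ℝ, ℂ) f x =
      (fderiv ℝ (f ∘ φ.symm) (φ x)).comp (mfderiv 𝓘(ℝ, E) 𝓘(ℝ, E) φ x) := by
    rw [hfx.mfderiv_eq, ← mfderiv_eq_fderiv]
    exact mfderiv_comp x (hfs.contMDiffAt.mdifferentiableAt (by simp))
      (mdifferentiableAt_extChartAt (mem_chart_source E x))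
  rw [hbr, ← hw]
  change mfderiv 𝓘(ℝ, E) 𝓘(ℝ, ℂ) f x _ = _
  rw [h2]
  exact congrArg (fderiv ℝ (f ∘ φ.symm) (φ x)) (hinv.self_apply_inverse _)

end SmoothTools

end Involutive

end

noncomputable section

namespace Involutive

/-! ### Cutoff functions, coordinates, frames -/

section LocalTools

variable {E : Type*} [NormedAddCommGroup E] [NormedSpace ℝ E]
  {M : Type*} [TopologicalSpace M] [ChartedSpace E M]

lemma ofReal_contMDiff {f : M → ℝ} (hf : ContMDiff 𝓘(ℝ, E) 𝓘(ℝ, ℝ) ∞ f) :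
    ContMDiff 𝓘(ℝ, E) 𝓘(ℝ, ℂ) ∞ (fun x => (f x : ℂ)) :=
  Complex.ofRealCLM.contMDiff.comp hf

lemma det_contMDiff {r : ℕ} {m : M → Matrix (Fin r) (Fin r) ℂ}
    (hm : ∀ i k, ContMDiff 𝓘(ℝ, E) 𝓘(ℝ, ℂ) ∞ (fun x => m x i k)) :
    ContMDiff 𝓘(ℝ, E) 𝓘(ℝ, ℂ) ∞ (fun x => (m x).det) := by
  have hprod : ∀ (s : Finset (Fin r)) (a : Fin r → Fin r),
      ContMDiff 𝓘(ℝ, E) 𝓘(ℝ, ℂ) ∞ (fun x => ∏ i ∈ s, m x (a i) i) := by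
    intro s a
    induction s using Finset.induction_on with
    | empty => simpa using contMDiff_const
    | insert i s hi ih =>
      simp only [Finset.prod_insert hi]
      exact cmul_contMDiff (hm _ _) ih
  simp only [Matrix.det_apply']
  exact contMDiff_finsetSum fun τ _ => cmul_contMDiff contMDiff_const (hprod _ _)

/-- Exchanging the two summation indices turns the sum into its negative. -/
lemma sum_ι_mul_ι_eq_zero {N : Type*} [AddCommGroup N] [Module ℂ N] {ι : Type*} [Fintype ι]
    (t : ι → N) (c : ι → ι → ℂ) (hc : ∀ a b, c a b = c b a) :
    ∑ a, ∑ b, c a b • (ExteriorAlgebra.ι ℂ (t a) * ExteriorAlgebra.ι ℂ (t b)) = 0 := by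
  have h : ∑ a, ∑ b, c a b • (ExteriorAlgebra.ι ℂ (t a) * ExteriorAlgebra.ι ℂ (t b)) =
      -∑ a, ∑ b, c a b • (ExteriorAlgebra.ι ℂ (t a) * ExteriorAlgebra.ι ℂ (t b)) := by
    conv_lhs => rw [Finset.sum_comm]
    rw [← Finset.sum_neg_distrib]
    refine Finset.sum_congr rfl fun a _ => ?_
    rw [← Finset.sum_neg_distrib]
    refine Finset.sum_congr rfl fun b _ => ?_
    rw [hc b a, eq_neg_of_add_eq_zero_left (ExteriorAlgebra.ι_add_mul_swap (t b) (t a)), smul_neg]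
  have h2 : (2 : ℂ) • ∑ a, ∑ b, c a b •
      (ExteriorAlgebra.ι ℂ (t a) * ExteriorAlgebra.ι ℂ (t b)) = 0 := by
    rw [two_smul]
    nth_rewrite 1 [h]
    exact neg_add_cancel _
  exact (smul_eq_zero.1 h2).resolve_left two_ne_zero

section

variable [IsManifold 𝓘(ℝ, E) ∞ M]

lemma SmoothCField.smul {χ : M → ℝ} (hχ : ContMDiff 𝓘(ℝ, E) 𝓘(ℝ, ℝ) ∞ χ)
    {X : ∀ x : M, CTangent E x} (hX : SmoothCField X) :
    SmoothCField (fun x => (χ x : ℂ) • X x) := by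
  obtain ⟨a, b, ha, hb, hab⟩ := hX
  refine ⟨_, _, ha.smul hχ, hb.smul hχ, fun x => ?_⟩
  change (χ x : ℂ) • X x = mkC (χ x • a x) (χ x • b x)
  rw [hab, mkC, mkC, smul_add]
  congr 1 <;> rw [TensorProduct.smul_tmul', TensorProduct.tmul_smul, TensorProduct.smul_tmul',
    smul_eq_mul, Complex.real_smul]

/-- Covectors dual to a basis of `T^{0,1}` at a point. -/
lemma InvolutiveStructure.exists_dual (S : InvolutiveStructure E M) {x : M} {r : ℕ}
    {X : Fin r → CTangent E x} (hX : LinearIndependent ℂ X) :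
    ∃ t : Fin r → CCotangent E x, (∀ i k, t i (X k) = if i = k then 1 else 0) ∧
      (Submodule.span ℂ (Set.range X) = S.T01 x →
        ∀ α : CCotangent E x, α - ∑ i, α (X i) • t i ∈ S.form10 x) := by
  obtain ⟨g, hg⟩ := LinearMap.exists_leftInverse_of_injective
    (Fintype.linearCombination ℂ X) (by
      rw [LinearMap.ker_eq_bot]; exact hX.fintypeLinearCombination_injective)
  have hgX : ∀ k, g (X k) = Pi.single k 1 := by
    intro k
    have := LinearMap.congr_fun hg (Pi.single k 1)
    simpa [Fintype.linearCombination_apply_single] using this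
  have ht : ∀ i k, (LinearMap.proj i ∘ₗ g) (X k) = if i = k then (1 : ℂ) else 0 := by
    intro i k
    rw [LinearMap.comp_apply, hgX, LinearMap.proj_apply, Pi.single_apply]
  refine ⟨fun i => LinearMap.proj i ∘ₗ g, ht, fun hT α => ?_⟩
  rw [InvolutiveStructure.form10, Submodule.mem_dualAnnihilator]
  intro w hw
  rw [← hT] at hw
  induction hw using Submodule.span_induction with
  | mem w hw =>
    obtain ⟨k, rfl⟩ := hw
    simp only [LinearMap.sub_apply, LinearMap.sum_apply, LinearMap.smul_apply, ht]
    simp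
  | zero => simp
  | add a b _ _ ha hb => rw [map_add, ha, hb, add_zero]
  | smul c a _ ha => rw [map_smul, ha, smul_zero]

variable [FiniteDimensional ℝ E]

/-- For sections `X`, `Y` of `T^{0,1}` there is, at each point, an element of `T^{0,1}` that acts on
functions as their commutator. -/
lemma InvolutiveStructure.exists_bracket (S : InvolutiveStructure E M)
    {X Y : ∀ x : M, CTangent E x} (hX : SmoothCField X) (hY : SmoothCField Y)
    (hXT : ∀ x, X x ∈ S.T01 x) (hYT : ∀ x, Y x ∈ S.T01 x) (x₀ : M) :
    ∃ Z ∈ S.T01 x₀, ∀ f : M → ℂ, ContMDiff 𝓘(ℝ, E) 𝓘(ℝ, ℂ) ∞ f →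
      cdiff f x₀ Z = cdiff (fun y => cdiff f y (Y y)) x₀ (X x₀) -
        cdiff (fun y => cdiff f y (X y)) x₀ (Y x₀) := by
  obtain ⟨a, b, ha, hb, hab⟩ := hX
  obtain ⟨c, d, hc, hd, hcd⟩ := hY
  refine ⟨_, S.involutive a b c d ha hb hc hd (fun x => hab x ▸ hXT x) (fun x => hcd x ▸ hYT x) x₀,
    fun f hf => ?_⟩
  have hmk : ∀ (f : M → ℂ) (x : M) (a b : TangentSpace 𝓘(ℝ, E) x),
      cdiff f x (mkC a b) = realDiff f x a + Complex.I * realDiff f x b := by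
    intro f x a b
    rw [mkC, map_add, cdiff_tmul, cdiff_tmul, one_mul]
  have hlin : ∀ (g h : M → ℂ), ContMDiff 𝓘(ℝ, E) 𝓘(ℝ, ℂ) ∞ g → ContMDiff 𝓘(ℝ, E) 𝓘(ℝ, ℂ) ∞ h →
      ∀ v : TangentSpace 𝓘(ℝ, E) x₀, realDiff (fun y => g y + Complex.I * h y) x₀ v =
        realDiff g x₀ v + Complex.I * realDiff h x₀ v := by
    intro g h hg hh v
    have hI : ContMDiff 𝓘(ℝ, E) 𝓘(ℝ, ℂ) ∞ (fun y => Complex.I * h y) :=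
      cmul_contMDiff contMDiff_const hh
    have e1 := cdiff_add ((hg x₀).mdifferentiableAt (by simp))
      ((hI x₀).mdifferentiableAt (by simp))
    have e2 := cdiff_mul (f := fun _ => Complex.I) (g := h) (x := x₀) mdifferentiableAt_const
      ((hh x₀).mdifferentiableAt (by simp))
    rw [cdiff_const, smul_zero, add_zero] at e2
    rw [e2] at e1
    have e3 := LinearMap.congr_fun e1 ((1 : ℂ) ⊗ₜ[ℝ] v)
    rw [LinearMap.add_apply, LinearMap.smul_apply, cdiff_tmul, cdiff_tmul, cdiff_tmul, one_mul,
      one_mul, one_mul] at e3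
    exact e3
  have hsm : ∀ a : ∀ x : M, TangentSpace 𝓘(ℝ, E) x, SmoothField a →
      ContMDiff 𝓘(ℝ, E) 𝓘(ℝ, ℂ) ∞ (fun x => realDiff f x (a x)) :=
    fun a ha => contMDiff_mfderiv_apply hf ha
  simp only [hab, hcd, hmk]
  rw [hlin _ _ (hsm c hc) (hsm d hd), hlin _ _ (hsm c hc) (hsm d hd),
    hlin _ _ (hsm a ha) (hsm b hb), hlin _ _ (hsm a ha) (hsm b hb), map_sub, map_add,
    realDiff_mlieBracket hf ha hc, realDiff_mlieBracket hf hb hd, realDiff_mlieBracket hf ha hd,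
    realDiff_mlieBracket hf hb hc]
  -- Only the terms from `[b, d]` carry `I²`; the coefficient is their commutator on `f`, with a
  -- minus sign.
  linear_combination (-(realDiff (fun y => realDiff f y (d y)) x₀ (b x₀)) +
    realDiff (fun y => realDiff f y (b y)) x₀ (d x₀)) * Complex.I_mul_I

variable [T2Space M]

lemma exists_real_cutoff (x₀ : M) {U : Set M} (hU : U ∈ 𝓝 x₀) :
    ∃ χ : M → ℝ, ContMDiff 𝓘(ℝ, E) 𝓘(ℝ, ℝ) ∞ χ ∧ (∀ᶠ x in 𝓝 x₀, χ x = 1) ∧ tsupport χ ⊆ U := by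
  obtain ⟨f, -, hf⟩ := (SmoothBumpFunction.nhds_basis_tsupport (I := 𝓘(ℝ, E)) x₀).mem_iff.1 hU
  exact ⟨f, f.contMDiff, f.eventuallyEq_one, hf⟩

variable (E) in
lemma exists_cutoff (x₀ : M) {U : Set M} (hU : U ∈ 𝓝 x₀) :
    ∃ χ : M → ℂ, ContMDiff 𝓘(ℝ, E) 𝓘(ℝ, ℂ) ∞ χ ∧ (∀ᶠ x in 𝓝 x₀, χ x = 1) ∧
      (∀ x, x ∉ U → χ x = 0) ∧ ∀ x ∈ closure Uᶜ, ∀ᶠ y in 𝓝 x, χ y = 0 := by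
  obtain ⟨χ, h1, h2, h3⟩ := exists_real_cutoff (E := E) x₀ (interior_mem_nhds.2 hU)
  have h0 : ∀ x, x ∉ interior U → ∀ᶠ y in 𝓝 x, χ y = 0 := fun x hx => by
    have := (notMem_tsupport_iff_eventuallyEq (f := χ)).1 fun h => hx (h3 h)
    exact this
  refine ⟨fun x => (χ x : ℂ), ofReal_contMDiff h1, ?_, ?_, ?_⟩
  · filter_upwards [h2] with x hx using by simp [hx]
  · intro x hx
    have := (h0 x fun h => hx (interior_subset h)).self_of_nhds
    simp [this]
  · intro x hx
    rw [closure_compl] at hx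
    filter_upwards [h0 x hx] with y hy using by simp [hy]

/-- A smooth function that is the inverse of `f` near `x₀` and vanishes off `U`. -/
lemma exists_local_inv (x₀ : M) {U : Set M} (hU : U ∈ 𝓝 x₀) {f : M → ℂ}
    (hf : ContMDiff 𝓘(ℝ, E) 𝓘(ℝ, ℂ) ∞ f) (h0 : f x₀ ≠ 0) :
    ∃ u : M → ℂ, ContMDiff 𝓘(ℝ, E) 𝓘(ℝ, ℂ) ∞ u ∧ (∀ᶠ x in 𝓝 x₀, u x * f x = 1) ∧
      ∀ x, x ∉ U → u x = 0 := by
  have hne : ∀ᶠ x in 𝓝 x₀, f x ≠ 0 := hf.continuous.continuousAt.eventually_ne h0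
  obtain ⟨χ, h1, h2, h3⟩ := exists_real_cutoff (E := E) x₀ (Filter.inter_mem hU hne)
  refine ⟨fun x => χ x • (f x)⁻¹, ?_, ?_, ?_⟩
  · refine contMDiff_of_tsupport fun x hx => ?_
    have hx' : x ∈ tsupport χ := tsupport_smul_subset_left _ _ hx
    refine (h1 x).smul ?_
    have hi : ContDiffAt ℝ ∞ (fun z : ℂ => z⁻¹) (f x) :=
      contDiffAt_inv (𝕜 := ℝ) (h3 hx').2
    exact hi.contMDiffAt.comp x (hf x)
  · filter_upwards [h2, hne] with x hx hx'
    rw [hx, one_smul, inv_mul_cancel₀ hx']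
  · intro x hx
    have : χ x = 0 := image_eq_zero_of_notMem_tsupport fun h => hx (h3 h).1
    simp [this]

/-- Near every point there are coordinates `f_j` and the dual frame of vector fields, extended to
the whole manifold. -/
lemma exists_coordinates (x₀ : M) :
    ∃ (n : ℕ) (f : Fin n → M → ℂ) (e : Fin n → ∀ x : M, TangentSpace 𝓘(ℝ, E) x),
      (∀ j, ContMDiff 𝓘(ℝ, E) 𝓘(ℝ, ℂ) ∞ (f j)) ∧ (∀ j, SmoothField (e j)) ∧
      ∀ᶠ x in 𝓝 x₀, ∀ α : CCotangent E x,
        α = ∑ j, α ((1 : ℂ) ⊗ₜ[ℝ] e j x) • cdiff (f j) x := by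
  have : IsManifold 𝓘(ℝ, E) 1 M := IsManifold.of_le (n := ∞) (by simp)
  obtain ⟨g⟩ : Nonempty (SmoothBumpFunction 𝓘(ℝ, E) x₀) := inferInstance
  let b := Module.finBasis ℝ E
  -- The bump function extends the chart, and below the coordinate frame, smoothly to all of `M`
  -- without changing them near `x₀`.
  let φ : M → E := fun x => g x • extChartAt 𝓘(ℝ, E) x₀ x
  have hφ : ContMDiff 𝓘(ℝ, E) 𝓘(ℝ, E) ∞ φ := g.contMDiff_smul contMDiffOn_extChartAt
  let t := trivializationAt E (TangentSpace 𝓘(ℝ, E)) x₀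
  have hbase : t.baseSet = (chartAt E x₀).source := TangentBundle.trivializationAt_baseSet x₀
  let c : Fin (Module.finrank ℝ E) → E →L[ℝ] ℂ := fun j =>
    Complex.ofRealCLM ∘L LinearMap.toContinuousLinearMap (b.coord j)
  refine ⟨_, fun j x => c j (φ x), fun j x => g x • t.localFrame b j x, ?_, ?_, ?_⟩
  · intro j
    exact (c j).contMDiff.comp hφ
  · intro j
    refine ContMDiffOn.smul_section_of_tsupport (u := (chartAt E x₀).source)
      g.contMDiff.contMDiffOn (chartAt E x₀).open_source g.tsupport_subset_chartAt_source ?_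
    rw [← hbase]
    exact t.contMDiffOn_localFrame_baseSet _ b j
  -- The bump function has to be one on a neighbourhood of `x`, not only at `x`, since `φ` is
  -- differentiated there.
  · filter_upwards [g.eventuallyEq_one.eventuallyEq_nhds,
      (chartAt E x₀).open_source.mem_nhds (mem_chart_source E x₀)] with x hx hxs α
    have hxb : x ∈ t.baseSet := by rw [hbase]; exact hxs
    refine dual_ext fun v => ?_
    have hd : ∀ j, realDiff (fun x => c j (φ x)) x v =
        ((t.basisAt b hxb).repr v j : ℝ) := by
      intro j
      have hev : φ =ᶠ[𝓝 x] extChartAt 𝓘(ℝ, E) x₀ := by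
        filter_upwards [hx] with y hy
        simp only [φ, hy, Pi.one_apply, one_smul]
      have h1 : mfderiv 𝓘(ℝ, E) 𝓘(ℝ, ℂ) (fun x => c j (φ x)) x =
          (c j).comp (mfderiv 𝓘(ℝ, E) 𝓘(ℝ, E) φ x) := by
        have := mfderiv_comp x ((c j).mdifferentiableAt) ((hφ x).mdifferentiableAt (by simp))
        rw [ContinuousLinearMap.mfderiv_eq] at this
        exact this
      have h2 : mfderiv 𝓘(ℝ, E) 𝓘(ℝ, E) φ x = t.continuousLinearMapAt ℝ x := by
        rw [hev.mfderiv_eq]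
        exact (TangentBundle.continuousLinearMapAt_trivializationAt hxs).symm
      change mfderiv 𝓘(ℝ, E) 𝓘(ℝ, ℂ) (fun x => c j (φ x)) x v = _
      rw [h1, h2]
      change ((b.repr (t.continuousLinearMapAt ℝ x v) j : ℝ) : ℂ) = _
      rw [show t.continuousLinearMapAt ℝ x v = (t ⟨x, v⟩).2 from
        congrFun (t.coe_linearMapAt_of_mem (R := ℝ) hxb) v]
      rfl
    have hv : v = ∑ j, (t.basisAt b hxb).repr v j • (g x • t.localFrame b j x) := by
      have hg : g x = 1 := hx.self_of_nhds
      conv_lhs => rw [← (t.basisAt b hxb).sum_repr v]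
      refine Finset.sum_congr rfl fun j _ => ?_
      rw [hg, one_smul, t.localFrame_apply_of_mem_baseSet b hxb]
    have htm : ∀ (r : ℝ) (w : TangentSpace 𝓘(ℝ, E) x), (1 : ℂ) ⊗ₜ[ℝ] (r • w) =
        (r : ℂ) • ((1 : ℂ) ⊗ₜ[ℝ] w) := by
      intro r w
      rw [TensorProduct.tmul_smul, TensorProduct.smul_tmul', TensorProduct.smul_tmul',
        Complex.real_smul, smul_eq_mul]
    conv_lhs => rw [hv, TensorProduct.tmul_sum, map_sum]
    rw [LinearMap.sum_apply]
    refine Finset.sum_congr rfl fun j _ => ?_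
    rw [LinearMap.smul_apply, cdiff_tmul, hd, htm, map_smul, smul_eq_mul, smul_eq_mul, one_mul,
      mul_comm]

/-- A smooth one-form is locally a combination of differentials. -/
lemma SmoothForm.exists_eq_sum {θ : ∀ x : M, CCotangent E x} (hθ : SmoothForm θ) (x₀ : M) :
    ∃ (n : ℕ) (g f : Fin n → M → ℂ), (∀ j, ContMDiff 𝓘(ℝ, E) 𝓘(ℝ, ℂ) ∞ (g j)) ∧
      (∀ j, ContMDiff 𝓘(ℝ, E) 𝓘(ℝ, ℂ) ∞ (f j)) ∧
      ∀ᶠ x in 𝓝 x₀, θ x = ∑ j, g j x • cdiff (f j) x := by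
  obtain ⟨n, f, e, hf, he, h⟩ := exists_coordinates (E := E) x₀
  refine ⟨n, fun j x => θ x ((1 : ℂ) ⊗ₜ[ℝ] e j x), f, fun j => hθ _ (he j), hf, ?_⟩
  filter_upwards [h] with x hx using hx (θ x)

/-- Every covector is the value of a smooth one-form. -/
lemma exists_smoothForm_apply_eq (x₀ : M) (α : CCotangent E x₀) :
    ∃ θ : ∀ x : M, CCotangent E x, SmoothForm θ ∧ θ x₀ = α := by
  obtain ⟨n, f, e, hf, -, h⟩ := exists_coordinates (E := E) x₀
  refine ⟨fun x => ∑ j, α ((1 : ℂ) ⊗ₜ[ℝ] e j x₀) • cdiff (f j) x, ?_, (h.self_of_nhds α).symm⟩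
  exact SmoothForm.sum _ fun j => SmoothForm.smul contMDiff_const (smoothForm_cdiff (hf j))

/-- For a smooth section `∑ g_j df_j` of `E^{1,0}`, the element `∑ dg_j ∧ df_j` restricts to zero
on `T^{0,1}`. -/
lemma InvolutiveStructure.sum_wedge_eq_zero (S : InvolutiveStructure E M)
    {θ : ∀ x : M, CCotangent E x} (hθS : ∀ x, θ x ∈ S.form10 x) {n : ℕ}
    {g f : Fin n → M → ℂ} (hg : ∀ j, ContMDiff 𝓘(ℝ, E) 𝓘(ℝ, ℂ) ∞ (g j))
    (hf : ∀ j, ContMDiff 𝓘(ℝ, E) 𝓘(ℝ, ℂ) ∞ (f j)) {x₀ : M}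
    (h : ∀ᶠ x in 𝓝 x₀, θ x = ∑ j, g j x • cdiff (f j) x) :
    ∑ j, ExteriorAlgebra.ι ℂ ((S.form10 x₀).mkQ (cdiff (g j) x₀)) *
      ExteriorAlgebra.ι ℂ ((S.form10 x₀).mkQ (cdiff (f j) x₀)) = 0 := by
  obtain ⟨r, X₀, hX₀, hev⟩ := S.subbundle x₀
  obtain ⟨χ, hχ, hχ1, hχs⟩ := exists_real_cutoff (E := E) x₀ hev
  obtain ⟨hli, hspan⟩ := hev.self_of_nhds
  -- The closure condition under brackets concerns global sections of `T^{0,1}`, so the local frame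
  -- is cut off; at `x₀` it is unchanged.
  let X : Fin r → ∀ x : M, CTangent E x := fun i x => (χ x : ℂ) • X₀ i x
  have hX : ∀ i, SmoothCField (X i) := fun i => (hX₀ i).smul hχ
  have hXT : ∀ i x, X i x ∈ S.T01 x := by
    intro i x
    by_cases hx : x ∈ tsupport χ
    · refine Submodule.smul_mem _ _ ?_
      rw [← (hχs hx).2]
      exact Submodule.subset_span ⟨i, rfl⟩
    · have : χ x = 0 := image_eq_zero_of_notMem_tsupport hx
      change (χ x : ℂ) • X₀ i x ∈ _
      rw [this, Complex.ofReal_zero, zero_smul]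
      exact Submodule.zero_mem _
  have hX0 : ∀ i, X i x₀ = X₀ i x₀ := fun i => by
    change (χ x₀ : ℂ) • X₀ i x₀ = _
    rw [hχ1.self_of_nhds, Complex.ofReal_one, one_smul]
  clear_value X
  have hzero : ∀ i, (fun y => ∑ j, g j y * cdiff (f j) y (X i y)) =ᶠ[𝓝 x₀] fun _ => 0 := by
    intro i
    filter_upwards [h] with y hy
    have h1 : θ y (X i y) = 0 :=
      (Submodule.mem_dualAnnihilator _).1 (hθS y) _ (hXT i y)
    rw [hy] at h1
    simpa [LinearMap.sum_apply] using h1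
  -- The identity `θ(X_i) = 0` near `x₀`, differentiated along `X_k`.
  have hdz : ∀ i k, ∑ j, (g j x₀ * cdiff (fun y => cdiff (f j) y (X i y)) x₀ (X k x₀) +
      cdiff (f j) x₀ (X i x₀) * cdiff (g j) x₀ (X k x₀)) = 0 := by
    intro i k
    have hsm : ∀ j, ContMDiff 𝓘(ℝ, E) 𝓘(ℝ, ℂ) ∞ (fun y => cdiff (f j) y (X i y)) :=
      fun j => (smoothForm_cdiff (hf j)).apply (hX i)
    have e := (cdiff_congr (E := E) (hzero i)).symm
    rw [cdiff_const, cdiff_sum _ fun j =>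
      ((cmul_contMDiff (hg j) (hsm j)) x₀).mdifferentiableAt (by simp)] at e
    have e' := LinearMap.congr_fun e (X k x₀)
    rw [LinearMap.sum_apply, LinearMap.zero_apply] at e'
    rw [e']
    refine Finset.sum_congr rfl fun j _ => ?_
    rw [cdiff_mul ((hg j x₀).mdifferentiableAt (by simp)) ((hsm j x₀).mdifferentiableAt (by simp))]
    rfl
  -- Cartan's formula for `dθ(X_a, X_b)`: besides the derivatives of `θ(X_a)` and `θ(X_b)`, also
  -- `θ([X_a, X_b])` vanishes, by involutivity.
  have hsymm : ∀ a b, ∑ j, cdiff (g j) x₀ (X a x₀) * cdiff (f j) x₀ (X b x₀) =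
      ∑ j, cdiff (g j) x₀ (X b x₀) * cdiff (f j) x₀ (X a x₀) := by
    intro a b
    obtain ⟨Z, hZ, hbr⟩ := S.exists_bracket (hX a) (hX b) (hXT a) (hXT b) x₀
    have hθZ : θ x₀ Z = 0 := (Submodule.mem_dualAnnihilator _).1 (hθS x₀) _ hZ
    rw [h.self_of_nhds, LinearMap.sum_apply] at hθZ
    simp only [LinearMap.smul_apply, smul_eq_mul, hbr _ (hf _), mul_sub,
      Finset.sum_sub_distrib] at hθZ
    have h1 := hdz b a
    have h2 := hdz a b
    rw [Finset.sum_add_distrib] at h1 h2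
    simp only [mul_comm (cdiff (g _) x₀ _)]
    linear_combination h1 - h2 - hθZ
  obtain ⟨t, -, ht⟩ := S.exists_dual hli
  have hmk : ∀ α : CCotangent E x₀, (S.form10 x₀).mkQ α =
      ∑ i, α (X i x₀) • (S.form10 x₀).mkQ (t i) := by
    intro α
    have := (Submodule.Quotient.mk_eq_zero _).2 (ht hspan α)
    rw [← Submodule.mkQ_apply, map_sub, sub_eq_zero, map_sum] at this
    rw [this]
    exact Finset.sum_congr rfl fun i _ => by rw [map_smul, hX0]
  -- Modulo `E^{1,0}` every covector is expanded in the dual covectors `t`. The resulting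
  -- coefficients are symmetric by `hsymm`, so the sum of products vanishes.
  rw [← sum_ι_mul_ι_eq_zero (fun i => (S.form10 x₀).mkQ (t i))
    (fun a b => ∑ j, cdiff (g j) x₀ (X a x₀) * cdiff (f j) x₀ (X b x₀)) hsymm]
  have hj : ∀ j, ExteriorAlgebra.ι ℂ ((S.form10 x₀).mkQ (cdiff (g j) x₀)) *
      ExteriorAlgebra.ι ℂ ((S.form10 x₀).mkQ (cdiff (f j) x₀)) =
      ∑ a, ∑ b, (cdiff (g j) x₀ (X a x₀) * cdiff (f j) x₀ (X b x₀)) •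
        (ExteriorAlgebra.ι ℂ ((S.form10 x₀).mkQ (t a)) *
          ExteriorAlgebra.ι ℂ ((S.form10 x₀).mkQ (t b))) := by
    intro j
    rw [hmk (cdiff (g j) x₀), hmk (cdiff (f j) x₀), map_sum, map_sum, Finset.sum_mul_sum]
    refine Finset.sum_congr rfl fun a _ => Finset.sum_congr rfl fun b _ => ?_
    rw [(ExteriorAlgebra.ι ℂ).map_smul, (ExteriorAlgebra.ι ℂ).map_smul, smul_mul_smul_comm]
  simp only [hj, Finset.sum_smul]
  rw [Finset.sum_comm]
  exact Finset.sum_congr rfl fun a _ => Finset.sum_comm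

/-- Near every point there is a smooth projection of the one-forms to `E^{1,0}`; it extends to the
whole manifold if it is only required to be a multiple of the identity on `E^{1,0}` there. -/
lemma InvolutiveStructure.exists_projection (S : InvolutiveStructure E M) (x₀ : M) :
    ∃ R : ∀ x : M, CCotangent E x →ₗ[ℂ] S.form10 x,
      (∀ θ : ∀ x : M, CCotangent E x, SmoothForm θ →
        SmoothForm (fun x => (R x (θ x) : CCotangent E x))) ∧
      (∀ x, ∃ c : ℂ, ∀ u : S.form10 x, R x u = c • u) ∧
      ∀ᶠ x in 𝓝 x₀, ∀ u : S.form10 x, R x u = u := by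
  obtain ⟨r, X, hX, hev⟩ := S.subbundle x₀
  obtain ⟨t, ht, -⟩ := S.exists_dual hev.self_of_nhds.1
  choose θ hθ hθt using fun i => exists_smoothForm_apply_eq (E := E) x₀ (t i)
  let m : M → Matrix (Fin r) (Fin r) ℂ := fun x => Matrix.of fun i k => θ i x (X k x)
  have hm : ∀ i k, ContMDiff 𝓘(ℝ, E) 𝓘(ℝ, ℂ) ∞ (fun x => m x i k) :=
    fun i k => (hθ i).apply (hX k)
  have hm0 : m x₀ = 1 := by
    ext i k
    rw [Matrix.one_apply, ← ht i k, ← hθt i]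
    rfl
  have hadj : ∀ i k, ContMDiff 𝓘(ℝ, E) 𝓘(ℝ, ℂ) ∞ (fun x => (m x).adjugate i k) := by
    intro i k
    simp only [Matrix.adjugate_apply]
    refine det_contMDiff fun a b => ?_
    by_cases h : a = k
    · subst h
      simpa using contMDiff_const
    · simpa [Matrix.updateRow_ne h] using hm a b
  obtain ⟨u, hu, hu1, hu0⟩ := exists_local_inv (E := E) x₀ hev (det_contMDiff hm)
    (by rw [hm0, Matrix.det_one]; exact one_ne_zero)
  -- The projection `α ↦ α - ∑ (m⁻¹)_{ji} α(X_j) θ_i` along the `θ_i`, with `m⁻¹` replaced by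
  -- adjugate and determinant so that it is smooth where `m` degenerates. The factor `u` is the
  -- inverse of `det m` near `x₀` and vanishes wherever `X` is not a frame of `T^{0,1}`; hence the
  -- values lie in `E^{1,0}` at every point.
  let R₀ : ∀ x : M, CCotangent E x →ₗ[ℂ] CCotangent E x := fun x =>
    u x • ((m x).det • LinearMap.id - ∑ i, ∑ j, (m x).adjugate j i •
      (Module.Dual.eval ℂ (CTangent E x) (X j x)).smulRight (θ i x))
  have hR₀ : ∀ x α, R₀ x α = u x • ((m x).det • α - ∑ i, ∑ j, ((m x).adjugate j i *
      α (X j x)) • θ i x) := by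
    intro x α
    simp [R₀, LinearMap.sum_apply, smul_smul]
  have hmem : ∀ x α, R₀ x α ∈ S.form10 x := by
    intro x α
    rw [hR₀]
    by_cases hx : LinearIndependent ℂ (fun i => X i x) ∧
      Submodule.span ℂ (Set.range fun i => X i x) = S.T01 x
    · refine Submodule.smul_mem _ _ ?_
      rw [InvolutiveStructure.form10, Submodule.mem_dualAnnihilator]
      intro w hw
      rw [← hx.2] at hw
      induction hw using Submodule.span_induction with
      | mem w hw =>
        obtain ⟨k, rfl⟩ := hw
        simp only [LinearMap.sub_apply, LinearMap.sum_apply, LinearMap.smul_apply, smul_eq_mul]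
        rw [Finset.sum_comm]
        have hk : ∀ j, ∑ i, (m x).adjugate j i * α (X j x) * θ i x (X k x) =
            α (X j x) * ((m x).det * (1 : Matrix (Fin r) (Fin r) ℂ) j k) := by
          intro j
          have := congrFun (congrFun (Matrix.adjugate_mul (m x)) j) k
          rw [Matrix.mul_apply, Matrix.smul_apply, smul_eq_mul] at this
          rw [← this, Finset.mul_sum]
          refine Finset.sum_congr rfl fun i _ => ?_
          change _ = α (X j x) * ((m x).adjugate j i * θ i x (X k x))
          ring
        simp only [hk, Matrix.one_apply]
        simp [mul_comm]
      | zero => simp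
      | add a b _ _ ha hb => rw [map_add, ha, hb, add_zero]
      | smul c a _ ha => rw [map_smul, ha, smul_zero]
    · rw [hu0 x hx, zero_smul]
      exact Submodule.zero_mem _
  have hc : ∀ x, ∀ v : S.form10 x, (LinearMap.codRestrict (S.form10 x) (R₀ x) (hmem x)) v =
      (u x * (m x).det) • v := by
    intro x v
    refine Subtype.ext ?_
    rw [LinearMap.codRestrict_apply, hR₀, Submodule.coe_smul, mul_smul]
    by_cases hx : LinearIndependent ℂ (fun i => X i x) ∧
      Submodule.span ℂ (Set.range fun i => X i x) = S.T01 x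
    · have : ∀ j, (v : CCotangent E x) (X j x) = 0 := fun j =>
        (Submodule.mem_dualAnnihilator _).1 v.2 _ (hx.2 ▸ Submodule.subset_span ⟨j, rfl⟩)
      simp [this]
    · rw [hu0 x hx, zero_smul, zero_smul]
  refine ⟨fun x => LinearMap.codRestrict (S.form10 x) (R₀ x) (hmem x), fun η hη => ?_,
    fun x => ⟨_, hc x⟩, ?_⟩
  · simp only [LinearMap.codRestrict_apply, hR₀, sub_eq_add_neg]
    refine SmoothForm.smul hu (SmoothForm.add (SmoothForm.smul (det_contMDiff hm) hη) ?_)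
    simp only [← neg_one_smul ℂ (∑ i, _)]
    exact SmoothForm.smul contMDiff_const (SmoothForm.sum _ fun i => SmoothForm.sum _ fun j =>
      SmoothForm.smul (cmul_contMDiff (hadj _ _) (hη.apply (hX j))) (hθ i))
  · filter_upwards [hu1] with x hx v
    rw [hc, hx, one_smul]

end

end LocalTools

end Involutive

end

noncomputable section

namespace Involutive

/-! ### Local spans of sections -/

section LocSpan

lemma map_mem_of_mem_span {M : Type*} {W W' : M → Type*} [∀ x, AddCommGroup (W x)]
    [∀ x, Module ℂ (W x)] [∀ x, AddCommGroup (W' x)] [∀ x, Module ℂ (W' x)]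
    (L : ∀ x, W x →ₗ[ℂ] W' x) {G : Set (∀ x, W x)} {P : Submodule ℂ (∀ x, W' x)}
    (h : ∀ g ∈ G, (fun x => L x (g x)) ∈ P) {s : ∀ x, W x} (hs : s ∈ Submodule.span ℂ G) :
    (fun x => L x (s x)) ∈ P :=
  (Submodule.span_le (p := P.comap (LinearMap.pi fun x => L x ∘ₗ LinearMap.proj x))).2 h hs

variable {M : Type*} [TopologicalSpace M] {W : M → Type*} [∀ x, AddCommGroup (W x)]
  [∀ x, Module ℂ (W x)] {W' : M → Type*} [∀ x, AddCommGroup (W' x)] [∀ x, Module ℂ (W' x)]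

lemma span_le_locSpan (G : Set (∀ x, W x)) : Submodule.span ℂ G ≤ locSpan G :=
  fun s hs _ => ⟨s, hs, Filter.Eventually.of_forall fun _ => rfl⟩

lemma mem_locSpan_of_mem {G : Set (∀ x, W x)} {s : ∀ x, W x} (hs : s ∈ G) : s ∈ locSpan G :=
  span_le_locSpan G (Submodule.subset_span hs)

lemma mem_locSpan_of_eventuallyEq {G : Set (∀ x, W x)} {s : ∀ x, W x}
    (h : ∀ x₀, ∃ t ∈ locSpan G, ∀ᶠ x in 𝓝 x₀, s x = t x) : s ∈ locSpan G := by
  intro x₀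
  obtain ⟨t, ht, hst⟩ := h x₀
  obtain ⟨u, hu, htu⟩ := ht x₀
  exact ⟨u, hu, by filter_upwards [hst, htu] with x h1 h2 using h1.trans h2⟩

lemma locSpan_le {G G' : Set (∀ x, W x)} (h : G ⊆ locSpan G') : locSpan G ≤ locSpan G' := by
  intro s hs
  refine mem_locSpan_of_eventuallyEq fun x₀ => ?_
  obtain ⟨t, ht, hst⟩ := hs x₀
  exact ⟨t, Submodule.span_le.2 h ht, hst⟩

lemma locSpan_mono {G G' : Set (∀ x, W x)} (h : G ⊆ G') : locSpan G ≤ locSpan G' :=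
  locSpan_le fun _ hs => mem_locSpan_of_mem (h hs)

/-- The map on sections given by linear maps of the fibres. -/
def fibrewise (L : ∀ x, W x →ₗ[ℂ] W' x) : (∀ x, W x) →ₗ[ℂ] (∀ x, W' x) :=
  LinearMap.pi fun x => L x ∘ₗ LinearMap.proj x

lemma map_mem_locSpan (L : ∀ x, W x →ₗ[ℂ] W' x) {G : Set (∀ x, W x)} {G' : Set (∀ x, W' x)}
    (h : ∀ g ∈ G, (fun x => L x (g x)) ∈ locSpan G') {s : ∀ x, W x} (hs : s ∈ locSpan G) :
    (fun x => L x (s x)) ∈ locSpan G' := by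
  have hspan : Submodule.span ℂ G ≤ (locSpan G').comap (fibrewise L) := Submodule.span_le.2 h
  refine mem_locSpan_of_eventuallyEq fun x₀ => ?_
  obtain ⟨t, ht, hst⟩ := hs x₀
  exact ⟨_, hspan ht, by filter_upwards [hst] with x hx using by rw [hx]; rfl⟩

end LocSpan

/-! ### Smooth multiples and patching -/

section Patching

variable {E : Type*} [NormedAddCommGroup E] [NormedSpace ℝ E]
  {M : Type*} [TopologicalSpace M] [ChartedSpace E M]
  {W : M → Type*} [∀ x, AddCommGroup (W x)] [∀ x, Module ℂ (W x)]
  {W' : M → Type*} [∀ x, AddCommGroup (W' x)] [∀ x, Module ℂ (W' x)]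

variable (E) in
/-- A space of sections is closed under multiplication by smooth functions. -/
def SmoothClosed (Γ : Submodule ℂ (∀ x, W x)) : Prop :=
  ∀ f : M → ℂ, ContMDiff 𝓘(ℝ, E) 𝓘(ℝ, ℂ) ∞ f → ∀ w ∈ Γ, (fun x => f x • w x) ∈ Γ

lemma smoothClosed_locSpan {G : Set (∀ x, W x)}
    (h : ∀ f : M → ℂ, ContMDiff 𝓘(ℝ, E) 𝓘(ℝ, ℂ) ∞ f → ∀ w ∈ G, (fun x => f x • w x) ∈ G) :
    SmoothClosed E (locSpan G) := fun f hf _ hw =>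
  map_mem_locSpan (fun x => f x • LinearMap.id) (fun g hg => mem_locSpan_of_mem (h f hf g hg)) hw

/-- Local solutions of a linear equation can be glued by a partition of unity. -/
lemma exists_locSpan_of_local [FiniteDimensional ℝ E] [IsManifold 𝓘(ℝ, E) ∞ M] [T2Space M]
    [SigmaCompactSpace M] (L : ∀ x, W x →ₗ[ℂ] W' x) {G : Set (∀ x, W x)}
    (hG : SmoothClosed E (locSpan G)) {σ : ∀ x, W' x}
    (h : ∀ x₀, ∃ t ∈ locSpan G, ∀ᶠ x in 𝓝 x₀, L x (t x) = σ x) :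
    ∃ t ∈ locSpan G, ∀ x, L x (t x) = σ x := by
  choose t ht hev using h
  choose U hU hUo hmem using fun x₀ => eventually_nhds_iff.1 (hev x₀)
  obtain ⟨ρ, hρ⟩ := SmoothPartitionOfUnity.exists_isSubordinate 𝓘(ℝ, E) isClosed_univ U hUo
    fun x _ => Set.mem_iUnion.2 ⟨x, hmem x⟩
  -- Local finiteness in the form used twice: near each point the infinite sum is a sum over one
  -- fixed finite set, so it stays in the local span.
  have hfin : ∀ x₀, ∃ I : Finset M, ∀ᶠ x in 𝓝 x₀, ∀ i, ρ i x ≠ 0 → i ∈ I := by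
    intro x₀
    obtain ⟨T, hT, hTf⟩ := ρ.locallyFinite x₀
    refine ⟨hTf.toFinset, ?_⟩
    filter_upwards [hT] with x hx i hi
    exact hTf.mem_toFinset.2 ⟨x, hi, hx⟩
  let s : ∀ x, W x := fun x => ∑ᶠ i, (ρ i x : ℂ) • t i x
  have hs : ∀ (I : Finset M) x, (∀ i, ρ i x ≠ 0 → i ∈ I) →
      s x = ∑ i ∈ I, (ρ i x : ℂ) • t i x := by
    intro I x hI
    refine finsum_eq_sum_of_support_subset _ fun i hi => hI i fun h0 => hi ?_
    simp [h0]
  refine ⟨s, mem_locSpan_of_eventuallyEq fun x₀ => ?_, fun x => ?_⟩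
  · obtain ⟨I, hI⟩ := hfin x₀
    refine ⟨∑ i ∈ I, fun x => (ρ i x : ℂ) • t i x, Submodule.sum_mem _ fun i _ =>
      hG _ (ofReal_contMDiff (ρ i).contMDiff) _ (ht i), ?_⟩
    filter_upwards [hI] with x hx
    rw [hs I x hx, Finset.sum_apply]
  · obtain ⟨I, hI⟩ := hfin x
    have hI := hI.self_of_nhds
    have h1 : ∑ i ∈ I, (ρ i x : ℂ) = 1 := by
      have := ρ.sum_eq_one (Set.mem_univ x)
      rw [finsum_eq_sum_of_support_subset _ (s := I) fun i hi => hI i hi] at this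
      exact_mod_cast this
    rw [hs I x hI, map_sum]
    have : ∀ i ∈ I, L x ((ρ i x : ℂ) • t i x) = (ρ i x : ℂ) • σ x := by
      intro i _
      rw [map_smul]
      by_cases h0 : ρ i x = 0
      · rw [h0, Complex.ofReal_zero, zero_smul, zero_smul]
      · rw [hU i x (hρ i (subset_tsupport _ h0))]
    rw [Finset.sum_congr rfl this, ← Finset.sum_smul, h1, one_smul]

variable (E) in
/-- A smooth function with compact support that is one on a given compact set. -/
lemma exists_compact_cutoff [FiniteDimensional ℝ E] [IsManifold 𝓘(ℝ, E) ∞ M] [T2Space M]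
    [SigmaCompactSpace M] {K : Set M} (hK : IsCompact K) :
    ∃ (χ : M → ℂ) (K' : Set M), ContMDiff 𝓘(ℝ, E) 𝓘(ℝ, ℂ) ∞ χ ∧ IsCompact K' ∧
      (∀ x ∈ K, χ x = 1) ∧ ∀ x ∉ K', χ x = 0 := by
  have : LocallyCompactSpace M := ChartedSpace.locallyCompactSpace E M
  obtain ⟨K', hK', hsub⟩ := exists_compact_superset hK
  obtain ⟨f, h1, h0, -⟩ := exists_contMDiffMap_one_nhds_of_subset_interior (n := ⊤) 𝓘(ℝ, E)
    hK.isClosed hsub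
  refine ⟨fun x => (f x : ℂ), K', ofReal_contMDiff f.contMDiff, hK', fun x hx => ?_,
    fun x hx => ?_⟩
  · simp only [h1.self_of_nhdsSet x hx, Complex.ofReal_one]
  · simp only [h0 x hx, Complex.ofReal_zero]

end Patching

/-! ### Forms with values in a bundle, and compatible structures -/

namespace InvolutiveStructure

variable {E : Type*} [NormedAddCommGroup E] [NormedSpace ℝ E]
  {M : Type*} [TopologicalSpace M] [ChartedSpace E M] [IsManifold 𝓘(ℝ, E) ∞ M]
  {S : InvolutiveStructure E M}
  {W : M → Type*} [∀ x, AddCommGroup (W x)] [∀ x, Module ℂ (W x)]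
  {Γ : Submodule ℂ (∀ x, W x)}

lemma smoothClosed_locSpan_decomposable (hΓ : SmoothClosed E Γ) (q : ℕ) :
    SmoothClosed E (locSpan (S.decomposable Γ q)) := by
  refine smoothClosed_locSpan ?_
  rintro f hf - ⟨θ, w, hθ, hw, rfl⟩
  refine ⟨θ, _, hθ, hΓ f hf w hw, ?_⟩
  funext x
  exact (TensorProduct.tmul_smul (f x) _ (w x)).symm

lemma smoothClosed_forms (hΓ : SmoothClosed E Γ) : SmoothClosed E (S.forms Γ) := by
  refine smoothClosed_locSpan ?_
  intro f hf s hs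
  obtain ⟨q, θ, w, hθ, hw, rfl⟩ := Set.mem_iUnion.1 hs
  refine Set.mem_iUnion.2 ⟨q, θ, _, hθ, hΓ f hf w hw, ?_⟩
  funext x
  exact (TensorProduct.tmul_smul (f x) _ (w x)).symm

lemma locSpan_decomposable_le_forms (q : ℕ) : locSpan (S.decomposable Γ q) ≤ S.forms Γ :=
  locSpan_mono (Set.subset_iUnion _ q)

lemma wedge_mem_decomposable {θ : ∀ x : M, CCotangent E x} (hθ : SmoothForm θ) {q : ℕ}
    {s : ∀ x, S.FormFibre W x} (hs : s ∈ S.decomposable Γ q) :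
    (fun x => wedge01 W x ((S.form10 x).mkQ (θ x)) (s x)) ∈ S.decomposable Γ (q + 1) := by
  obtain ⟨η, w, hη, hw, rfl⟩ := hs
  refine ⟨Fin.cons θ η, w, fun i => ?_, hw, ?_⟩
  · refine Fin.cases ?_ (fun i => ?_) i
    · exact hθ
    · exact hη i
  · funext x
    rw [ExteriorAlgebra.ιMulti_succ_apply]
    rfl

lemma wedge_mem_locSpan {θ : ∀ x : M, CCotangent E x} (hθ : SmoothForm θ) {q : ℕ}
    {s : ∀ x, S.FormFibre W x} (hs : s ∈ locSpan (S.decomposable Γ q)) :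
    (fun x => wedge01 W x ((S.form10 x).mkQ (θ x)) (s x)) ∈ locSpan (S.decomposable Γ (q + 1)) :=
  map_mem_locSpan (fun x => wedge01 W x ((S.form10 x).mkQ (θ x)))
    (fun _ hg => mem_locSpan_of_mem (wedge_mem_decomposable hθ hg)) hs

lemma wedge_mem_forms {θ : ∀ x : M, CCotangent E x} (hθ : SmoothForm θ)
    {s : ∀ x, S.FormFibre W x} (hs : s ∈ S.forms Γ) :
    (fun x => wedge01 W x ((S.form10 x).mkQ (θ x)) (s x)) ∈ S.forms Γ := by
  refine map_mem_locSpan (fun x => wedge01 W x ((S.form10 x).mkQ (θ x))) (fun g hg => ?_) hs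
  obtain ⟨q, hq⟩ := Set.mem_iUnion.1 hg
  exact mem_locSpan_of_mem (Set.mem_iUnion.2 ⟨q + 1, wedge_mem_decomposable hθ hq⟩)

lemma tmul_one_mem_decomposable {w : ∀ x, W x} (hw : w ∈ Γ) :
    (fun x => FormFibre.tmul (S := S) 1 (w x)) ∈ S.decomposable Γ 0 := by
  refine ⟨fun i => i.elim0, w, fun i => i.elim0, hw, ?_⟩
  funext x
  rw [ExteriorAlgebra.ιMulti_zero_apply]

lemma tmul_one_mem_forms {w : ∀ x, W x} (hw : w ∈ Γ) :
    (fun x => FormFibre.tmul (S := S) 1 (w x)) ∈ S.forms Γ :=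
  locSpan_decomposable_le_forms 0 (mem_locSpan_of_mem (tmul_one_mem_decomposable hw))

/-- To prove something for all `[θ₁] ∧ ⋯ ∧ [θ_q] ⊗ w`, one may multiply with one form at a time. -/
lemma decomposable_induction {p : ℕ → (∀ x, S.FormFibre W x) → Prop}
    (h0 : ∀ w ∈ Γ, p 0 (fun x => FormFibre.tmul 1 (w x)))
    (hs : ∀ (q : ℕ) (θ : ∀ x : M, CCotangent E x) (s : ∀ x, S.FormFibre W x), SmoothForm θ →
      s ∈ S.decomposable Γ q → p q s →
        p (q + 1) (fun x => wedge01 W x ((S.form10 x).mkQ (θ x)) (s x)))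
    {q : ℕ} {s : ∀ x, S.FormFibre W x} (h : s ∈ S.decomposable Γ q) : p q s := by
  induction q generalizing s with
  | zero =>
    obtain ⟨θ, w, hθ, hw, rfl⟩ := h
    simp only [ExteriorAlgebra.ιMulti_zero_apply]
    exact h0 w hw
  | succ q ih =>
    obtain ⟨θ, w, hθ, hw, rfl⟩ := h
    have hmem : (fun x => FormFibre.tmul (ExteriorAlgebra.ιMulti ℂ q
        (fun i => (S.form10 x).mkQ (θ i.succ x))) (w x)) ∈ S.decomposable Γ q :=
      ⟨fun i => θ i.succ, w, fun i => hθ i.succ, hw, rfl⟩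
    have := hs q (θ 0) _ (hθ 0) hmem (ih hmem)
    simp only [ExteriorAlgebra.ιMulti_succ_apply]
    exact this

lemma wedge01_add (x : M) (a b : S.Form01 x) (s : S.FormFibre W x) :
    wedge01 W x (a + b) s = wedge01 W x a s + wedge01 W x b s := by
  change LinearMap.rTensor _ _ s = LinearMap.rTensor _ _ s + LinearMap.rTensor _ _ s
  have h : LinearMap.mulLeft ℂ (ExteriorAlgebra.ι ℂ (a + b)) =
      LinearMap.mulLeft ℂ (ExteriorAlgebra.ι ℂ a) + LinearMap.mulLeft ℂ (ExteriorAlgebra.ι ℂ b) :=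
    LinearMap.ext fun y => by rw [map_add]; exact add_mul _ _ y
  rw [h, LinearMap.rTensor_add]
  rfl

lemma wedge01_smul (x : M) (c : ℂ) (a : S.Form01 x) (s : S.FormFibre W x) :
    wedge01 W x (c • a) s = c • wedge01 W x a s := by
  change LinearMap.rTensor _ _ s = c • LinearMap.rTensor _ _ s
  have h : LinearMap.mulLeft ℂ (ExteriorAlgebra.ι ℂ (c • a)) =
      c • LinearMap.mulLeft ℂ (ExteriorAlgebra.ι ℂ a) :=
    LinearMap.ext fun y => by rw [map_smul]; exact smul_mul_assoc c _ y
  rw [h, LinearMap.rTensor_smul]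
  rfl

lemma wedge01_zero (x : M) (s : S.FormFibre W x) :
    wedge01 W x (0 : S.Form01 x) s = 0 := by
  have := wedge01_smul x (0 : ℂ) (0 : S.Form01 x) s
  rwa [zero_smul, zero_smul] at this

lemma wedge01_sum {ι : Type*} (I : Finset ι) (x : M) (a : ι → S.Form01 x)
    (s : S.FormFibre W x) : wedge01 W x (∑ i ∈ I, a i) s = ∑ i ∈ I, wedge01 W x (a i) s := by
  classical
  induction I using Finset.induction_on with
  | empty => rw [Finset.sum_empty, Finset.sum_empty, wedge01_zero]
  | insert i I hi ih => rw [Finset.sum_insert hi, Finset.sum_insert hi, wedge01_add, ih]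

/-! ### Locality, product rule and uniqueness for compatible structures -/

namespace CompatibleStructure

/-- Apply `∂̄² = 0` to `f s`: from `∂̄(f s) = ∂̄f ∧ s + f ∂̄s`, the second term contributes `∂̄f ∧
∂̄s`, and the first must cancel it. -/
lemma dbar_dbarFun_wedge (hΓ : SmoothClosed E Γ) (N : S.CompatibleStructure Γ) {f : M → ℂ}
    (hf : ContMDiff 𝓘(ℝ, E) 𝓘(ℝ, ℂ) ∞ f) {s u : S.forms Γ}
    (hu : ∀ x, u.1 x = wedge01 W x (S.dbarFun f x) (s.1 x)) (x : M) :
    (N.dbar u).1 x = -wedge01 W x (S.dbarFun f x) ((N.dbar s).1 x) := by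
  let t : S.forms Γ := ⟨_, smoothClosed_forms hΓ f hf _ s.2⟩
  let v : S.forms Γ := ⟨_, smoothClosed_forms hΓ f hf _ (N.dbar s).2⟩
  have ht : N.dbar t = u + v := by
    refine Subtype.ext (funext fun x => ?_)
    rw [N.leibniz f hf s t (fun _ => rfl) x, ← hu x]
    rfl
  have h0 := N.dbar_dbar t
  rw [ht, map_add] at h0
  have hx : (N.dbar u).1 x + (N.dbar v).1 x = 0 := congrFun (congrArg Subtype.val h0) x
  rw [N.leibniz f hf (N.dbar s) v (fun _ => rfl) x, N.dbar_dbar] at hx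
  have h2 : f x • (0 : S.forms Γ).1 x = 0 := smul_zero _
  rw [h2, add_zero] at hx
  exact eq_neg_of_add_eq_zero_left hx

variable [FiniteDimensional ℝ E] [T2Space M]

/-- `∂̄` is a local operator. -/
lemma dbar_eq_zero_of_eventually (N : S.CompatibleStructure Γ) {s : S.forms Γ} {x₀ : M}
    (h : ∀ᶠ x in 𝓝 x₀, s.1 x = 0) : (N.dbar s).1 x₀ = 0 := by
  obtain ⟨χ, hχ, hχ1, hχ0, -⟩ := exists_cutoff E x₀ h
  -- `χ` vanishes wherever `s` does not, so `(1 - χ) s = s`. The Leibniz rule for this product gives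
  -- zero at `x₀`, where `1 - χ` vanishes together with its differential.
  have hf : ContMDiff 𝓘(ℝ, E) 𝓘(ℝ, ℂ) ∞ (fun x => 1 - χ x) := contMDiff_const.sub hχ
  have hl := N.leibniz _ hf s s (fun x => ?_) x₀
  · rw [hl, hχ1.self_of_nhds, sub_self, zero_smul, add_zero]
    have hd : S.dbarFun (fun x => 1 - χ x) x₀ = 0 := by
      have : (fun x => 1 - χ x) =ᶠ[𝓝 x₀] fun _ => (0 : ℂ) := by
        filter_upwards [hχ1] with x hx using by rw [hx, sub_self]
      rw [dbarFun, cdiff_congr this, cdiff_const, map_zero]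
    rw [hd, wedge01_zero]
  · by_cases hx : s.1 x = 0
    · rw [hx, smul_zero]
    · rw [hχ0 x hx, sub_zero, one_smul]

lemma dbar_congr (N : S.CompatibleStructure Γ) {s t : S.forms Γ} {x₀ : M}
    (h : ∀ᶠ x in 𝓝 x₀, s.1 x = t.1 x) : (N.dbar s).1 x₀ = (N.dbar t).1 x₀ := by
  have h0 := N.dbar_eq_zero_of_eventually (s := s - t) (x₀ := x₀)
    (by filter_upwards [h] with x hx using sub_eq_zero.2 hx)
  rw [map_sub] at h0
  exact sub_eq_zero.1 h0

lemma dbar_mem_compactlySupported (N : S.CompatibleStructure Γ) {s : S.forms Γ}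
    (hs : s.1 ∈ compactlySupported) : (N.dbar s).1 ∈ compactlySupported := by
  obtain ⟨K, hK, h⟩ := hs
  refine ⟨K, hK, fun x hx => N.dbar_eq_zero_of_eventually ?_⟩
  filter_upwards [hK.isClosed.isOpen_compl.mem_nhds hx] with y hy using h y hy

/-- `∂̄([θ] ∧ s) = ∑ ∂̄g_j ∧ ∂̄f_j ∧ s - [θ] ∧ ∂̄ s` for `θ = ∑ g_j df_j`. -/
lemma dbar_wedge (hΓ : SmoothClosed E Γ) (N : S.CompatibleStructure Γ)
    {θ : ∀ x : M, CCotangent E x} {n : ℕ} {g f : Fin n → M → ℂ}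
    (hg : ∀ j, ContMDiff 𝓘(ℝ, E) 𝓘(ℝ, ℂ) ∞ (g j)) (hf : ∀ j, ContMDiff 𝓘(ℝ, E) 𝓘(ℝ, ℂ) ∞ (f j))
    {x₀ : M} (h : ∀ᶠ x in 𝓝 x₀, θ x = ∑ j, g j x • cdiff (f j) x) {s u : S.forms Γ}
    (hu : ∀ x, u.1 x = wedge01 W x ((S.form10 x).mkQ (θ x)) (s.1 x)) :
    (N.dbar u).1 x₀ = ∑ j, wedge01 W x₀ (S.dbarFun (g j) x₀)
        (wedge01 W x₀ (S.dbarFun (f j) x₀) (s.1 x₀)) -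
      wedge01 W x₀ ((S.form10 x₀).mkQ (θ x₀)) ((N.dbar s).1 x₀) := by
  have hmk : ∀ x, θ x = ∑ j, g j x • cdiff (f j) x → ∀ t : S.FormFibre W x,
      wedge01 W x ((S.form10 x).mkQ (θ x)) t =
        ∑ j, g j x • wedge01 W x (S.dbarFun (f j) x) t := by
    intro x hx t
    rw [hx, map_sum, wedge01_sum]
    exact Finset.sum_congr rfl fun j _ => by rw [map_smul, wedge01_smul]; rfl
  let a : Fin n → S.forms Γ := fun j => ⟨_, wedge_mem_forms (smoothForm_cdiff (hf j)) s.2⟩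
  let b : Fin n → S.forms Γ := fun j => ⟨_, smoothClosed_forms hΓ (g j) (hg j) _ (a j).2⟩
  have hab : ∀ᶠ x in 𝓝 x₀, u.1 x = (∑ j, b j : S.forms Γ).1 x := by
    filter_upwards [h] with x hx
    rw [hu, hmk x hx, AddSubmonoidClass.coe_finsetSum, Finset.sum_apply]
    rfl
  rw [N.dbar_congr hab, map_sum, AddSubmonoidClass.coe_finsetSum, Finset.sum_apply,
    hmk x₀ h.self_of_nhds, ← Finset.sum_sub_distrib]
  refine Finset.sum_congr rfl fun j _ => ?_
  rw [N.leibniz (g j) (hg j) (a j) (b j) (fun _ => rfl) x₀,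
    N.dbar_dbarFun_wedge hΓ (hf j) (s := s) (u := a j) (fun _ => rfl), smul_neg, sub_eq_add_neg]
  rfl

/-- A compatible structure is determined by its values on the sections of the bundle. -/
lemma ext_of_degree_zero (hΓ : SmoothClosed E Γ) {N N' : S.CompatibleStructure Γ}
    (h : ∀ (w : ∀ x, W x) (hw : w ∈ Γ),
      N.dbar ⟨_, tmul_one_mem_forms hw⟩ = N'.dbar ⟨_, tmul_one_mem_forms hw⟩) : N = N' := by
  -- Induction on the number of one-forms: `dbar_wedge` expresses `∂̄([θ] ∧ s)` through `s` and
  -- `∂̄s` alone. Linearity and locality then extend the agreement to all forms.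
  have hdec : ∀ q, ∀ s ∈ S.decomposable Γ q,
      ∃ hs : s ∈ S.forms Γ, N.dbar ⟨s, hs⟩ = N'.dbar ⟨s, hs⟩ := by
    intro q s hs
    refine decomposable_induction (p := fun _ s => ∃ hs : s ∈ S.forms Γ,
      N.dbar ⟨s, hs⟩ = N'.dbar ⟨s, hs⟩) ?_ ?_ hs
    · intro w hw
      exact ⟨_, h w hw⟩
    · rintro q θ s hθ - ⟨hs, hss⟩
      refine ⟨wedge_mem_forms hθ hs, Subtype.ext (funext fun x₀ => ?_)⟩
      obtain ⟨n, g, f, hg, hf, hgf⟩ := hθ.exists_eq_sum x₀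
      rw [N.dbar_wedge hΓ hg hf hgf (s := ⟨s, hs⟩) (fun _ => rfl),
        N'.dbar_wedge hΓ hg hf hgf (s := ⟨s, hs⟩) (fun _ => rfl), hss]
  have hspan : Submodule.span ℂ (⋃ q, S.decomposable Γ q) ≤
      (LinearMap.ker (N.dbar - N'.dbar)).map (S.forms Γ).subtype := by
    refine Submodule.span_le.2 fun s hs => ?_
    obtain ⟨q, hq⟩ := Set.mem_iUnion.1 hs
    obtain ⟨hs, he⟩ := hdec q s hq
    exact ⟨⟨s, hs⟩, LinearMap.mem_ker.2 (sub_eq_zero.2 he), rfl⟩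
  refine CompatibleStructure.ext (LinearMap.ext fun s => Subtype.ext (funext fun x₀ => ?_))
  obtain ⟨t, ht, hst⟩ := s.2 x₀
  obtain ⟨t, htk, rfl⟩ := hspan ht
  rw [N.dbar_congr (t := t) hst, N'.dbar_congr (t := t) hst]
  have : N.dbar t = N'.dbar t := sub_eq_zero.1 (LinearMap.mem_ker.1 htk)
  rw [this]

end CompatibleStructure

end InvolutiveStructure

end Involutive

end

noncomputable section

namespace Involutive

/-! ### The leading part in one fibre -/

section RelQuot

lemma mulLeft_wedgeOf {N B V : Type*} [AddCommGroup N] [Module ℂ N] [AddCommGroup B] [Module ℂ B]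
    [AddCommGroup V] [Module ℂ V] (j : B →ₗ[ℂ] N) (p : ℕ) (ζ : ExteriorAlgebra ℂ N)
    (t : ExteriorAlgebra ℂ N ⊗[ℂ] (⋀[ℂ]^p B ⊗[ℂ] V)) :
    LinearMap.rTensor V (LinearMap.mulLeft ℂ ζ) (wedgeOf V j p t) =
      wedgeOf V j p (LinearMap.rTensor _ (LinearMap.mulLeft ℂ ζ) t) := by
  induction t using TensorProduct.induction_on with
  | zero => simp
  | add y z hy hz => simp only [map_add, hy, hz]
  | tmul α w =>
    induction w using TensorProduct.induction_on with
    | zero => simp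
    | add y z hy hz => simp only [TensorProduct.tmul_add, map_add, hy, hz]
    | tmul β v =>
      rw [wedgeOf_tmul, LinearMap.rTensor_tmul, LinearMap.rTensor_tmul, wedgeOf_tmul,
        LinearMap.mulLeft_apply, LinearMap.mulLeft_apply, mul_assoc]

variable {U : Type*} [AddCommGroup U] [Module ℂ U] {P Q : Submodule ℂ U}

lemma factor_relIncl (h : P ≤ Q) (b : RelQuot P Q) : Submodule.factor h (relIncl P Q b) = 0 := by
  obtain ⟨u, rfl⟩ := Submodule.mkQ_surjective _ b
  exact (Submodule.Quotient.mk_eq_zero Q).2 u.2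

lemma relIncl_injective (P Q : Submodule ℂ U) : Function.Injective (relIncl P Q) := by
  rw [← LinearMap.ker_eq_bot, LinearMap.ker_eq_bot']
  intro b hb
  obtain ⟨u, rfl⟩ := Submodule.mkQ_surjective _ b
  exact (Submodule.Quotient.mk_eq_zero _).2 ((Submodule.Quotient.mk_eq_zero P).1 hb)

lemma ker_factor_le (h : P ≤ Q) :
    LinearMap.ker (Submodule.factor h) ≤ LinearMap.range (relIncl P Q) := by
  intro a ha
  obtain ⟨u, rfl⟩ := Submodule.mkQ_surjective _ a
  have hu : u ∈ Q := (Submodule.Quotient.mk_eq_zero Q).1 ha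
  exact ⟨(P.submoduleOf Q).mkQ ⟨u, hu⟩, rfl⟩

lemma exists_relSplit (P Q : Submodule ℂ U) :
    ∃ r : U ⧸ P →ₗ[ℂ] RelQuot P Q, ∀ b, r (relIncl P Q b) = b := by
  obtain ⟨r, hr⟩ := LinearMap.exists_leftInverse_of_injective (relIncl P Q)
    (LinearMap.ker_eq_bot.2 (relIncl_injective P Q))
  exact ⟨r, LinearMap.congr_fun hr⟩

variable (P Q) in
/-- A projection `U / P → Q / P`. -/
def relSplit : U ⧸ P →ₗ[ℂ] RelQuot P Q := (exists_relSplit P Q).choose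

lemma relSplit_relIncl (b : RelQuot P Q) : relSplit P Q (relIncl P Q b) = b :=
  (exists_relSplit P Q).choose_spec b

end RelQuot

section LeadingPart

variable {E : Type*} [NormedAddCommGroup E] [NormedSpace ℝ E]
  {M : Type*} [TopologicalSpace M] [ChartedSpace E M] [IsManifold 𝓘(ℝ, E) ∞ M]
  {A S : InvolutiveStructure E M}
  {V : M → Type*} [∀ x, AddCommGroup (V x)] [∀ x, Module ℂ (V x)]

open InvolutiveStructure

variable (A S V) in
/-- The values of the sections of the `p`-th step of the filtration. -/
def filFibre (p : ℕ) (x : M) : Submodule ℂ (A.FormFibre V x) := LinearMap.range (wedgeB A S V p x)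

variable (V) in
/-- The map `Λ A^{0,1} ⊗ V → Λ E^{0,1} ⊗ B^p ⊗ V` defined by a projection
`A^{0,1} → B^1`. -/
def partOf (p : ℕ) (x : M) (h : A.form10 x ≤ S.form10 x)
    (r : A.Form01 x →ₗ[ℂ] RelQuot (A.form10 x) (S.form10 x)) :
    A.FormFibre V x →ₗ[ℂ] S.FormFibre (BFibre A S V p) x :=
  symbolMap (V x) (Submodule.factor h) r p

variable (V) in
/-- A linear map whose restriction to the `p`-th step of the filtration maps each element to its
leading part. -/
def leadingPart (p : ℕ) (x : M) (h : A.form10 x ≤ S.form10 x) :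
    A.FormFibre V x →ₗ[ℂ] S.FormFibre (BFibre A S V p) x :=
  partOf V p x h (relSplit _ _)

variable {p : ℕ} {x : M} (h : A.form10 x ≤ S.form10 x)

lemma wedgeB_mem_filFibre (t : A.FormFibre (BFibre A S V p) x) :
    wedgeB A S V p x t ∈ filFibre A S V p x := ⟨t, rfl⟩

variable (A S V p x) in
lemma filFibre_succ_le : filFibre A S V (p + 1) x ≤ filFibre A S V p x :=
  range_wedgeOf_succ_le (V := V x) (relIncl (A.form10 x) (S.form10 x)) p

variable (A S V x) in
lemma filFibre_zero : filFibre A S V 0 x = ⊤ :=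
  range_wedgeOf_zero (V := V x) (relIncl (A.form10 x) (S.form10 x))

lemma wedge01_mem_filFibre (a : A.Form01 x) {η : A.FormFibre V x} (hη : η ∈ filFibre A S V p x) :
    wedge01 V x a η ∈ filFibre A S V p x :=
  mulLeft_mem_range_wedgeOf (V := V x) (relIncl (A.form10 x) (S.form10 x)) p _ hη

lemma wedge01_mem_filFibre_succ {u : CCotangent E x} (hu : u ∈ S.form10 x) {η : A.FormFibre V x}
    (hη : η ∈ filFibre A S V p x) :
    wedge01 V x ((A.form10 x).mkQ u) η ∈ filFibre A S V (p + 1) x :=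
  mulLeft_mem_range_wedgeOf_succ (V := V x) (relIncl (A.form10 x) (S.form10 x)) p
    (ι_mem_extIdeal (relIncl (A.form10 x) (S.form10 x))
      (((A.form10 x).submoduleOf (S.form10 x)).mkQ ⟨u, hu⟩)) hη

/-- The sum is left multiplication by `ζ = ∑ [a_j] ∧ [b_j]`. By `hab` the image of `ζ` in `Λ
E^{0,1}` is zero, so `ζ` lies in the ideal generated by `B^1`. -/
lemma sum_wedge01_mem_filFibre_succ (hle : A.form10 x ≤ S.form10 x) {ι : Type*} [Fintype ι] (a b : ι → CCotangent E x)
    (hab : ∑ j, ExteriorAlgebra.ι ℂ ((S.form10 x).mkQ (a j)) *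
      ExteriorAlgebra.ι ℂ ((S.form10 x).mkQ (b j)) = 0) {η : A.FormFibre V x}
    (hη : η ∈ filFibre A S V p x) :
    ∑ j, wedge01 V x ((A.form10 x).mkQ (a j)) (wedge01 V x ((A.form10 x).mkQ (b j)) η) ∈
      filFibre A S V (p + 1) x := by
  have hζ : ∑ j, ExteriorAlgebra.ι ℂ ((A.form10 x).mkQ (a j)) *
      ExteriorAlgebra.ι ℂ ((A.form10 x).mkQ (b j)) ∈
        extIdeal (relIncl (A.form10 x) (S.form10 x)) := by
    refine mem_extIdeal_of_map_eq_zero (Submodule.factor_surjective hle) (ker_factor_le hle) ?_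
    rw [← hab, map_sum]
    refine Finset.sum_congr rfl fun j _ => ?_
    rw [map_mul, ExteriorAlgebra.map_apply_ι, ExteriorAlgebra.map_apply_ι]
    rfl
  have := mulLeft_mem_range_wedgeOf_succ (V := V x) (relIncl (A.form10 x) (S.form10 x)) p hζ hη
  have hsum : LinearMap.mulLeft ℂ (∑ j, ExteriorAlgebra.ι ℂ ((A.form10 x).mkQ (a j)) *
      ExteriorAlgebra.ι ℂ ((A.form10 x).mkQ (b j))) =
      ∑ j, LinearMap.mulLeft ℂ (ExteriorAlgebra.ι ℂ ((A.form10 x).mkQ (a j))) ∘ₗ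
        LinearMap.mulLeft ℂ (ExteriorAlgebra.ι ℂ ((A.form10 x).mkQ (b j))) := by
    refine LinearMap.ext fun y => ?_
    rw [LinearMap.sum_apply, LinearMap.mulLeft_apply, Finset.sum_mul]
    exact Finset.sum_congr rfl fun j _ => mul_assoc _ _ y
  have hr : ∀ y : ExteriorAlgebra ℂ (A.Form01 x) ⊗[ℂ] V x,
      LinearMap.rTensor (V x) (LinearMap.mulLeft ℂ (∑ j,
        ExteriorAlgebra.ι ℂ ((A.form10 x).mkQ (a j)) *
        ExteriorAlgebra.ι ℂ ((A.form10 x).mkQ (b j)))) y =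
      ∑ j, LinearMap.rTensor (V x) (LinearMap.mulLeft ℂ (ExteriorAlgebra.ι ℂ
        ((A.form10 x).mkQ (a j)))) (LinearMap.rTensor (V x) (LinearMap.mulLeft ℂ
          (ExteriorAlgebra.ι ℂ ((A.form10 x).mkQ (b j)))) y) := by
    intro y
    rw [hsum]
    induction y using TensorProduct.induction_on with
    | zero => simp
    | add y z hy hz => simp only [map_add, hy, hz, Finset.sum_add_distrib]
    | tmul α v =>
      simp only [LinearMap.rTensor_tmul, LinearMap.sum_apply, TensorProduct.sum_tmul]
      rfl
  exact (hr η) ▸ this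

lemma partOf_wedgeB {r : A.Form01 x →ₗ[ℂ] RelQuot (A.form10 x) (S.form10 x)}
    (hr : ∀ b, r (relIncl _ _ b) = b) (t : A.FormFibre (BFibre A S V p) x) :
    partOf V p x h r (wedgeB A S V p x t) = reduce A (BFibre A S V p) x h t :=
  symbolMap_wedgeOf (V := V x) (factor_relIncl h) hr p t

lemma leadingPart_wedgeB (t : A.FormFibre (BFibre A S V p) x) :
    leadingPart V p x h (wedgeB A S V p x t) = reduce A (BFibre A S V p) x h t :=
  partOf_wedgeB h relSplit_relIncl t

/-- Independence of the splitting. It allows the fibrewise choice `relSplit`, which need not depend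
smoothly on the point, to be replaced by a smooth projection. -/
lemma partOf_eq_leadingPart {r : A.Form01 x →ₗ[ℂ] RelQuot (A.form10 x) (S.form10 x)}
    (hr : ∀ b, r (relIncl _ _ b) = b) {η : A.FormFibre V x} (hη : η ∈ filFibre A S V p x) :
    partOf V p x h r η = leadingPart V p x h η := by
  obtain ⟨t, rfl⟩ := hη
  rw [partOf_wedgeB h hr, leadingPart_wedgeB]

lemma leadingPart_eq_zero {η : A.FormFibre V x} (hη : η ∈ filFibre A S V (p + 1) x) :
    leadingPart V p x h η = 0 :=
  symbolMap_of_mem_succ (V := V x) (factor_relIncl h) relSplit_relIncl p hη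

lemma mem_filFibre_succ {η : A.FormFibre V x} (hη : η ∈ filFibre A S V p x)
    (h0 : leadingPart V p x h η = 0) : η ∈ filFibre A S V (p + 1) x := by
  obtain ⟨t, rfl⟩ := hη
  rw [leadingPart_wedgeB] at h0
  exact wedgeOf_mem_succ_of_reduce_eq_zero (V := V x) (Submodule.factor_surjective h)
    (ker_factor_le h) p h0

lemma wedge01_wedgeB (a : A.Form01 x) (t : A.FormFibre (BFibre A S V p) x) :
    wedge01 V x a (wedgeB A S V p x t) = wedgeB A S V p x (wedge01 _ x a t) :=
  mulLeft_wedgeOf (V := V x) (relIncl (A.form10 x) (S.form10 x)) p (ExteriorAlgebra.ι ℂ a) t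

lemma reduce_wedge01 {W : M → Type*} [∀ x, AddCommGroup (W x)] [∀ x, Module ℂ (W x)]
    (u : CCotangent E x) (t : A.FormFibre W x) :
    reduce A W x h (wedge01 W x ((A.form10 x).mkQ u) t) =
      wedge01 W x ((S.form10 x).mkQ u) (reduce A W x h t) := by
  have : ∀ t : ExteriorAlgebra ℂ (A.Form01 x) ⊗[ℂ] W x,
      reduceMap h (W x) (wedgeLeft (W x) ((A.form10 x).mkQ u) t) =
      wedgeLeft (W x) ((S.form10 x).mkQ u) (reduceMap h (W x) t) := by
    intro t
    induction t using TensorProduct.induction_on with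
    | zero => simp
    | add y z hy hz => simp only [map_add, hy, hz]
    | tmul α w =>
      rw [wedgeLeft, wedgeLeft, reduceMap, LinearMap.rTensor_tmul, LinearMap.rTensor_tmul,
        LinearMap.rTensor_tmul, LinearMap.rTensor_tmul, LinearMap.mulLeft_apply,
        LinearMap.mulLeft_apply, AlgHom.toLinearMap_apply, AlgHom.toLinearMap_apply, map_mul, ExteriorAlgebra.map_apply_ι]
      rfl
  exact this t

lemma leadingPart_wedge01 (u : CCotangent E x) {η : A.FormFibre V x}
    (hη : η ∈ filFibre A S V p x) :
    leadingPart V p x h (wedge01 V x ((A.form10 x).mkQ u) η) =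
      wedge01 _ x ((S.form10 x).mkQ u) (leadingPart V p x h η) := by
  obtain ⟨t, rfl⟩ := hη
  rw [wedge01_wedgeB, leadingPart_wedgeB, leadingPart_wedgeB, reduce_wedge01]

variable (A S V x) in
-- `B^1` embeds in a quotient of the complexified cotangent space, whose complex dimension is the
-- real dimension of `E`.
lemma filFibre_eq_bot [FiniteDimensional ℝ E] (hp : Module.finrank ℝ E < p) :
    filFibre A S V p x = ⊥ := by
  have : FiniteDimensional ℝ (TangentSpace 𝓘(ℝ, E) x) := inferInstanceAs (FiniteDimensional ℝ E)
  refine range_wedgeOf_eq_bot (V := V x) (relIncl (A.form10 x) (S.form10 x)) (lt_of_le_of_lt ?_ hp)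
  refine (LinearMap.finrank_le_finrank_of_injective (relIncl_injective _ _)).trans
    ((Submodule.finrank_quotient_le _).trans ?_)
  rw [Subspace.dual_finrank_eq, Module.finrank_baseChange]
  exact le_of_eq rfl

/-- An element of degree `n` in the step `n + 1` of the filtration vanishes. -/
lemma eq_zero_of_mem_filFibre {n : ℕ} {η : A.FormFibre V x}
    (hη : η ∈ filFibre A S V (n + 1) x)
    (hn : η ∈ Submodule.span ℂ {y : A.FormFibre V x | ∃ (a : Fin n → A.Form01 x) (v : V x),
      y = FormFibre.tmul (ExteriorAlgebra.ιMulti ℂ n a) v}) : η = 0 :=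
  eq_zero_of_rTensor_projDeg (V := V x) n hn
    (rTensor_projDeg_of_mem (V := V x) (relIncl (A.form10 x) (S.form10 x)) n hη)

end LeadingPart

end Involutive

end

noncomputable section

namespace Involutive

open InvolutiveStructure

/-! ### Smoothness of the maps between sections -/

/-- The constant is `(-1)^q`. What matters is that it is chosen before the space: the same scalar
then serves in the fibres at all points, and identities between sections stay within complex linear
spans. -/
lemma exists_involute_ιMulti (q : ℕ) : ∃ c : ℂ, ∀ (N : Type*) [AddCommGroup N] [Module ℂ N]
    (a : Fin q → N), CliffordAlgebra.involute (ExteriorAlgebra.ιMulti ℂ q a) =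
      c • ExteriorAlgebra.ιMulti ℂ q a := by
  induction q with
  | zero => exact ⟨1, fun N _ _ a => by simp⟩
  | succ q ih =>
    obtain ⟨c, hc⟩ := ih
    refine ⟨-c, fun N _ _ a => ?_⟩
    rw [ExteriorAlgebra.ιMulti_succ_apply, map_mul, hc, neg_smul, mul_smul_comm,
      ← smul_neg, ← neg_mul]
    congr 2
    exact CliffordAlgebra.involute_ι _

lemma exists_splitWedge_ιMulti (q : ℕ) : ∃ c : ℂ, ∀ {N N' B : Type*} [AddCommGroup N]
    [Module ℂ N] [AddCommGroup N'] [Module ℂ N'] [AddCommGroup B] [Module ℂ B]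
    (π : N →ₗ[ℂ] N') (r : N →ₗ[ℂ] B) (a : N) {k : ℕ} (θ : Fin q → N') (β : Fin k → B),
    splitWedge π r a (ExteriorAlgebra.ιMulti ℂ q θ ⊗ₜ ExteriorAlgebra.ιMulti ℂ k β) =
      ExteriorAlgebra.ιMulti ℂ (q + 1) (Fin.cons (π a) θ : Fin (q + 1) → N') ⊗ₜ
          ExteriorAlgebra.ιMulti ℂ k β +
        c • (ExteriorAlgebra.ιMulti ℂ q θ ⊗ₜ
          ExteriorAlgebra.ιMulti ℂ (k + 1) (Fin.cons (r a) β : Fin (k + 1) → B)) := by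
  obtain ⟨c, hc⟩ := exists_involute_ιMulti q
  refine ⟨c, fun π r a k θ β => ?_⟩
  rw [splitWedge_tmul, hc, TensorProduct.smul_tmul', ExteriorAlgebra.ιMulti_succ_apply,
    ExteriorAlgebra.ιMulti_succ_apply]
  rfl

/-! ### Extraction of the component in `Λ^p B` -/

section ProjTensor

variable {N' B V : Type*} [AddCommGroup N'] [Module ℂ N'] [AddCommGroup B] [Module ℂ B]
  [AddCommGroup V] [Module ℂ V]

/-- The map `Λ N' ⊗ Λ B → Λ N' ⊗ (Λ^p B ⊗ V)` given by the projection to `Λ^p B` and an element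
of `V`. -/
def projTensor (p : ℕ) (v : V) : ExteriorAlgebra ℂ N' ⊗[ℂ] ExteriorAlgebra ℂ B →ₗ[ℂ]
    ExteriorAlgebra ℂ N' ⊗[ℂ] (⋀[ℂ]^p B ⊗[ℂ] V) :=
  (TensorProduct.assoc ℂ _ _ _).toLinearMap ∘ₗ
    (TensorProduct.mk ℂ (ExteriorAlgebra ℂ N' ⊗[ℂ] ⋀[ℂ]^p B) V).flip v ∘ₗ
      LinearMap.lTensor _ (projDeg B p)

lemma projTensor_ιMulti (p : ℕ) (v : V) (ξ : ExteriorAlgebra ℂ N') (b : Fin p → B) :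
    projTensor p v (ξ ⊗ₜ ExteriorAlgebra.ιMulti ℂ p b) =
      ξ ⊗ₜ (exteriorPower.ιMulti ℂ p b ⊗ₜ v) := by
  change TensorProduct.assoc ℂ _ _ _ ((ξ ⊗ₜ projDeg B p
    (exteriorPower.ιMulti ℂ p b : ExteriorAlgebra ℂ B)) ⊗ₜ v) = _
  rw [projDeg_coe]
  rfl

lemma projTensor_ιMulti_of_ne {p k : ℕ} (hk : k ≠ p) (v : V) (ξ : ExteriorAlgebra ℂ N')
    (b : Fin k → B) : projTensor p v (ξ ⊗ₜ ExteriorAlgebra.ιMulti ℂ k b) = 0 := by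
  change TensorProduct.assoc ℂ _ _ _ ((ξ ⊗ₜ projDeg B p
    (exteriorPower.ιMulti ℂ k b : ExteriorAlgebra ℂ B)) ⊗ₜ v) = _
  rw [projDeg_of_mem hk (Subtype.property _), TensorProduct.tmul_zero, TensorProduct.zero_tmul,
    map_zero]

end ProjTensor

section Smoothness

variable {E : Type*} [NormedAddCommGroup E] [NormedSpace ℝ E]
  {M : Type*} [TopologicalSpace M] [ChartedSpace E M] [IsManifold 𝓘(ℝ, E) ∞ M]
  {A S : InvolutiveStructure E M}
  {V : M → Type*} [∀ x, AddCommGroup (V x)] [∀ x, Module ℂ (V x)]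
  {Γ : Submodule ℂ (∀ x, V x)}

variable (S Γ) in
/-- The sections `[θ₁] ∧ ⋯ ∧ [θ_n] ⊗ v` with `n` in a given set. -/
def InvolutiveStructure.decomposableIn (I : Set ℕ) : Set (∀ x, S.FormFibre V x) :=
  {s | ∃ n ∈ I, s ∈ S.decomposable Γ n}

lemma decomposableIn_singleton (n : ℕ) : S.decomposableIn Γ {n} = S.decomposable Γ n := by
  ext s
  simp [decomposableIn]

variable (S Γ) in
lemma forms_eq_locSpan : S.forms Γ = locSpan (S.decomposableIn Γ Set.univ) := by
  have : ⋃ q, S.decomposable Γ q = S.decomposableIn Γ Set.univ :=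
    Set.ext fun s => ⟨fun hs => let ⟨q, hq⟩ := Set.mem_iUnion.1 hs; ⟨q, Set.mem_univ q, hq⟩,
      fun ⟨q, _, hq⟩ => Set.mem_iUnion.2 ⟨q, hq⟩⟩
  rw [forms, this]

lemma mem_forms_iff {s : ∀ x, S.FormFibre V x} :
    s ∈ S.forms Γ ↔ s ∈ locSpan (S.decomposableIn Γ Set.univ) := by
  rw [forms_eq_locSpan]

lemma decomposableIn_mono {I J : Set ℕ} (h : I ⊆ J) :
    locSpan (S.decomposableIn Γ I) ≤ locSpan (S.decomposableIn Γ J) :=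
  locSpan_mono (G := S.decomposableIn Γ I) (G' := S.decomposableIn Γ J)
    fun _ ⟨n, hn, hs⟩ => ⟨n, h hn, hs⟩

lemma smoothClosed_decomposableIn (hΓ : SmoothClosed E Γ) (I : Set ℕ) :
    SmoothClosed E (locSpan (S.decomposableIn Γ I)) := by
  refine smoothClosed_locSpan ?_
  rintro f hf - ⟨n, hn, θ, w, hθ, hw, rfl⟩
  refine ⟨n, hn, θ, _, hθ, hΓ f hf w hw, ?_⟩
  funext x
  exact (TensorProduct.tmul_smul (f x) _ (w x)).symm

lemma smoothClosed_BSections (hΓ : SmoothClosed E Γ) (p : ℕ) :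
    SmoothClosed E (BSections A S Γ p) := by
  refine smoothClosed_locSpan ?_
  rintro f hf - ⟨θ, v, hθ, hv, rfl⟩
  refine ⟨θ, _, hθ, hΓ f hf v hv, ?_⟩
  funext x
  exact (TensorProduct.tmul_smul (f x) _ (v x)).symm

variable {p : ℕ}

lemma wedgeB_tmul_one_mem {w : ∀ x, BFibre A S V p x} (hw : w ∈ BSections A S Γ p) :
    (fun x => wedgeB A S V p x (FormFibre.tmul 1 (w x))) ∈ locSpan (A.decomposable Γ p) := by
  let L : ∀ x, BFibre A S V p x →ₗ[ℂ] A.FormFibre V x := fun x =>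
    wedgeB A S V p x ∘ₗ TensorProduct.mk ℂ (ExteriorAlgebra ℂ (A.Form01 x)) (BFibre A S V p x) 1
  refine map_mem_locSpan L ?_ hw
  rintro - ⟨θ, v, hθ, hv, rfl⟩
  refine mem_locSpan_of_mem ⟨fun i x => (θ i x : CCotangent E x), v, hθ, hv, ?_⟩
  funext x
  change (1 * ExteriorAlgebra.map (relIncl (A.form10 x) (S.form10 x)) (ExteriorAlgebra.ιMulti ℂ p
      fun i => ((A.form10 x).submoduleOf (S.form10 x)).mkQ (θ i x))) ⊗ₜ[ℂ] v x = _
  rw [one_mul, ExteriorAlgebra.map_apply_ιMulti]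
  rfl

lemma wedgeB_mem_locSpan {I : Set ℕ} {t : ∀ x, A.FormFibre (BFibre A S V p) x}
    (ht : t ∈ locSpan (A.decomposableIn (BSections A S Γ p) I)) :
    (fun x => wedgeB A S V p x (t x)) ∈ locSpan (A.decomposableIn Γ ((p + ·) '' I)) := by
  refine map_mem_locSpan (fun x => wedgeB A S V p x) ?_ ht
  rintro t ⟨q, hq, ht⟩
  have : (fun x => wedgeB A S V p x (t x)) ∈ locSpan (A.decomposable Γ (p + q)) := by
    refine decomposable_induction (p := fun q t => (fun x => wedgeB A S V p x (t x)) ∈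
      locSpan (A.decomposable Γ (p + q))) (fun w hw => wedgeB_tmul_one_mem hw) ?_ ht
    intro q θ s hθ _ hs
    simp only [← wedge01_wedgeB]
    exact wedge_mem_locSpan hθ hs
  rw [← decomposableIn_singleton] at this
  exact decomposableIn_mono (Set.singleton_subset_iff.2 (Set.mem_image_of_mem _ hq)) this

lemma wedgeB_mem_forms {t : ∀ x, A.FormFibre (BFibre A S V p) x}
    (ht : t ∈ A.forms (BSections A S Γ p)) :
    (fun x => wedgeB A S V p x (t x)) ∈ A.forms Γ := by
  rw [forms_eq_locSpan] at ht ⊢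
  exact decomposableIn_mono (Set.subset_univ _) (wedgeB_mem_locSpan ht)

/-- Smooth sections of `Λ E^{0,1} ⊗ W` lift to smooth sections of `Λ A^{0,1} ⊗ W`. -/
lemma exists_reduce_eq [FiniteDimensional ℝ E] [T2Space M] [SigmaCompactSpace M]
    (hΓ : SmoothClosed E Γ) (h : ∀ x, A.form10 x ≤ S.form10 x) {I : Set ℕ}
    {σ : ∀ x, S.FormFibre V x} (hσ : σ ∈ locSpan (S.decomposableIn Γ I)) :
    ∃ t ∈ locSpan (A.decomposableIn Γ I), ∀ x, reduce A V x (h x) (t x) = σ x := by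
  refine exists_locSpan_of_local (fun x => reduce A V x (h x))
    (smoothClosed_decomposableIn hΓ I) fun x₀ => ?_
  obtain ⟨u, hu, hσu⟩ := hσ x₀
  have hspan : Submodule.span ℂ (S.decomposableIn Γ I) ≤
      (Submodule.span ℂ (A.decomposableIn Γ I)).map (fibrewise fun x => reduce A V x (h x)) := by
    refine Submodule.span_le.2 ?_
    rintro - ⟨n, hn, θ, w, hθ, hw, rfl⟩
    -- The same one-forms, taken modulo `A^{1,0}` instead of `E^{1,0}`, provide the lift.
    refine ⟨_, Submodule.subset_span ⟨n, hn, θ, w, hθ, hw, rfl⟩, ?_⟩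
    funext x
    change (ExteriorAlgebra.map (Submodule.factor (h x)) (ExteriorAlgebra.ιMulti ℂ n
      fun i => (A.form10 x).mkQ (θ i x))) ⊗ₜ[ℂ] w x = _
    rw [ExteriorAlgebra.map_apply_ιMulti]
    rfl
  obtain ⟨t, ht, rfl⟩ := hspan hu
  exact ⟨t, span_le_locSpan _ ht, by filter_upwards [hσu] with x hx using hx.symm⟩

/-! ### Smoothness of the leading part, through `Λ E^{0,1} ⊗ Λ B^1` -/

variable (A S) in
/-- The fibre of `Λ E^{0,1} ⊗ Λ B^1`. -/
def BiFibre (x : M) : Type _ :=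
  ExteriorAlgebra ℂ (S.Form01 x) ⊗[ℂ] ExteriorAlgebra ℂ (RelQuot (A.form10 x) (S.form10 x))

instance (x : M) : AddCommGroup (BiFibre A S x) :=
  inferInstanceAs (AddCommGroup (ExteriorAlgebra ℂ (S.Form01 x) ⊗[ℂ]
    ExteriorAlgebra ℂ (RelQuot (A.form10 x) (S.form10 x))))

instance (x : M) : Module ℂ (BiFibre A S x) :=
  inferInstanceAs (Module ℂ (ExteriorAlgebra ℂ (S.Form01 x) ⊗[ℂ]
    ExteriorAlgebra ℂ (RelQuot (A.form10 x) (S.form10 x))))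

/-- The element `[θ₁] ∧ ⋯ ∧ [θ_q] ⊗ [β₁] ∧ ⋯ ∧ [β_k]` of `Λ E^{0,1} ⊗ Λ B^1`. -/
def BiFibre.mk {x : M} {q k : ℕ} (θ : Fin q → CCotangent E x) (β : Fin k → S.form10 x) :
    BiFibre A S x :=
  ExteriorAlgebra.ιMulti ℂ q (fun i => (S.form10 x).mkQ (θ i)) ⊗ₜ[ℂ]
    ExteriorAlgebra.ιMulti ℂ k (fun i => ((A.form10 x).submoduleOf (S.form10 x)).mkQ (β i))

variable (A S) in
/-- The sections `[θ₁] ∧ ⋯ ∧ [θ_q] ⊗ [β₁] ∧ ⋯ ∧ [β_k]` of `Λ E^{0,1} ⊗ Λ B^1` with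
`q + k = n`. -/
def bidecomposable (n : ℕ) : Set (∀ x : M, BiFibre A S x) :=
  {s | ∃ (q k : ℕ) (θ : Fin q → ∀ x : M, CCotangent E x) (β : Fin k → ∀ x : M, S.form10 x),
    q + k = n ∧ (∀ i, SmoothForm (θ i)) ∧ (∀ i, SmoothForm fun x => (β i x : CCotangent E x)) ∧
    s = fun x => BiFibre.mk (fun i => θ i x) (fun i => β i x)}

/-- The operator on `Λ E^{0,1} ⊗ Λ B^1` that corresponds to exterior multiplication by `a`. -/
def biWedge {x : M} (h : A.form10 x ≤ S.form10 x)
    (r : A.Form01 x →ₗ[ℂ] RelQuot (A.form10 x) (S.form10 x)) (a : A.Form01 x) :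
    BiFibre A S x →ₗ[ℂ] BiFibre A S x :=
  splitWedge (Submodule.factor h) r a

/-- The map `Λ A^{0,1} → Λ E^{0,1} ⊗ Λ B^1`. -/
def biSplit {x : M} (h : A.form10 x ≤ S.form10 x)
    (r : A.Form01 x →ₗ[ℂ] RelQuot (A.form10 x) (S.form10 x)) {n : ℕ}
    (θ : Fin n → CCotangent E x) : BiFibre A S x :=
  splitMap (Submodule.factor h) r (ExteriorAlgebra.ιMulti ℂ n fun i => (A.form10 x).mkQ (θ i))

lemma biSplit_zero {x : M} (h : A.form10 x ≤ S.form10 x)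
    (r : A.Form01 x →ₗ[ℂ] RelQuot (A.form10 x) (S.form10 x)) (θ : Fin 0 → CCotangent E x)
    (θ' : Fin 0 → CCotangent E x) (β : Fin 0 → S.form10 x) :
    biSplit h r θ = BiFibre.mk θ' β := by
  rw [biSplit, BiFibre.mk, ExteriorAlgebra.ιMulti_zero_apply, splitMap_one,
    ExteriorAlgebra.ιMulti_zero_apply, ExteriorAlgebra.ιMulti_zero_apply]

lemma biSplit_succ {x : M} (h : A.form10 x ≤ S.form10 x)
    (r : A.Form01 x →ₗ[ℂ] RelQuot (A.form10 x) (S.form10 x)) {n : ℕ}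
    (θ : Fin (n + 1) → CCotangent E x) :
    biSplit h r θ = biWedge h r ((A.form10 x).mkQ (θ 0)) (biSplit h r fun i => θ i.succ) := by
  rw [biSplit, ExteriorAlgebra.ιMulti_succ_apply, splitMap_ι_mul]
  rfl

lemma exists_biWedge_mk (q : ℕ) : ∃ c : ℂ, ∀ {x : M} (h : A.form10 x ≤ S.form10 x)
    (r : A.Form01 x →ₗ[ℂ] RelQuot (A.form10 x) (S.form10 x)) (u : CCotangent E x)
    (b : S.form10 x) {k : ℕ} (θ : Fin q → CCotangent E x) (β : Fin k → S.form10 x),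
    r ((A.form10 x).mkQ u) = ((A.form10 x).submoduleOf (S.form10 x)).mkQ b →
    biWedge h r ((A.form10 x).mkQ u) (BiFibre.mk θ β) =
      BiFibre.mk (Fin.cons u θ : Fin (q + 1) → CCotangent E x) β +
        c • BiFibre.mk θ (Fin.cons b β : Fin (k + 1) → S.form10 x) := by
  obtain ⟨c, hc⟩ := exists_splitWedge_ιMulti q
  refine ⟨c, fun {x} h r u b k θ β hr => ?_⟩
  have h1 : (fun i => (S.form10 x).mkQ ((Fin.cons u θ : Fin (q + 1) → CCotangent E x) i)) =
      Fin.cons (Submodule.factor h ((A.form10 x).mkQ u)) (fun i => (S.form10 x).mkQ (θ i)) := by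
    funext i
    refine Fin.cases ?_ (fun i => ?_) i <;> rfl
  have h2 : (fun i => ((A.form10 x).submoduleOf (S.form10 x)).mkQ
      ((Fin.cons b β : Fin (k + 1) → S.form10 x) i)) =
      Fin.cons (r ((A.form10 x).mkQ u))
        (fun i => ((A.form10 x).submoduleOf (S.form10 x)).mkQ (β i)) := by
    rw [hr]
    funext i
    refine Fin.cases ?_ (fun i => ?_) i <;> rfl
  rw [BiFibre.mk, BiFibre.mk, BiFibre.mk, h1, h2]
  exact hc (Submodule.factor h) r _ _ _

variable {R : ∀ x : M, CCotangent E x →ₗ[ℂ] S.form10 x}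
  {r : ∀ x : M, A.Form01 x →ₗ[ℂ] RelQuot (A.form10 x) (S.form10 x)}

/-- By induction on the number of factors: multiplication by `[θ]` either adds `θ` to the first
tensor factor or adds the smooth form `R θ` to the second, up to a constant sign. -/
lemma biSplit_mem_span (h : ∀ x, A.form10 x ≤ S.form10 x)
    (hR : ∀ θ : ∀ x : M, CCotangent E x, SmoothForm θ →
      SmoothForm (fun x => (R x (θ x) : CCotangent E x)))
    (hr : ∀ x u, r x ((A.form10 x).mkQ u) =
      ((A.form10 x).submoduleOf (S.form10 x)).mkQ (R x u)) {n : ℕ}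
    (θ : Fin n → ∀ x : M, CCotangent E x) (hθ : ∀ i, SmoothForm (θ i)) :
    (fun x => biSplit (h x) (r x) fun i => θ i x) ∈ Submodule.span ℂ (bidecomposable A S n) := by
  induction n with
  | zero =>
    exact Submodule.subset_span ⟨0, 0, fun i => i.elim0, fun i => i.elim0, rfl,
      fun i => i.elim0, fun i => i.elim0, funext fun x => biSplit_zero _ _ _ _ _⟩
  | succ n ih =>
    simp only [biSplit_succ]
    refine map_mem_of_mem_span (fun x => biWedge (h x) (r x) ((A.form10 x).mkQ (θ 0 x))) ?_
      (ih (fun i => θ i.succ) fun i => hθ i.succ)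
    rintro - ⟨q, k, η, β, hqk, hη, hβ, rfl⟩
    obtain ⟨c, hc⟩ := exists_biWedge_mk (A := A) (S := S) q
    have h1 : (fun x => BiFibre.mk (A := A) (fun i =>
        (Fin.cons (θ 0) η : Fin (q + 1) → ∀ x : M, CCotangent E x) i x) (fun i => β i x)) ∈
          bidecomposable A S (n + 1) := by
      refine ⟨q + 1, k, _, β, by omega, fun i => ?_, hβ, rfl⟩
      refine Fin.cases ?_ (fun i => ?_) i
      · exact hθ 0
      · exact hη i
    have h2 : (fun x => BiFibre.mk (A := A) (fun i => η i x) (fun i =>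
        (Fin.cons (fun x => R x (θ 0 x)) β : Fin (k + 1) → ∀ x : M, S.form10 x) i x)) ∈
          bidecomposable A S (n + 1) := by
      refine ⟨q, k + 1, η, _, by omega, hη, fun i => ?_, rfl⟩
      refine Fin.cases ?_ (fun i => ?_) i
      · exact hR _ (hθ 0)
      · exact hβ i
    convert Submodule.add_mem _ (Submodule.subset_span h1)
      (Submodule.smul_mem _ c (Submodule.subset_span h2)) using 1
    funext x
    have hcons : ∀ {k : ℕ} {W : M → Type _} (a : ∀ x, W x) (b : Fin k → ∀ x, W x),
        (fun i => (Fin.cons a b : Fin (k + 1) → ∀ x, W x) i x) =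
          (Fin.cons (a x) fun i => b i x : Fin (k + 1) → W x) := by
      intro k W a b
      funext i
      refine Fin.cases ?_ (fun i => ?_) i <;> rfl
    rw [Pi.add_apply, Pi.smul_apply, hcons, hcons]
    exact hc (h x) (r x) _ _ _ _ (hr x _)

/-- A product of `n` forms splits into terms of bidegree `(q, k)` with `q + k = n`, and only those
with `k = p` survive. For `p > n` the index set is empty and the result is zero. -/
lemma partOf_mem_span (h : ∀ x, A.form10 x ≤ S.form10 x)
    (hR : ∀ θ : ∀ x : M, CCotangent E x, SmoothForm θ →
      SmoothForm (fun x => (R x (θ x) : CCotangent E x)))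
    (hr : ∀ x u, r x ((A.form10 x).mkQ u) =
      ((A.form10 x).submoduleOf (S.form10 x)).mkQ (R x u)) {n : ℕ}
    {η : ∀ x, A.FormFibre V x} (hη : η ∈ A.decomposable Γ n) :
    (fun x => partOf V p x (h x) (r x) (η x)) ∈
      Submodule.span ℂ (S.decomposableIn (BSections A S Γ p) {q | p + q = n}) := by
  obtain ⟨θ, v, hθ, hv, rfl⟩ := hη
  refine map_mem_of_mem_span (W := BiFibre A S) (W' := S.FormFibre (BFibre A S V p))
    (fun x => projTensor (N' := S.Form01 x) (B := RelQuot (A.form10 x) (S.form10 x)) p (v x)) ?_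
    (biSplit_mem_span h hR hr θ hθ)
  rintro - ⟨q, k, η, β, hqk, hη, hβ, rfl⟩
  by_cases hk : k = p
  · subst hk
    refine Submodule.subset_span ⟨q, (by rw [← hqk]; exact add_comm k q), η, _, hη,
      mem_locSpan_of_mem ⟨β, v, hβ, hv, rfl⟩, ?_⟩
    funext x
    exact projTensor_ιMulti _ _ _ _
  · have h0 : (0 : ∀ x, S.FormFibre (BFibre A S V p) x) ∈ Submodule.span ℂ
        (S.decomposableIn (BSections A S Γ p) {q | p + q = n}) := Submodule.zero_mem _
    convert h0 using 1
    funext x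
    exact projTensor_ιMulti_of_ne hk _ _ _

/-- The leading part of a smooth section is smooth. -/
lemma leadingPart_mem_locSpan [FiniteDimensional ℝ E] [T2Space M]
    (h : ∀ x, A.form10 x ≤ S.form10 x) {I : Set ℕ} {η : ∀ x, A.FormFibre V x}
    (hη : η ∈ locSpan (A.decomposableIn Γ I)) (hp : ∀ x, η x ∈ filFibre A S V p x) :
    (fun x => leadingPart V p x (h x) (η x)) ∈
      locSpan (S.decomposableIn (BSections A S Γ p) {q | p + q ∈ I}) := by
  refine mem_locSpan_of_eventuallyEq fun x₀ => ?_
  obtain ⟨R, hR, hRc, hRid⟩ := S.exists_projection x₀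
  -- `R` is scalar on `E^{1,0}`, hence maps `A^{1,0}` into itself and descends to a map `A^{0,1} →
  -- B^1` at every point. Near `x₀` the scalar is one and this map is a splitting.
  have hle : ∀ x, A.form10 x ≤ ((A.form10 x).submoduleOf (S.form10 x)).comap (R x) := by
    intro x u hu
    obtain ⟨c, hc⟩ := hRc x
    have := hc ⟨u, h x hu⟩
    rw [Submodule.mem_comap]
    change ((R x u : S.form10 x) : CCotangent E x) ∈ A.form10 x
    rw [show R x u = c • (⟨u, h x hu⟩ : S.form10 x) from this]
    exact Submodule.smul_mem _ c hu
  let r : ∀ x : M, A.Form01 x →ₗ[ℂ] RelQuot (A.form10 x) (S.form10 x) := fun x =>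
    Submodule.mapQ _ _ (R x) (hle x)
  obtain ⟨u, hu, hηu⟩ := hη x₀
  refine ⟨fun x => partOf V p x (h x) (r x) (u x), span_le_locSpan _ ?_, ?_⟩
  · refine map_mem_of_mem_span (fun x => partOf V p x (h x) (r x)) ?_ hu
    rintro s ⟨n, hn, hs⟩
    refine Submodule.span_mono ?_ (partOf_mem_span h hR (fun x u => rfl) hs)
    rintro t ⟨q, rfl, ht⟩
    exact ⟨q, hn, ht⟩
  · filter_upwards [hηu, hRid] with x hx hid
    rw [← hx, partOf_eq_leadingPart (h x) ?_ (hp x)]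
    intro b
    obtain ⟨b, rfl⟩ := Submodule.mkQ_surjective _ b
    exact congrArg _ (hid b)

end Smoothness

end Involutive

end

noncomputable section

namespace Involutive

open InvolutiveStructure

/-! ### The filtration is stable under `∂̄`, and the induced structures -/

lemma _root_.LinearMap.exists_induced_of_surjective {X Y : Type*} [AddCommGroup X] [Module ℂ X]
    [AddCommGroup Y] [Module ℂ Y] {L : X →ₗ[ℂ] Y} (hL : Function.Surjective L) (T : X →ₗ[ℂ] X)
    (hT : ∀ x, L x = 0 → L (T x) = 0) : ∃ d : Y →ₗ[ℂ] Y, ∀ x, d (L x) = L (T x) := by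
  obtain ⟨r, hr⟩ := LinearMap.exists_rightInverse_of_surjective L (LinearMap.range_eq_top.2 hL)
  refine ⟨L ∘ₗ T ∘ₗ r, fun x => ?_⟩
  have h1 : L (r (L x) - x) = 0 := by
    rw [map_sub, sub_eq_zero]
    exact LinearMap.congr_fun hr _
  have h2 := hT _ h1
  rw [map_sub, map_sub, sub_eq_zero] at h2
  exact h2

section Induced

variable {E : Type*} [NormedAddCommGroup E] [NormedSpace ℝ E]
  {M : Type*} [TopologicalSpace M] [ChartedSpace E M] [IsManifold 𝓘(ℝ, E) ∞ M]
  {A S : InvolutiveStructure E M}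
  {V : M → Type*} [∀ x, AddCommGroup (V x)] [∀ x, Module ℂ (V x)]
  {Γ : Submodule ℂ (∀ x, V x)}

variable (A S Γ) in
/-- The smooth sections with values in the `p`-th step of the filtration. -/
def filSections (p : ℕ) : Submodule ℂ (A.forms Γ) where
  carrier := {s | ∀ x, s.1 x ∈ filFibre A S V p x}
  zero_mem' := fun _ => Submodule.zero_mem _
  add_mem' := fun ha hb x => Submodule.add_mem _ (ha x) (hb x)
  smul_mem' := fun c _ ha x => Submodule.smul_mem _ c (ha x)

variable (S) in
/-- The sections in the `p`-th step of the filtration with `∂̄` in the same step. -/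
def stableSections (D : A.CompatibleStructure Γ) (p : ℕ) : Submodule ℂ (∀ x, A.FormFibre V x) :=
  (filSections A S Γ p ⊓ (filSections A S Γ p).comap D.dbar).map (A.forms Γ).subtype

variable {D : A.CompatibleStructure Γ} {p : ℕ}

lemma mem_stableSections {s : A.forms Γ} (h1 : s ∈ filSections A S Γ p)
    (h2 : D.dbar s ∈ filSections A S Γ p) : s.1 ∈ stableSections S D p :=
  ⟨s, ⟨h1, h2⟩, rfl⟩

variable [FiniteDimensional ℝ E] [T2Space M]

/-- Both conditions can be tested near each point, because `∂̄` is local. -/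
lemma locSpan_stableSections_le :
    locSpan (stableSections S D p : Set (∀ x, A.FormFibre V x)) ≤ stableSections S D p := by
  intro s hs
  have hloc : ∀ x₀, ∃ t : A.forms Γ, (t ∈ filSections A S Γ p ∧
      D.dbar t ∈ filSections A S Γ p) ∧ ∀ᶠ x in 𝓝 x₀, s x = t.1 x := by
    intro x₀
    obtain ⟨t, ht, hst⟩ := hs x₀
    rw [Submodule.span_eq] at ht
    obtain ⟨t, ht, rfl⟩ := ht
    exact ⟨t, ht, hst⟩
  have hforms : s ∈ A.forms Γ := mem_locSpan_of_eventuallyEq fun x₀ =>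
    let ⟨t, _, hst⟩ := hloc x₀
    ⟨t.1, t.2, hst⟩
  refine mem_stableSections (s := ⟨s, hforms⟩) (fun x₀ => ?_) (fun x₀ => ?_)
  · obtain ⟨t, ht, hst⟩ := hloc x₀
    change s x₀ ∈ _
    rw [hst.self_of_nhds]
    exact ht.1 x₀
  · obtain ⟨t, ht, hst⟩ := hloc x₀
    rw [D.dbar_congr (s := ⟨s, hforms⟩) (t := t) hst]
    exact ht.2 x₀

lemma wedge_mem_stableSections (hΓ : SmoothClosed E Γ) {θ : ∀ x : M, CCotangent E x}
    (hθ : SmoothForm θ) {s : ∀ x, A.FormFibre V x} (hs : s ∈ stableSections S D p) :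
    (fun x => wedge01 V x ((A.form10 x).mkQ (θ x)) (s x)) ∈ stableSections S D p := by
  obtain ⟨s, ⟨hs1, hs2⟩, rfl⟩ := hs
  refine mem_stableSections (s := ⟨_, wedge_mem_forms hθ s.2⟩)
    (fun x => wedge01_mem_filFibre _ (hs1 x)) (fun x₀ => ?_)
  obtain ⟨n, g, f, hg, hf, hgf⟩ := hθ.exists_eq_sum x₀
  rw [D.dbar_wedge hΓ hg hf hgf (s := s) (fun _ => rfl)]
  exact Submodule.sub_mem _ (Submodule.sum_mem _ fun j _ =>
    wedge01_mem_filFibre _ (wedge01_mem_filFibre _ (hs1 x₀))) (wedge01_mem_filFibre _ (hs2 x₀))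

/-- Involutivity of `S` enters here: in `∂̄([θ] ∧ s)` the term `∑ ∂̄g_j ∧ ∂̄f_j ∧ s` gains a
filtration step by `sum_wedge_eq_zero`, and `[θ] ∧ ∂̄s` gains one because `θ` is in `E^{1,0}`. -/
lemma wedge_mem_stableSections_succ (hΓ : SmoothClosed E Γ) (h : ∀ x, A.form10 x ≤ S.form10 x)
    {θ : ∀ x : M, S.form10 x} (hθ : SmoothForm fun x => (θ x : CCotangent E x))
    {s : ∀ x, A.FormFibre V x} (hs : s ∈ stableSections S D p) :
    (fun x => wedge01 V x ((A.form10 x).mkQ (θ x : CCotangent E x)) (s x)) ∈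
      stableSections S D (p + 1) := by
  obtain ⟨s, ⟨hs1, hs2⟩, rfl⟩ := hs
  refine mem_stableSections (s := ⟨_, wedge_mem_forms hθ s.2⟩)
    (fun x => wedge01_mem_filFibre_succ (θ x).2 (hs1 x)) (fun x₀ => ?_)
  obtain ⟨n, g, f, hg, hf, hgf⟩ := hθ.exists_eq_sum x₀
  rw [D.dbar_wedge hΓ hg hf hgf (s := s) (fun _ => rfl)]
  exact Submodule.sub_mem _ (sum_wedge01_mem_filFibre_succ (h x₀) _ _
    (S.sum_wedge_eq_zero (fun x => (θ x).2) hg hf hgf) (hs1 x₀))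
    (wedge01_mem_filFibre_succ (θ x₀).2 (hs2 x₀))

lemma ιMulti_tmul_mem_stableSections (hΓ : SmoothClosed E Γ) (h : ∀ x, A.form10 x ≤ S.form10 x)
    (D : A.CompatibleStructure Γ) (θ : Fin p → ∀ x : M, S.form10 x)
    (hθ : ∀ i, SmoothForm fun x => (θ i x : CCotangent E x)) {v : ∀ x, V x} (hv : v ∈ Γ) :
    (fun x => FormFibre.tmul (ExteriorAlgebra.ιMulti ℂ p
      fun i => (A.form10 x).mkQ (θ i x : CCotangent E x)) (v x)) ∈ stableSections S D p := by
  induction p with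
  | zero =>
    simp only [ExteriorAlgebra.ιMulti_zero_apply]
    refine mem_stableSections (s := ⟨_, tmul_one_mem_forms hv⟩) (fun x => ?_) (fun x => ?_) <;>
    · rw [filFibre_zero]
      exact Submodule.mem_top
  | succ p ih =>
    have := wedge_mem_stableSections_succ hΓ h (hθ 0)
      (ih (fun i => θ i.succ) fun i => hθ i.succ)
    simp only [ExteriorAlgebra.ιMulti_succ_apply]
    exact this

/-- Such a section is locally a sum of products: the `p` forms from `E^{1,0}` raise the step from
`0` to `p`, and the remaining forms preserve it. -/
lemma wedgeB_mem_stableSections (hΓ : SmoothClosed E Γ) (h : ∀ x, A.form10 x ≤ S.form10 x)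
    (D : A.CompatibleStructure Γ) {t : ∀ x, A.FormFibre (BFibre A S V p) x}
    (ht : t ∈ A.forms (BSections A S Γ p)) :
    (fun x => wedgeB A S V p x (t x)) ∈ stableSections S D p := by
  refine locSpan_stableSections_le (map_mem_locSpan (fun x => wedgeB A S V p x) ?_ ht)
  intro t ht
  obtain ⟨q, ht⟩ := Set.mem_iUnion.1 ht
  refine decomposable_induction (p := fun q t => (fun x => wedgeB A S V p x (t x)) ∈
      locSpan (stableSections S D p : Set (∀ x, A.FormFibre V x))) (fun w hw => ?_) ?_ ht
  · let L : ∀ x, BFibre A S V p x →ₗ[ℂ] A.FormFibre V x := fun x =>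
      wedgeB A S V p x ∘ₗ TensorProduct.mk ℂ (ExteriorAlgebra ℂ (A.Form01 x)) (BFibre A S V p x) 1
    refine map_mem_locSpan L ?_ hw
    rintro - ⟨θ, v, hθ, hv, rfl⟩
    refine mem_locSpan_of_mem (SetLike.mem_coe.2 ?_)
    convert ιMulti_tmul_mem_stableSections hΓ h D θ hθ hv using 2 with x
    change (1 * ExteriorAlgebra.map (relIncl (A.form10 x) (S.form10 x))
      (ExteriorAlgebra.ιMulti ℂ p fun i =>
        ((A.form10 x).submoduleOf (S.form10 x)).mkQ (θ i x))) ⊗ₜ[ℂ] v x = _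
    rw [one_mul, ExteriorAlgebra.map_apply_ιMulti]
    rfl
  · intro q θ s hθ _ hs
    simp only [← wedge01_wedgeB]
    exact mem_locSpan_of_mem (wedge_mem_stableSections hΓ hθ (locSpan_stableSections_le hs))

variable [SigmaCompactSpace M]

/-- Every smooth section of `Λ E^{0,1} ⊗ B^p ⊗ V` is the leading part of a smooth section. -/
lemma exists_wedgeB_leadingPart_eq (hΓ : SmoothClosed E Γ) (h : ∀ x, A.form10 x ≤ S.form10 x)
    {I : Set ℕ} {σ : ∀ x, S.FormFibre (BFibre A S V p) x}
    (hσ : σ ∈ locSpan (S.decomposableIn (BSections A S Γ p) I)) :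
    ∃ t ∈ locSpan (A.decomposableIn (BSections A S Γ p) I),
      ∀ x, leadingPart V p x (h x) (wedgeB A S V p x (t x)) = σ x := by
  obtain ⟨t, ht, htσ⟩ := exists_reduce_eq (smoothClosed_BSections hΓ p) h hσ
  exact ⟨t, ht, fun x => by rw [leadingPart_wedgeB, htσ]⟩

variable (p) in
/-- The map from sections in the `p`-th step of the filtration to their leading parts. -/
def leadSections (h : ∀ x, A.form10 x ≤ S.form10 x) :
    filSections A S Γ p →ₗ[ℂ] S.forms (BSections A S Γ p) :=
  LinearMap.codRestrict (S.forms (BSections A S Γ p))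
    ((fibrewise fun x => leadingPart V p x (h x)) ∘ₗ (A.forms Γ).subtype ∘ₗ
      (filSections A S Γ p).subtype) fun s => by
    exact mem_forms_iff.2 (decomposableIn_mono (Set.subset_univ _)
      (leadingPart_mem_locSpan h (mem_forms_iff.1 s.1.2) s.2))

omit [SigmaCompactSpace M] in
lemma leadSections_apply (h : ∀ x, A.form10 x ≤ S.form10 x) (s : filSections A S Γ p) (x : M) :
    (leadSections p h s).1 x = leadingPart V p x (h x) (s.1.1 x) := rfl

/-- The filtration is stable under `∂̄`. -/
lemma dbar_mem_filSections (hΓ : SmoothClosed E Γ) (h : ∀ x, A.form10 x ≤ S.form10 x)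
    (D : A.CompatibleStructure Γ) {s : A.forms Γ} (hs : s ∈ filSections A S Γ p) :
    D.dbar s ∈ filSections A S Γ p := by
  -- Descending induction on `p`, with `k` bounding the distance to the range `p > dim E`, where the
  -- step is zero.
  have key : ∀ k p, Module.finrank ℝ E < p + k → ∀ s ∈ filSections A S Γ p,
      D.dbar s ∈ filSections A S Γ p := by
    intro k
    induction k with
    | zero =>
      intro p hp s hs
      have h0 : s = 0 := by
        refine Subtype.ext (funext fun x => ?_)
        have := hs x
        rw [filFibre_eq_bot A S V x (by omega)] at this
        exact (Submodule.mem_bot ℂ).1 this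
      rw [h0, map_zero]
      exact Submodule.zero_mem _
    | succ k ih =>
      intro p hp s hs
      -- The section `u = wedgeB t` has the same leading part as `s` and is known to be stable. The
      -- difference `s - u` lies in step `p + 1`, where the induction hypothesis applies.
      obtain ⟨t, ht, hts⟩ := exists_wedgeB_leadingPart_eq hΓ h
        (mem_forms_iff.1 (leadSections p h ⟨s, hs⟩).2)
      obtain ⟨u, ⟨hu1, hu2⟩, hut⟩ := wedgeB_mem_stableSections hΓ h D (mem_forms_iff.2 ht)
      have hsub : s - u ∈ filSections A S Γ (p + 1) := by
        intro x
        refine mem_filFibre_succ (h x) (Submodule.sub_mem _ (hs x) (hu1 x)) ?_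
        change leadingPart V p x (h x) (s.1 x - u.1 x) = 0
        rw [map_sub, show u.1 x = wedgeB A S V p x (t x) from congrFun hut x, hts]
        exact sub_self _
      have h1 := ih (p + 1) (by omega) _ hsub
      have h2 : D.dbar s = D.dbar (s - u) + D.dbar u := by rw [map_sub, sub_add_cancel]
      rw [h2]
      exact Submodule.add_mem _ (fun x => filFibre_succ_le A S V p x (h1 x)) hu2
  exact key (Module.finrank ℝ E + 1) p (by omega) s hs

omit [SigmaCompactSpace M] in
lemma mem_filSections_succ (h : ∀ x, A.form10 x ≤ S.form10 x) {s : filSections A S Γ p} :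
    leadSections p h s = 0 ↔ s.1 ∈ filSections A S Γ (p + 1) :=
  ⟨fun h0 x => mem_filFibre_succ (h x) (s.2 x) (congrFun (congrArg Subtype.val h0) x),
    fun hs => Subtype.ext (funext fun x => leadingPart_eq_zero (h x) (hs x))⟩

lemma leadSections_surjective (hΓ : SmoothClosed E Γ) (h : ∀ x, A.form10 x ≤ S.form10 x) :
    Function.Surjective (leadSections (Γ := Γ) p h) := by
  intro σ
  obtain ⟨t, ht, hts⟩ := exists_wedgeB_leadingPart_eq hΓ h (mem_forms_iff.1 σ.2)
  exact ⟨⟨⟨_, wedgeB_mem_forms (mem_forms_iff.2 ht)⟩, fun x => wedgeB_mem_filFibre _⟩,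
    Subtype.ext (funext fun x => hts x)⟩

/-- The operator induced by `∂̄` on the leading parts. -/
lemma exists_induced_dbar (hΓ : SmoothClosed E Γ) (h : ∀ x, A.form10 x ≤ S.form10 x)
    (D : A.CompatibleStructure Γ) (p : ℕ) :
    ∃ d : S.forms (BSections A S Γ p) →ₗ[ℂ] S.forms (BSections A S Γ p),
      ∀ s : filSections A S Γ p, d (leadSections p h s) =
        leadSections p h ⟨D.dbar s, dbar_mem_filSections hΓ h D s.2⟩ := by
  -- The kernel of taking leading parts is step `p + 1`, and `∂̄` preserves that step too; hence
  -- `∂̄` passes to the quotient.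
  have hT : ∀ s : filSections A S Γ p, leadSections p h s = 0 →
      leadSections p h (D.dbar.restrict (fun s hs => dbar_mem_filSections hΓ h D hs) s) = 0 := by
    intro s hs
    have h1 : s.1 ∈ filSections A S Γ (p + 1) := (mem_filSections_succ h).1 hs
    have h2 : D.dbar s.1 ∈ filSections A S Γ (p + 1) := dbar_mem_filSections hΓ h D h1
    exact (mem_filSections_succ (s := ⟨D.dbar s.1, dbar_mem_filSections hΓ h D s.2⟩) h).2 h2
  exact LinearMap.exists_induced_of_surjective (X := filSections A S Γ p)
    (Y := S.forms (BSections A S Γ p)) (L := leadSections p h)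
    (leadSections_surjective (p := p) hΓ h)
    (D.dbar.restrict fun s hs => dbar_mem_filSections hΓ h D hs) hT

/-- A section of degree `q` of `Λ E^{0,1} ⊗ B^p ⊗ V` is the leading part of one of degree
`p + q`. -/
lemma exists_leadSections_eq (hΓ : SmoothClosed E Γ) (h : ∀ x, A.form10 x ≤ S.form10 x) {q : ℕ}
    {σ : S.forms (BSections A S Γ p)} (hσ : σ ∈ S.formsDeg (BSections A S Γ p) q) :
    ∃ s : filSections A S Γ p, s.1 ∈ A.formsDeg Γ (p + q) ∧ leadSections p h s = σ := by
  have hσ' : σ.1 ∈ locSpan (S.decomposable (BSections A S Γ p) q) := hσ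
  rw [← decomposableIn_singleton] at hσ'
  obtain ⟨t, ht, hts⟩ := exists_wedgeB_leadingPart_eq hΓ h hσ'
  have hw := wedgeB_mem_locSpan ht
  rw [Set.image_singleton, decomposableIn_singleton] at hw
  exact ⟨⟨⟨_, locSpan_decomposable_le_forms _ hw⟩, fun x => wedgeB_mem_filFibre _⟩, hw,
    Subtype.ext (funext fun x => hts x)⟩

omit [SigmaCompactSpace M] in
lemma leadSections_mem_formsDeg (h : ∀ x, A.form10 x ≤ S.form10 x) {q : ℕ}
    {s : filSections A S Γ p} (hs : s.1 ∈ A.formsDeg Γ (p + q)) :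
    leadSections p h s ∈ S.formsDeg (BSections A S Γ p) q := by
  have hs' : s.1.1 ∈ locSpan (A.decomposable Γ (p + q)) := hs
  rw [← decomposableIn_singleton] at hs'
  have := leadingPart_mem_locSpan h hs' s.2
  have hI : {k | p + k ∈ ({p + q} : Set ℕ)} = {q} := by
    ext k
    simp
  rw [hI, decomposableIn_singleton] at this
  exact this

/-- The structure on `B^p ⊗ V` induced by a structure on `V`. -/
lemma exists_inducedStructure (hΓ : SmoothClosed E Γ) (h : ∀ x, A.form10 x ≤ S.form10 x)
    (D : A.CompatibleStructure Γ) (p : ℕ) :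
    ∃ N : S.CompatibleStructure (BSections A S Γ p), ∀ s : filSections A S Γ p,
      N.dbar (leadSections p h s) =
        leadSections p h ⟨D.dbar s, dbar_mem_filSections hΓ h D s.2⟩ := by
  obtain ⟨d, hd⟩ := exists_induced_dbar hΓ h D p
  refine ⟨⟨d, ?_, ?_, ?_⟩, hd⟩
  · intro q σ hσ
    obtain ⟨s, hs, rfl⟩ := exists_leadSections_eq hΓ h hσ
    rw [hd]
    exact leadSections_mem_formsDeg h (q := q + 1) (D.dbar_deg _ _ hs)
  · intro f hf σ τ hτ x
    obtain ⟨s, rfl⟩ := leadSections_surjective hΓ h σ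
    -- If `s` has leading part `σ`, then `f s` has leading part `f σ`, so the Leibniz rule for `D`
    -- descends.
    let t : filSections A S Γ p := ⟨⟨_, smoothClosed_forms hΓ f hf _ s.1.2⟩,
      fun x => Submodule.smul_mem _ _ (s.2 x)⟩
    have ht : leadSections p h t = τ := by
      refine Subtype.ext (funext fun x => ?_)
      rw [hτ, leadSections_apply, leadSections_apply]
      exact map_smul _ _ _
    rw [← ht, hd, hd, leadSections_apply, leadSections_apply, leadSections_apply,
      D.leibniz f hf s.1 t.1 (fun _ => rfl) x, map_add, map_smul]
    congr 1
    exact leadingPart_wedge01 (h x) (cdiff f x) (s.2 x)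
  · intro σ
    obtain ⟨s, rfl⟩ := leadSections_surjective hΓ h σ
    rw [hd, hd]
    refine Subtype.ext (funext fun x => ?_)
    rw [leadSections_apply]
    change leadingPart V p x (h x) ((D.dbar (D.dbar s)).1 x) = 0
    rw [D.dbar_dbar]
    exact map_zero _

/-- The structure on `B^p ⊗ V` induced by a structure on `V`. -/
def inducedStructure (hΓ : SmoothClosed E Γ) (h : ∀ x, A.form10 x ≤ S.form10 x)
    (D : A.CompatibleStructure Γ) (p : ℕ) : S.CompatibleStructure (BSections A S Γ p) :=
  (exists_inducedStructure hΓ h D p).choose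

lemma inducedStructure_dbar (hΓ : SmoothClosed E Γ) (h : ∀ x, A.form10 x ≤ S.form10 x)
    (D : A.CompatibleStructure Γ) (s : filSections A S Γ p) :
    (inducedStructure hΓ h D p).dbar (leadSections p h s) =
      leadSections p h ⟨D.dbar s, dbar_mem_filSections hΓ h D s.2⟩ :=
  (exists_inducedStructure hΓ h D p).choose_spec s

omit [SigmaCompactSpace M] in
lemma isSymbol_leadSections (h : ∀ x, A.form10 x ≤ S.form10 x) (s : filSections A S Γ p) :
    IsSymbol h p s.1.1 (leadSections p h s).1 := by
  intro x
  obtain ⟨t, ht⟩ := s.2 x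
  refine ⟨t, ht, ?_⟩
  rw [leadSections_apply, ← ht, leadingPart_wedgeB]

omit [FiniteDimensional ℝ E] [T2Space M] [SigmaCompactSpace M] in
-- Uniqueness of the leading part: the representative `t` in `IsSymbol` may be chosen freely at each
-- point without affecting the result.
lemma IsSymbol.eq_leadingPart {h : ∀ x, A.form10 x ≤ S.form10 x} {η : ∀ x, A.FormFibre V x}
    {σ : ∀ x, S.FormFibre (BFibre A S V p) x} (hs : IsSymbol h p η σ) (x : M) :
    σ x = leadingPart V p x (h x) (η x) := by
  obtain ⟨t, ht, htσ⟩ := hs x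
  rw [← ht, leadingPart_wedgeB, htσ]

/-- The induced structure is the only one for which `∂̄ w` is the leading part of the `∂̄ w` for
the given structure. -/
theorem isInduced_iff (hΓ : SmoothClosed E Γ) (h : ∀ x, A.form10 x ≤ S.form10 x)
    (D : A.CompatibleStructure Γ) (p : ℕ) (N' : S.CompatibleStructure (BSections A S Γ p)) :
    IsInduced h D p N' ↔ N' = inducedStructure hΓ h D p := by
  -- A section `w` of `B^p ⊗ V`, regarded as a form of type `A^{0,p} ⊗ V`, has leading part `1 ⊗ w`.
  -- Being induced is therefore a condition on `∂̄` in degree zero only, where it determines the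
  -- whole structure.
  have key : ∀ (w : ∀ x, BFibre A S V p x) (hw : w ∈ BSections A S Γ p),
      ∃ η : filSections A S Γ p,
        (∀ x, η.1.1 x = wedgeB A S V p x (FormFibre.tmul 1 (w x))) ∧
        leadSections p h η = ⟨_, tmul_one_mem_forms hw⟩ := by
    intro w hw
    refine ⟨⟨⟨_, locSpan_decomposable_le_forms _ (wedgeB_tmul_one_mem hw)⟩,
      fun x => wedgeB_mem_filFibre _⟩, fun _ => rfl, Subtype.ext (funext fun x => ?_)⟩
    rw [leadSections_apply]
    refine (leadingPart_wedgeB (h x) _).trans ?_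
    change ExteriorAlgebra.map (Submodule.factor (h x)) 1 ⊗ₜ[ℂ] w x = _
    rw [map_one]
    rfl
  constructor
  · intro hN
    refine CompatibleStructure.ext_of_degree_zero (smoothClosed_BSections hΓ p) fun w hw => ?_
    obtain ⟨η, s, hη, hs, hsym⟩ := hN w hw
    obtain ⟨η', hη', hlead⟩ := key w hw
    have e1 : η = η'.1 := Subtype.ext (funext fun x => (hη x).trans (hη' x).symm)
    have e2 : s = ⟨_, tmul_one_mem_forms hw⟩ := Subtype.ext (funext fun x => hs x)
    rw [← hlead, inducedStructure_dbar, hlead, ← e2]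
    refine Subtype.ext (funext fun x => ?_)
    rw [leadSections_apply, hsym.eq_leadingPart x, e1]
  · rintro rfl w hw
    obtain ⟨η, hη, hlead⟩ := key w hw
    refine ⟨η.1, ⟨_, tmul_one_mem_forms hw⟩, hη, fun _ => rfl, ?_⟩
    rw [← hlead, inducedStructure_dbar]
    exact isSymbol_leadSections h ⟨D.dbar η, dbar_mem_filSections hΓ h D η.2⟩

end Induced

end Involutive

end

noncomputable section

namespace Involutive

/-! ### The first page -/

section FirstPage

lemma _root_.LinearMap.exists_equiv_of_ker_eq {X Y Z : Type*} [AddCommGroup X] [Module ℂ X]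
    [AddCommGroup Y] [Module ℂ Y] [AddCommGroup Z] [Module ℂ Z] {f : Z →ₗ[ℂ] X} {g : Z →ₗ[ℂ] Y}
    (hf : Function.Surjective f) (hg : Function.Surjective g)
    (hfg : LinearMap.ker f = LinearMap.ker g) : ∃ e : X ≃ₗ[ℂ] Y, ∀ z, e (f z) = g z := by
  refine ⟨(f.quotKerEquivOfSurjective hf).symm ≪≫ₗ Submodule.quotEquivOfEq _ _ hfg ≪≫ₗ
    g.quotKerEquivOfSurjective hg, fun z => ?_⟩
  have : (f.quotKerEquivOfSurjective hf).symm (f z) = Submodule.Quotient.mk z :=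
    (LinearEquiv.symm_apply_eq _).2 rfl
  rw [LinearEquiv.trans_apply, LinearEquiv.trans_apply, this]
  rfl

lemma SpectralSequenceOf.exists_firstPage_equiv {C Y : Type*} [AddCommGroup C] [Module ℂ C]
    [AddCommGroup Y] [Module ℂ Y] {d : C →ₗ[ℂ] C} {K : ℕ → ℕ → Submodule ℂ C}
    (Sp : SpectralSequenceOf d K) (hr : (1 : ℤ) ≤ (1 : ℕ)) {p q : ℕ} {g : approxCycles d K 1 p (p + q) →ₗ[ℂ] Y}
    (hg : Function.Surjective g) (hker : LinearMap.ker g =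
      (approxBoundaries d K 1 p (p + q)).submoduleOf (approxCycles d K 1 p (p + q))) :
    ∃ e : (Sp.seq.page (1 : ℕ) hr).X (p, q) ≃ₗ[ℂ] Y, ∀ η, e (Sp.repr 1 hr p q η) = g η :=
  LinearMap.exists_equiv_of_ker_eq (Sp.repr_surjective 1 hr p q) hg
    ((Sp.ker_repr 1 hr p q).trans hker.symm)

variable {C C' : Type*} [AddCommGroup C] [Module ℂ C] [AddCommGroup C'] [Module ℂ C']
  {d : C →ₗ[ℂ] C} {K : ℕ → ℕ → Submodule ℂ C} {d' : C' →ₗ[ℂ] C'} {K' : ℕ → Submodule ℂ C'}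
  {p : ℕ} {G : Submodule ℂ C} {lead : G →ₗ[ℂ] C'}

/-- The first page of a filtered complex, if the graded pieces of the filtration are
identified with complexes `K'` by surjections `lead`. -/
lemma IsFilteredComplex.exists_firstPage (hK : IsFilteredComplex d K)
    (hG : ∀ n, K p n ≤ G) (hdG : ∀ c ∈ G, d c ∈ G)
    (hlead : ∀ q (c : G), (c : C) ∈ K p (p + q) → lead c ∈ K' q)
    (hsurj : ∀ q, ∀ σ ∈ K' q, ∃ c : G, (c : C) ∈ K p (p + q) ∧ lead c = σ)
    (hd : ∀ c : G, d' (lead c) = lead ⟨d c, hdG c c.2⟩)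
    (hker : ∀ n (c : G), (c : C) ∈ K p n → (lead c = 0 ↔ (c : C) ∈ K (p + 1) n)) (q : ℕ) :
    ∃ Ψ : approxCycles d K 1 p (p + q) →ₗ[ℂ] cocycles d' K' q,
      (∀ η, (Ψ η : C') = lead ⟨η, hG _ η.2.1⟩) ∧
      Function.Surjective (Cohomology.mk d' K' q ∘ₗ Ψ) ∧
      LinearMap.ker (Cohomology.mk d' K' q ∘ₗ Ψ) =
        (approxBoundaries d K 1 p (p + q)).submoduleOf (approxCycles d K 1 p (p + q)) := by
  have hin : approxCycles d K 1 p (p + q) ≤ G := fun c hc => hG _ hc.1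
  have hcoc : ∀ η : approxCycles d K 1 p (p + q),
      (lead ∘ₗ Submodule.inclusion hin) η ∈ cocycles d' K' q := by
    intro η
    refine ⟨hlead q _ η.2.1, ?_⟩
    change d' (lead ⟨η, hin η.2⟩) = 0
    rw [hd]
    exact (hker _ _ (hK.d_mem _ _ _ η.2.1)).2 η.2.2
  refine ⟨(lead ∘ₗ Submodule.inclusion hin).codRestrict _ hcoc, fun η => rfl, ?_, ?_⟩
  · intro y
    obtain ⟨σ, rfl⟩ := Cohomology.mk_surjective _ _ y
    obtain ⟨c, hc, hcσ⟩ := hsurj q σ σ.2.1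
    -- The leading part of `d c` is `d' σ = 0`, so any lift of a cocycle is automatically in
    -- `Z_1^p`.
    have hdc : d (c : C) ∈ K (p + 1) (p + q + 1) := by
      refine (hker _ ⟨d c, hdG c c.2⟩ (hK.d_mem _ _ _ hc)).1 ?_
      rw [← hd, hcσ]
      exact σ.2.2
    exact ⟨⟨c, hc, hdc⟩, congrArg (Cohomology.mk d' K' q) (Subtype.ext hcσ)⟩
  · ext η
    rw [LinearMap.mem_ker, LinearMap.comp_apply, Cohomology.mk_eq_zero]
    change lead ⟨η, hin η.2⟩ ∈ coboundaries d' K' q ↔ (η : C) ∈ approxBoundaries d K 1 p (p + q)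
    constructor
    · intro hη
      -- The coboundary `lead η` is lifted to a coboundary `c` in step `p`. For `q = 0` there are no
      -- coboundaries in the target and `c = 0`.
      obtain ⟨c, hcG, hc, hcη⟩ : ∃ c : C, ∃ hc : c ∈ G, c ∈ K p (p + q) ⊓
          coboundaries d (K p) (p + q) ∧ lead ⟨η, hin η.2⟩ = lead ⟨c, hc⟩ := by
        cases q with
        | zero =>
          refine ⟨0, G.zero_mem, Submodule.zero_mem _, ?_⟩
          rw [show lead ⟨η, hin η.2⟩ = 0 from (Submodule.mem_bot ℂ).1 hη]
          exact (map_zero lead).symm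
        | succ q =>
          obtain ⟨τ, hτ, hτη⟩ := hη
          obtain ⟨b, hb, rfl⟩ := hsurj q τ hτ
          exact ⟨d b, hdG b b.2, ⟨hK.d_mem _ _ _ hb, ⟨b, hb, rfl⟩⟩, by rw [← hτη, hd]⟩
      have hsub : (η : C) - c ∈ K (p + 1) (p + q) := by
        refine (hker _ ⟨(η : C) - c, G.sub_mem (hin η.2) hcG⟩
          (Submodule.sub_mem _ η.2.1 hc.1)).1 ?_
        have := map_sub lead ⟨η, hin η.2⟩ ⟨c, hcG⟩
        rw [hcη, sub_self] at this
        exact this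
      rw [← sub_add_cancel (η : C) c]
      exact Submodule.add_mem _ (Submodule.mem_sup_left ⟨hsub, hK.d_mem _ _ _ hsub⟩)
        (Submodule.mem_sup_right hc)
    · intro hη
      obtain ⟨a, ha, b, hb, hab⟩ := Submodule.mem_sup.1 hη
      have haG : a ∈ G := hG _ (hK.succ_le _ _ ha.1)
      have hbG : b ∈ G := hG _ hb.1
      have hsum : lead ⟨η, hin η.2⟩ = lead ⟨a, haG⟩ + lead ⟨b, hbG⟩ := by
        rw [← map_add]
        exact congrArg lead (Subtype.ext hab.symm)
      rw [hsum, (hker _ ⟨a, haG⟩ (hK.succ_le _ _ ha.1)).2 ha.1, zero_add]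
      have hb2 : b ∈ coboundaries d (K p) (p + q) := hb.2
      -- For `q = 0`, `b` is the differential of an element of degree `p - 1` in step `p`, and that
      -- step is zero there (for `p = 0` there is no such degree).
      cases q with
      | zero =>
        have hb0 : b = 0 := by
          cases p with
          | zero => exact (Submodule.mem_bot ℂ).1 hb2
          | succ p =>
            obtain ⟨c, hc, rfl⟩ := hb2
            rw [hK.eq_zero_of_lt (Nat.lt_succ_self p) hc, map_zero]
        subst hb0
        rw [show lead ⟨0, hbG⟩ = 0 from map_zero lead]
        exact Submodule.zero_mem _
      | succ q =>
        obtain ⟨c, hc, rfl⟩ := hb2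
        exact ⟨lead ⟨c, hG _ hc⟩, hlead q ⟨c, hG _ hc⟩ hc, hd _⟩

end FirstPage

open InvolutiveStructure

/-! ### The filtration of the compactly supported forms -/

section Filtration

variable {E : Type*} [NormedAddCommGroup E] [NormedSpace ℝ E]
  {M : Type*} [TopologicalSpace M] [ChartedSpace E M]

/-- Trivializations are complex linear, so multiplication by `f` may be carried out in a
trivialization. -/
lemma smoothClosed_smoothSections (F : Type*) [NormedAddCommGroup F] [NormedSpace ℂ F]
    (V : M → Type*) [TopologicalSpace (Bundle.TotalSpace F V)]
    [∀ x, TopologicalSpace (V x)] [∀ x, AddCommGroup (V x)] [∀ x, Module ℂ (V x)]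
    [FiberBundle F V] [VectorBundle ℂ F V] [VectorBundle ℝ F V]
    [ContMDiffVectorBundle ∞ F V 𝓘(ℝ, E)] : SmoothClosed E (smoothSections E F V) := by
  intro f hf s hs x₀
  have hs0 := (Bundle.contMDiffAt_section (s := s) x₀).1 (hs x₀)
  refine (Bundle.contMDiffAt_section (s := fun x => f x • s x) x₀).2 ?_
  have h2 : ContMDiffAt 𝓘(ℝ, E) 𝓘(ℝ, F) ∞
      (fun x => f x • (trivializationAt F V x₀ ⟨x, s x⟩).2) x₀ :=
    (contDiff_smul (𝕜 := ℝ) (𝕜' := ℂ) (F := F)).contMDiff.contMDiffAt.comp x₀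
      ((hf x₀).prodMk_space hs0)
  refine h2.congr_of_eventuallyEq ?_
  filter_upwards [(trivializationAt F V x₀).open_baseSet.mem_nhds
    (FiberBundle.mem_baseSet_trivializationAt F V x₀)] with x hx
  exact ((trivializationAt F V x₀).linear ℂ hx).map_smul (f x) (s x)

variable [IsManifold 𝓘(ℝ, E) ∞ M] {A S : InvolutiveStructure E M}
  {V : M → Type*} [∀ x, AddCommGroup (V x)] [∀ x, Module ℂ (V x)]
  {Γ : Submodule ℂ (∀ x, V x)}

variable (A S Γ) in
lemma filtrationC_succ_le (p n : ℕ) : filtrationC A S Γ (p + 1) n ≤ filtrationC A S Γ p n :=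
  fun _ hs => ⟨hs.1, fun x => filFibre_succ_le A S V p x (hs.2 x)⟩

variable (A S Γ) in
lemma filtrationC_zero : filtrationC A S Γ 0 = A.formsDegC Γ := by
  funext n
  refine le_antisymm (fun s hs => hs.1) fun s hs => ⟨hs, fun x => ?_⟩
  change s.1 x ∈ filFibre A S V 0 x
  rw [filFibre_zero]
  exact Submodule.mem_top

lemma apply_mem_span_of_mem_locSpan {n : ℕ} {s : ∀ x, A.FormFibre V x}
    (hs : s ∈ locSpan (A.decomposable Γ n)) (x : M) :
    s x ∈ Submodule.span ℂ {y : A.FormFibre V x | ∃ (a : Fin n → A.Form01 x) (v : V x),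
      y = FormFibre.tmul (ExteriorAlgebra.ιMulti ℂ n a) v} := by
  obtain ⟨t, ht, hst⟩ := hs x
  rw [hst.self_of_nhds]
  refine (Submodule.span_le (p := (Submodule.span ℂ _).comap (LinearMap.proj x))).2 ?_ ht
  rintro - ⟨θ, w, -, -, rfl⟩
  exact Submodule.subset_span ⟨_, w x, rfl⟩

variable (A S Γ) in
lemma filtrationC_eq_bot (n : ℕ) : filtrationC A S Γ (n + 1) n = ⊥ := by
  rw [eq_bot_iff]
  intro s hs
  refine (Submodule.mem_bot ℂ).2 (Subtype.ext (funext fun x => ?_))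
  exact eq_zero_of_mem_filFibre (hs.2 x) (apply_mem_span_of_mem_locSpan hs.1.1 x)

variable [FiniteDimensional ℝ E] [T2Space M]

lemma leadSections_mem_formsDegC (h : ∀ x, A.form10 x ≤ S.form10 x) {p q : ℕ}
    {s : filSections A S Γ p} (hs : s.1 ∈ filtrationC A S Γ p (p + q)) :
    leadSections p h s ∈ S.formsDegC (BSections A S Γ p) q := by
  obtain ⟨⟨hdeg, K, hK, hsK⟩, -⟩ := hs
  refine ⟨leadSections_mem_formsDeg h hdeg, K, hK, fun x hx => ?_⟩
  change (leadSections p h s).1 x = 0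
  rw [leadSections_apply, show s.1.1 x = 0 from hsK x hx, map_zero]

variable [SigmaCompactSpace M]

lemma dbar_mem_filtrationC (hΓ : SmoothClosed E Γ) (h : ∀ x, A.form10 x ≤ S.form10 x)
    (D : A.CompatibleStructure Γ) {p n : ℕ} {s : A.forms Γ} (hs : s ∈ filtrationC A S Γ p n) :
    D.dbar s ∈ filtrationC A S Γ p (n + 1) :=
  ⟨⟨D.dbar_deg n s hs.1.1, D.dbar_mem_compactlySupported hs.1.2⟩,
    dbar_mem_filSections hΓ h D hs.2⟩

lemma isFilteredComplex_filtrationC (hΓ : SmoothClosed E Γ) (h : ∀ x, A.form10 x ≤ S.form10 x)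
    (D : A.CompatibleStructure Γ) : IsFilteredComplex D.dbar (filtrationC A S Γ) where
  d_d := D.dbar_dbar
  d_mem _ _ _ hs := dbar_mem_filtrationC hΓ h D hs
  succ_le := filtrationC_succ_le A S Γ
  eq_bot := filtrationC_eq_bot A S Γ

/-- A compactly supported section is the leading part of a compactly supported section. -/
lemma exists_leadSections_eq_of_compact (hΓ : SmoothClosed E Γ)
    (h : ∀ x, A.form10 x ≤ S.form10 x) {p q : ℕ} {σ : S.forms (BSections A S Γ p)}
    (hσ : σ ∈ S.formsDegC (BSections A S Γ p) q) :
    ∃ s : filSections A S Γ p, s.1 ∈ filtrationC A S Γ p (p + q) ∧ leadSections p h s = σ := by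
  obtain ⟨s, hs, hsσ⟩ := exists_leadSections_eq hΓ h hσ.1
  obtain ⟨K, hK, hσK⟩ := hσ.2
  -- The lift `s` need not have compact support, but `χ s` does. Its leading part is `χ σ = σ`,
  -- because `χ` is one on `K` and `σ` vanishes off `K`.
  obtain ⟨χ, K', hχ, hK', h1, h0⟩ := exists_compact_cutoff E hK
  have hdeg : (fun x => χ x • s.1.1 x) ∈ locSpan (A.decomposable Γ (p + q)) :=
    smoothClosed_locSpan_decomposable hΓ _ χ hχ _ hs
  have hfil : ∀ x, χ x • s.1.1 x ∈ filFibre A S V p x :=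
    fun x => Submodule.smul_mem _ _ (s.2 x)
  refine ⟨⟨⟨_, locSpan_decomposable_le_forms _ hdeg⟩, hfil⟩, ⟨⟨hdeg, K', hK', fun x hx => ?_⟩,
    hfil⟩, Subtype.ext (funext fun x => ?_)⟩
  · change χ x • s.1.1 x = 0
    rw [h0 x hx, zero_smul]
  · rw [leadSections_apply, ← hsσ]
    refine (map_smul (leadingPart V p x (h x)) (χ x) (s.1.1 x)).trans ?_
    rw [← leadSections_apply, hsσ]
    by_cases hx : x ∈ K
    · rw [h1 x hx, one_smul]
    · rw [show σ.1 x = 0 from hσK x hx, smul_zero]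

/-- The first page of the spectral sequence. -/
theorem exists_firstPage_filtrationC (hΓ : SmoothClosed E Γ) (h : ∀ x, A.form10 x ≤ S.form10 x)
    (D : A.CompatibleStructure Γ) (p q : ℕ) :
    ∃ Ψ : approxCycles D.dbar (filtrationC A S Γ) 1 p (p + q) →ₗ[ℂ]
        cocycles (inducedStructure hΓ h D p).dbar (S.formsDegC (BSections A S Γ p)) q,
      (∀ η, IsSymbol h p η.1.1 (Ψ η).1.1) ∧
      Function.Surjective (Cohomology.mk _ _ q ∘ₗ Ψ) ∧
      LinearMap.ker (Cohomology.mk _ _ q ∘ₗ Ψ) =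
        (approxBoundaries D.dbar (filtrationC A S Γ) 1 p (p + q)).submoduleOf
          (approxCycles D.dbar (filtrationC A S Γ) 1 p (p + q)) := by
  obtain ⟨Ψ, h1, h2, h3⟩ := (isFilteredComplex_filtrationC hΓ h D).exists_firstPage
    (d' := (inducedStructure hΓ h D p).dbar) (K' := S.formsDegC (BSections A S Γ p)) (p := p)
    (G := filSections A S Γ p) (lead := leadSections p h) (fun n s hs => hs.2)
    (fun s hs => dbar_mem_filSections hΓ h D hs)
    (fun q s hs => leadSections_mem_formsDegC h hs)
    (fun q σ hσ => exists_leadSections_eq_of_compact hΓ h hσ)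
    (inducedStructure_dbar hΓ h D)
    (fun n s hs => ⟨fun h0 => ⟨hs.1, (mem_filSections_succ h).1 h0⟩,
      fun h1 => (mem_filSections_succ h).2 h1.2⟩) q
  refine ⟨Ψ, fun η => ?_, h2, h3⟩
  rw [h1 η]
  exact isSymbol_leadSections h ⟨η.1, η.2.1.2⟩

end Filtration

end Involutive

end

/-! ### The theorem -/

theorem mainTheorem6
    {E : Type*} [NormedAddCommGroup E] [NormedSpace ℝ E] [FiniteDimensional ℝ E]
    {M : Type*} [TopologicalSpace M] [ChartedSpace E M] [IsManifold 𝓘(ℝ, E) ∞ M]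
    [T2Space M] [SigmaCompactSpace M]
    (F : Type*) [NormedAddCommGroup F] [NormedSpace ℂ F] [FiniteDimensional ℂ F]
    (V : M → Type*) [TopologicalSpace (Bundle.TotalSpace F V)]
    [∀ x, TopologicalSpace (V x)] [∀ x, AddCommGroup (V x)] [∀ x, Module ℂ (V x)]
    [FiberBundle F V] [VectorBundle ℂ F V] [VectorBundle ℝ F V]
    [ContMDiffVectorBundle ∞ F V 𝓘(ℝ, E)]
    (𝒜 ℰ : InvolutiveStructure E M)
    (h : ∀ x, 𝒜.form10 x ≤ ℰ.form10 x)
    (D : 𝒜.CompatibleStructure (smoothSections E F V)) :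
    -- every `B^p ⊗ V` has exactly one `ℰ`-compatible structure `N p` induced by that of `V`
    ∃ N : ∀ p, ℰ.CompatibleStructure (BSections 𝒜 ℰ (smoothSections E F V) p),
      (∀ p N', IsInduced h D p N' ↔ N' = N p) ∧
      -- the filtration is a finite decreasing filtration by subcomplexes
      (∀ p n, ∀ η ∈ filtrationC 𝒜 ℰ (smoothSections E F V) p n,
        D.dbar η ∈ filtrationC 𝒜 ℰ (smoothSections E F V) p (n + 1)) ∧
      (∀ p n, filtrationC 𝒜 ℰ (smoothSections E F V) (p + 1) n ≤
        filtrationC 𝒜 ℰ (smoothSections E F V) p n) ∧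
      filtrationC 𝒜 ℰ (smoothSections E F V) 0 = 𝒜.formsDegC (smoothSections E F V) ∧
      (∀ n, filtrationC 𝒜 ℰ (smoothSections E F V) (n + 1) n = ⊥) ∧
      -- its spectral sequence
      ∃ Sp : SpectralSequenceOf D.dbar (filtrationC 𝒜 ℰ (smoothSections E F V)),
        -- the first page; the isomorphism maps an element to the class of the leading part of
        -- any representative
        (∀ p q : ℕ, ∃ e : (Sp.seq.page 1).X (p, q) ≃ₗ[ℂ] (N p).CohomologyC q,
          ∀ η : approxCycles D.dbar (filtrationC 𝒜 ℰ (smoothSections E F V)) 1 p (p + q),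
          ∃ s : cocycles (N p).dbar
              (ℰ.formsDegC (BSections 𝒜 ℰ (smoothSections E F V) p)) q,
            IsSymbol h p η.1.1 s.1.1 ∧
            e (Sp.repr 1 le_rfl p q η) = Cohomology.mk _ _ _ s) ∧
        -- convergence to the compactly supported cohomology `H_{𝒜,c}(M, V)`
        Sp.Converges := by
  have hΓ : SmoothClosed E (smoothSections E F V) := smoothClosed_smoothSections F V
  have hK := isFilteredComplex_filtrationC hΓ h D
  refine ⟨inducedStructure hΓ h D, fun p N' => isInduced_iff hΓ h D p N',
    fun p n η hη => dbar_mem_filtrationC hΓ h D hη, filtrationC_succ_le 𝒜 ℰ _,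
    filtrationC_zero 𝒜 ℰ _, filtrationC_eq_bot 𝒜 ℰ _, spectralSequenceOf hK, fun p q => ?_,
    spectralSequenceOf_converges hK⟩
  obtain ⟨Ψ, hΨ, hsurj, hker⟩ := exists_firstPage_filtrationC hΓ h D p q
  obtain ⟨e, he⟩ := (spectralSequenceOf hK).exists_firstPage_equiv le_rfl hsurj hker
  exact ⟨e, fun η => ⟨Ψ η, hΨ η, he η⟩⟩
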